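/- Let $\lambda\in\mathbb R\setminus\{0\}$ and $\mathcal T>0$. Let $\mathbb T=\mathbb R/\mathcal T\mathbb Z$ carry the Haar measure of total mass $1$, and let $G=\mathbb T\times\mathbb R^3$ carry the product of this measure with Lebesgue measure. Let $\mathscr S(G)$ be the Schwartz–Bruhat space, i.e. the smooth functions on $G$ all of whose derivatives in $(t,x)$ decay faster than any power of $|x|$, and let $\mathscr S'(G)$ be its dual. Let $\Gamma_\perp$ be the purely periodic part of the velocity fundamental solution of the time-periodic Oseen system, that is, the matrix-valued tempered distribution $$ \Gamma_\perp=\mathscr F_G^{-1}\!\left[\frac{1-\delta_{\mathbb Z}(k)}{|\xi|^2+i\left(\frac{2\pi}{\mathcal T}k-\lambda\xi_1\right)}\left(I-\frac{\xi\otimes\xi}{|\xi|^2}\right)\right]\in\mathscr S'(G)^{3\times3}, $$ where $\delta_{\mathbb Z}(k)=1$ if $k=0$ and $\delta_{\mathbb Z}(k)=0$ otherwise, and $\mathscr F_G^{-1}$ is given by duality, $\langle\mathscr F_G^{-1}m,\varphi\rangle=\sum_{k\in\mathbb Z}\int_{\mathbb R^3}m(k,\xi)\int_G\varphi(t,x)\,e^{i(\frac{2\pi}{\mathcal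 T}kt+\xi\cdot x)}\,\mathrm d(t,x)\,\frac{\mathrm d\xi}{(2\pi)^3}$ for $\varphi\in\mathscr S(G)$. Then $\Gamma_\perp$ and its distributional spatial gradient $\nabla\Gamma_\perp$ are given by functions on $G$ (determined almost everywhere, and again denoted by $\Gamma_\perp$ and $\nabla\Gamma_\perp$), and the following holds. For all $A\in(0,\infty)$ and $\varepsilon>0$ there is a constant $C=C(A,\lambda,\mathcal T,\varepsilon)>0$ such that for all $M\in\mathbb R$ and all real-valued $g\in L^\infty(G)$ with $|g(t,x)|\le M(1+|x|)^{-A}$ for almost every $(t,x)\in G$, and for all $t\in\mathbb T$ and all $x\in\mathbb R^3$ with $|x|\ge\varepsilon$, the integral defining $|\nabla\Gamma_\perp|*_G g\,(t,x)$ converges absolutely and $$ \bigl|\,|\nabla\Gamma_\perp|*_G g\,(t,x)\bigr|\le C\,M\,(1+|x|)^{-\min\{A,4\}}, $$ and, if $A>3$, the integral defining $|\Gamma_\perp|*_G g\,(t,x)$ converges absolutely and $$ \bigl|\,|\Gamma_\perp|*_G g\,(t,x)\bigr|\le C\,M\,(1+|x|)^{-3}. $$ Here $|\cdot|$ is the Euclidean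 norm of the array of components, and $*_G$ is convolution on the group $G$. -/

import Mathlib

open MeasureTheory
open scoped ContDiff Convolution ENNReal

noncomputable section

namespace TPOseen

/-- The space `ℝ³` with its Euclidean norm. -/
abbrev E3 : Type := EuclideanSpace ℝ (Fin 3)

/-- The group `G = 𝕋 × ℝ³`, where `𝕋 = ℝ / Tℤ`. -/
abbrev G (T : ℝ) : Type := AddCircle T × E3

/-- The measure on `G`: the Haar measure of total mass one on `𝕋`, times Lebesgue measure. -/
def haarG (T : ℝ) [Fact (0 < T)] : Measure (G T) :=
  (AddCircle.haarAddCircle : Measure (AddCircle T)).prod (volume : Measure E3)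

/-- The Schwartz-Bruhat functions on `G`: smooth functions, all of whose derivatives in `(t, x)`
decay faster than every power of `|x|`. Derivatives are those of the lift to `ℝ × ℝ³`. -/
structure IsSchwartzBruhat (T : ℝ) (φ : G T → ℂ) : Prop where
  smooth : ContDiff ℝ ∞ (fun p : ℝ × E3 => φ ((p.1 : AddCircle T), p.2))
  decay : ∀ m n : ℕ, ∃ C : ℝ, ∀ (t : ℝ) (x : E3),
    (1 + ‖x‖) ^ m *
      ‖iteratedFDeriv ℝ n (fun p : ℝ × E3 => φ ((p.1 : AddCircle T), p.2)) (t, x)‖ ≤ C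

/-- The spatial partial derivative `∂φ/∂xᵢ` of a function on `G`. -/
def spaceDeriv {T : ℝ} (i : Fin 3) (φ : G T → ℂ) : G T → ℂ :=
  fun p => fderiv ℝ (fun y : E3 => φ (p.1, y)) p.2 (EuclideanSpace.single i 1)

/-- The function `(k, ξ) ↦ ∫_G φ(t, x) exp(i (2πkt/T + ξ·x)) d(t, x)` on the dual group
`ℤ × ℝ³`. -/
def invFourierG {T : ℝ} [Fact (0 < T)] (φ : G T → ℂ) (k : ℤ) (ξ : E3) : ℂ :=
  ∫ p, fourier k p.1 * Complex.exp (Complex.I * ((inner ℝ ξ p.2 : ℝ) : ℂ)) * φ p ∂(haarG T)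

/-- The inverse Fourier transform, as a distribution on `G`, of a function `m` on `ℤ × ℝ³`,
defined by duality: `⟨𝓕⁻¹ m, φ⟩ = ⟨m, 𝓕⁻¹ φ⟩`. The measure on `ℤ × ℝ³` is the one dual to
`haarG`, that is, counting measure times `(2π)⁻³ dξ`. Distributions are functionals that are
evaluated only at Schwartz-Bruhat functions. -/
def invFourierDistribution {T : ℝ} [Fact (0 < T)] (m : ℤ → E3 → ℂ) (φ : G T → ℂ) : ℂ :=
  ∑' k : ℤ, (((2 * Real.pi) ^ 3 : ℝ) : ℂ)⁻¹ * ∫ ξ : E3, m k ξ * invFourierG φ k ξ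

/-- The `(j, l)` entry of the Fourier symbol
`(1 - δ(k)) / (|ξ|² + i (2πk/T - λξ₁)) (I - ξ ⊗ ξ / |ξ|²)`. -/
def symbolPerp (T lam : ℝ) (j l : Fin 3) (k : ℤ) (ξ : E3) : ℂ :=
  ((1 - if k = 0 then 1 else 0 : ℝ) : ℂ) /
      (((‖ξ‖ ^ 2 : ℝ) : ℂ) +
        Complex.I * ((2 * Real.pi / T * (k : ℝ) - lam * ξ 0 : ℝ) : ℂ)) *
    (((if j = l then 1 else 0) - ξ j * ξ l / ‖ξ‖ ^ 2 : ℝ) : ℂ)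

/-- The `(j, l)` entry of the purely periodic velocity fundamental solution, a distribution
on `G`. -/
def gammaPerp (T lam : ℝ) [Fact (0 < T)] (j l : Fin 3) : (G T → ℂ) → ℂ :=
  invFourierDistribution (symbolPerp T lam j l)

/-- The distributional derivative `∂/∂xᵢ` of a distribution on `G`. -/
def distribDeriv {T : ℝ} (i : Fin 3) (u : (G T → ℂ) → ℂ) : (G T → ℂ) → ℂ :=
  fun φ => -u (spaceDeriv i φ)

/-- The distribution `u` on `G` is given by the function `f`. Integrability against all
Schwartz-Bruhat functions makes `f` almost everywhere strongly measurable and locally integrable,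
so `f` is determined by `u` almost everywhere. -/
structure IsGivenBy {T : ℝ} [Fact (0 < T)] (u : (G T → ℂ) → ℂ) (f : G T → ℂ) : Prop where
  integrable : ∀ φ : G T → ℂ, IsSchwartzBruhat T φ → Integrable (fun p => f p * φ p) (haarG T)
  eq_integral : ∀ φ : G T → ℂ, IsSchwartzBruhat T φ → u φ = ∫ p, f p * φ p ∂(haarG T)

/-- `Γ` is a matrix-valued function which represents the purely periodic velocity fundamental
solution. -/
def IsGammaPerp (T lam : ℝ) [Fact (0 < T)] (Γ : G T → Matrix (Fin 3) (Fin 3) ℂ) : Prop :=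
  ∀ j l : Fin 3, IsGivenBy (gammaPerp T lam j l) (fun p => Γ p j l)

/-- `DΓ i` represents the distributional derivative with respect to `xᵢ` of the purely periodic
velocity fundamental solution, for `i = 1, 2, 3`. -/
def IsGradGammaPerp (T lam : ℝ) [Fact (0 < T)]
    (DΓ : Fin 3 → G T → Matrix (Fin 3) (Fin 3) ℂ) : Prop :=
  ∀ i j l : Fin 3, IsGivenBy (distribDeriv i (gammaPerp T lam j l)) (fun p => DΓ i p j l)

/-- The pointwise Euclidean norm `|Γ|` of a matrix field. -/
def absMatrix {T : ℝ} (Γ : G T → Matrix (Fin 3) (Fin 3) ℂ) : G T → ℝ :=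
  fun p => Real.sqrt (∑ j, ∑ l, ‖Γ p j l‖ ^ 2)

/-- The pointwise Euclidean norm `|∇Γ|` of the gradient of a matrix field. -/
def absGrad {T : ℝ} (DΓ : Fin 3 → G T → Matrix (Fin 3) (Fin 3) ℂ) : G T → ℝ :=
  fun p => Real.sqrt (∑ i, ∑ j, ∑ l, ‖DΓ i p j l‖ ^ 2)

/-- The convolution integral `(f * g)(t, x)` on `G` exists. -/
def ConvExistsG {T : ℝ} [Fact (0 < T)] (f g : G T → ℝ) (p : G T) : Prop :=
  ConvolutionExistsAt f g p (ContinuousLinearMap.mul ℝ ℝ) (haarG T)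

/-- The convolution `(f * g)(t, x)` on the group `G`. -/
def convG {T : ℝ} [Fact (0 < T)] (f g : G T → ℝ) (p : G T) : ℝ :=
  (f ⋆[ContinuousLinearMap.mul ℝ ℝ, haarG T] g) p

end TPOseen

end

namespace TPOseen

open Filter Topology Set

/-! ### Gaussian integrals with weights of temperate growth -/

/-! Integrating `exp(s(-|ξ|² + iλξ₁ - 2πik/T))` over `s > 0` produces the reciprocal of the
denominator of the symbol. So the fundamental solution is, in time, the periodization of the Cauchy
kernel `K(s, x)` whose spatial symbol is `exp(s(-|ξ|² + iλξ₁)) P(ξ)/|ξ|²`, and removing `k = 0`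
subtracts its time mean: the function is `T ∑ⱼ K(t + jT, x) - ∫₀^∞ K(s, x) ds` for `t ∈ (0, T]`.
Here `P` is homogeneous of degree `m`, with `m = 2` for the velocity and `m = 3` for its gradient.

Scaling and the translation caused by the drift give `|K| ≤ C D^(-(m+1)/2)` with `D = s + |x + λs
e₁|²`. Each time derivative multiplies the symbol by `-|ξ|² + iλξ₁` and gains a factor `D^(-1/2)`
away from the singularity. The difference between a Riemann sum and its integral is controlled, as
in the Euler-Maclaurin formula, by the derivatives of `K` at `s = 0+` and by the integral of one
high derivative. At small times `D ≥ |x|²/4`, and in the wake `D ≥ c(s + |x|)`, so with enough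
derivatives the periodic kernel is `O(|x|^(-(m+1)))` uniformly in time
(`IsHomSymbol.exists_norm_periodicPart_oseenKernel_le`).

That this function represents the distribution (`IsHomSymbol.hasSum_integral_kernelFun`) follows by
unfolding its pairing with a test function and evaluating at `0` the Fourier series of a continuous
time correlation. By `IsGivenBy.ae_eq` any other representative agrees with it almost everywhere.
The convolution bounds then need only the pointwise decay, the local integrability, and a split of
the domain according to whether `|x - y|` exceeds `|x|/2` (`exists_lintegral_mul_rpow_le`). -/

/-- The plane wave `exp(i ξ·x)`. -/
noncomputable def planeWave (ξ x : E3) : ℂ := Complex.exp (Complex.I * ((inner ℝ ξ x : ℝ) : ℂ))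

lemma norm_planeWave (ξ x : E3) : ‖planeWave ξ x‖ = 1 := by
  rw [planeWave, mul_comm]; exact Complex.norm_exp_ofReal_mul_I _

@[fun_prop]
lemma continuous_planeWave : Continuous fun p : E3 × E3 => planeWave p.1 p.2 := by
  unfold planeWave; fun_prop

lemma planeWave_comm (ξ x : E3) : planeWave ξ x = planeWave x ξ := by
  rw [planeWave, planeWave, real_inner_comm]

lemma hasFDerivAt_planeWave (ξ x : E3) :
    HasFDerivAt (planeWave ξ) (planeWave ξ x • Complex.I •
      (Complex.ofRealCLM.comp (innerSL ℝ ξ))) x := by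
  have h : HasFDerivAt (fun x : E3 => Complex.I * ((inner ℝ ξ x : ℝ) : ℂ))
      (Complex.I • (Complex.ofRealCLM.comp (innerSL ℝ ξ))) x :=
    ((Complex.ofRealCLM.comp (innerSL ℝ ξ)).hasFDerivAt (x := x)).const_mul Complex.I
  exact h.cexp

lemma exists_one_add_pow_mul_exp_neg_sq_le (n : ℕ) {a : ℝ} (ha : 0 < a) :
    ∃ C, 0 ≤ C ∧ ∀ r : ℝ, 0 ≤ r → (1 + r) ^ n * Real.exp (-a * r ^ 2) ≤ C := by
  refine ⟨n.factorial * Real.exp (1 + 1 / (4 * a)), by positivity, fun r hr => ?_⟩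
  have h1 : (1 + r) ^ n ≤ n.factorial * Real.exp (1 + r) := by
    have := Real.pow_div_factorial_le_exp (1 + r) (by positivity) n
    rwa [div_le_iff₀' (by positivity)] at this
  have h2 : r - a * r ^ 2 ≤ 1 / (4 * a) := by
    rw [le_div_iff₀ (by positivity)]; nlinarith [sq_nonneg (2 * a * r - 1)]
  calc (1 + r) ^ n * Real.exp (-a * r ^ 2)
      ≤ n.factorial * Real.exp (1 + r) * Real.exp (-a * r ^ 2) := by gcongr
    _ = n.factorial * Real.exp (1 + r + -a * r ^ 2) := by rw [mul_assoc, ← Real.exp_add]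
    _ ≤ _ := by
      have : 1 + r + -a * r ^ 2 ≤ 1 + 1 / (4 * a) := by linarith
      gcongr

lemma integrable_one_add_norm_pow_mul_exp (n : ℕ) {a : ℝ} (ha : 0 < a) :
    Integrable fun ξ : E3 => (1 + ‖ξ‖) ^ n * Real.exp (-a * ‖ξ‖ ^ 2) := by
  obtain ⟨C, hC, h⟩ := exists_one_add_pow_mul_exp_neg_sq_le (n + 4) ha
  have hi : Integrable fun ξ : E3 => C * (1 + ‖ξ‖) ^ (-4 : ℝ) :=
    (integrable_one_add_norm (by simp; norm_num)).const_mul C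
  refine hi.mono' (by fun_prop) (ae_of_all _ fun ξ => ?_)
  have h0 := h ‖ξ‖ (norm_nonneg _)
  rw [Real.norm_of_nonneg (by positivity), Real.rpow_neg (by positivity), ← div_eq_mul_inv,
    le_div_iff₀ (by positivity)]
  norm_cast
  calc _ = (1 + ‖ξ‖) ^ (n + 4) * Real.exp (-a * ‖ξ‖ ^ 2) := by rw [pow_add]; ring
    _ ≤ C := h0

lemma integrable_mul_exp_of_polynomial_bound {P : E3 → ℂ} (hm : AEStronglyMeasurable P volume)
    {C : ℝ} {n : ℕ} (hP : ∀ ξ, ‖P ξ‖ ≤ C * (1 + ‖ξ‖) ^ n) {a : ℝ} (ha : 0 < a) :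
    Integrable fun ξ : E3 => P ξ * (Real.exp (-a * ‖ξ‖ ^ 2) : ℝ) := by
  refine ((integrable_one_add_norm_pow_mul_exp n ha).const_mul C).mono'
    (hm.mul (by fun_prop)) (ae_of_all _ fun ξ => ?_)
  rw [norm_mul, Complex.norm_real, Real.norm_of_nonneg (Real.exp_nonneg _), ← mul_assoc]
  gcongr
  exact hP ξ

lemma HasTemperateGrowth.fderiv {P : E3 → ℂ} (hP : Function.HasTemperateGrowth P) :
    Function.HasTemperateGrowth (_root_.fderiv ℝ P) := by
  refine ⟨hP.1.fderiv_right (by norm_num), fun n => ?_⟩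
  obtain ⟨k, C, h⟩ := hP.2 (n + 1)
  exact ⟨k, C, fun x => by rw [norm_iteratedFDeriv_fderiv]; exact h x⟩

lemma HasTemperateGrowth.lineDeriv {P : E3 → ℂ} (hP : Function.HasTemperateGrowth P) (v : E3) :
    Function.HasTemperateGrowth (fun ξ => _root_.fderiv ℝ P ξ v) :=
  (ContinuousLinearMap.apply ℝ ℂ v).hasTemperateGrowth.comp (HasTemperateGrowth.fderiv hP)

lemma HasTemperateGrowth.exists_bound {P : E3 → ℂ} (hP : Function.HasTemperateGrowth P) :
    ∃ (n : ℕ) (C : ℝ), ∀ ξ, ‖P ξ‖ ≤ C * (1 + ‖ξ‖) ^ n := by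
  obtain ⟨n, C, h⟩ := hP.2 0
  exact ⟨n, C, fun ξ => by simpa using h ξ⟩

lemma HasTemperateGrowth.integrable_mul_exp {P : E3 → ℂ} (hP : Function.HasTemperateGrowth P)
    {a : ℝ} (ha : 0 < a) : Integrable fun ξ : E3 => P ξ * (Real.exp (-a * ‖ξ‖ ^ 2) : ℝ) := by
  obtain ⟨n, C, h⟩ := HasTemperateGrowth.exists_bound hP
  exact integrable_mul_exp_of_polynomial_bound hP.1.continuous.aestronglyMeasurable h ha

/-- The inverse Fourier integral of `P(ξ) exp(-τ|ξ|²)`, without the factor `(2π)⁻³`. -/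
noncomputable def gaussIntegral (P : E3 → ℂ) (τ : ℝ) (y : E3) : ℂ :=
  ∫ ξ : E3, planeWave ξ y * (P ξ * (Real.exp (-τ * ‖ξ‖ ^ 2) : ℝ))

lemma integrable_planeWave_mul {f : E3 → ℂ} (hf : Integrable f) (y : E3) :
    Integrable fun ξ => planeWave ξ y * f ξ := by
  refine hf.norm.mono' (AEStronglyMeasurable.mul (by fun_prop) hf.1) (ae_of_all _ fun ξ => ?_)
  rw [norm_mul, norm_planeWave, one_mul]

lemma norm_gaussIntegral_le (P : E3 → ℂ) (τ : ℝ) (y : E3) :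
    ‖gaussIntegral P τ y‖ ≤ ∫ ξ : E3, ‖P ξ * (Real.exp (-τ * ‖ξ‖ ^ 2) : ℝ)‖ := by
  refine (norm_integral_le_integral_norm _).trans_eq ?_
  simp_rw [norm_mul, norm_planeWave, one_mul]

/-- Integration by parts in a Gaussian integral. -/
lemma coord_mul_gaussIntegral {P : E3 → ℂ} (hP : Function.HasTemperateGrowth P) (y v : E3) :
    (Complex.I * ((inner ℝ y v : ℝ) : ℂ)) * gaussIntegral P 1 y =
      - gaussIntegral (fun ξ => fderiv ℝ P ξ v - 2 * ((inner ℝ ξ v : ℝ) : ℂ) * P ξ) 1 y := by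
  have hg : ∀ ξ : E3, HasFDerivAt (fun ξ : E3 => ((Real.exp (-1 * ‖ξ‖ ^ 2) : ℝ) : ℂ))
      (Complex.ofRealCLM.comp (Real.exp (-1 * ‖ξ‖ ^ 2) • ((-1 : ℝ) • (2 • innerSL ℝ ξ)))) ξ :=
    fun ξ => Complex.ofRealCLM.hasFDerivAt.comp ξ
      ((((hasStrictFDerivAt_norm_sq ξ).hasFDerivAt).const_mul (-1 : ℝ)).exp)
  have hQ : Function.HasTemperateGrowth
      (fun ξ => fderiv ℝ P ξ v - 2 * ((inner ℝ ξ v : ℝ) : ℂ) * P ξ) := by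
    have h1 := HasTemperateGrowth.lineDeriv hP v
    have h2 : Function.HasTemperateGrowth fun ξ : E3 => ((inner ℝ ξ v : ℝ) : ℂ) :=
      Function.Complex.hasTemperateGrowth_ofReal.comp (Function.hasTemperateGrowth_inner_left v)
    exact h1.sub (((Function.HasTemperateGrowth.const 2).mul h2).mul hP)
  have hPd : ∀ ξ, HasFDerivAt P (fderiv ℝ P ξ) ξ := fun ξ =>
    (hP.1.differentiable (by simp) ξ).hasFDerivAt
  have hprod : ∀ ξ : E3, HasFDerivAt (fun ξ : E3 => P ξ * ((Real.exp (-1 * ‖ξ‖ ^ 2) : ℝ) : ℂ)) _ ξ :=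
    fun ξ => (hPd ξ).mul (hg ξ)
  have hprod' : ∀ ξ : E3, fderiv ℝ (fun ξ : E3 => P ξ * ((Real.exp (-1 * ‖ξ‖ ^ 2) : ℝ) : ℂ)) ξ v =
      (fderiv ℝ P ξ v - 2 * ((inner ℝ ξ v : ℝ) : ℂ) * P ξ) * (Real.exp (-1 * ‖ξ‖ ^ 2) : ℝ) := by
    intro ξ
    rw [(hprod ξ).fderiv]
    simp
    ring
  have hwave : ∀ ξ, fderiv ℝ (fun ξ => planeWave ξ y) ξ v =
      Complex.I * ((inner ℝ y v : ℝ) : ℂ) * planeWave ξ y := by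
    intro ξ
    have : (fun ξ => planeWave ξ y) = planeWave y := funext fun ξ => planeWave_comm _ _
    rw [this, (hasFDerivAt_planeWave y ξ).fderiv, planeWave_comm ξ y]
    simp
    ring
  have hIP := HasTemperateGrowth.integrable_mul_exp hP one_pos
  have hIQ := HasTemperateGrowth.integrable_mul_exp hQ one_pos
  have key := integral_mul_fderiv_eq_neg_fderiv_mul_of_integrable (μ := (volume : Measure E3))
    (f := fun ξ : E3 => P ξ * ((Real.exp (-1 * ‖ξ‖ ^ 2) : ℝ) : ℂ)) (g := fun ξ => planeWave ξ y)
    (v := v) ?_ ?_ ?_ (fun ξ _ => (hprod ξ).differentiableAt)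
    (fun ξ _ => by
      have : (fun ξ => planeWave ξ y) = planeWave y := funext fun ξ => planeWave_comm _ _
      rw [this]; exact (hasFDerivAt_planeWave y ξ).differentiableAt)
  · simp_rw [hprod', hwave] at key
    rw [gaussIntegral, gaussIntegral, ← integral_const_mul]
    refine Eq.trans ?_ (key.trans ?_)
    · congr 1; ext ξ; ring
    · congr 2; ext ξ; ring
  · simp_rw [hprod']
    simpa only [mul_comm] using! integrable_planeWave_mul hIQ y
  · simp_rw [hwave]
    convert (integrable_planeWave_mul hIP y).const_mul (Complex.I * ((inner ℝ y v : ℝ) : ℂ)) using 2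
    ring
  · simpa only [mul_comm] using! integrable_planeWave_mul hIP y

/-- By `coord_mul_gaussIntegral`, a power of the coordinate can be traded for a new symbol of
temperate growth. Since the symbol changes at each step, the induction runs over all symbols at
once. -/
lemma abs_inner_pow_mul_norm_gaussIntegral_le (v : E3) (n : ℕ) :
    ∀ {P : E3 → ℂ}, Function.HasTemperateGrowth P →
      ∃ C, ∀ y, |inner ℝ y v| ^ n * ‖gaussIntegral P 1 y‖ ≤ C := by
  induction n with
  | zero =>
    intro P _
    exact ⟨_, fun y => by rw [pow_zero, one_mul]; exact norm_gaussIntegral_le P 1 y⟩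
  | succ n ih =>
    intro P hP
    have hQ : Function.HasTemperateGrowth
        (fun ξ => fderiv ℝ P ξ v - 2 * ((inner ℝ ξ v : ℝ) : ℂ) * P ξ) := by
      have h1 := HasTemperateGrowth.lineDeriv hP v
      have h2 : Function.HasTemperateGrowth fun ξ : E3 => ((inner ℝ ξ v : ℝ) : ℂ) :=
        Function.Complex.hasTemperateGrowth_ofReal.comp (Function.hasTemperateGrowth_inner_left v)
      exact h1.sub (((Function.HasTemperateGrowth.const 2).mul h2).mul hP)
    obtain ⟨C, hC⟩ := ih hQ
    refine ⟨C, fun y => ?_⟩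
    have := congrArg norm (coord_mul_gaussIntegral hP y v)
    rw [norm_mul, norm_neg, norm_mul, Complex.norm_I, one_mul, Complex.norm_real,
      Real.norm_eq_abs] at this
    rw [pow_succ, mul_assoc, this]
    exact hC y

lemma norm_pow_le_sum_coord (n : ℕ) (y : E3) :
    ‖y‖ ^ n ≤ 3 ^ n * ∑ i : Fin 3, |y i| ^ n := by
  obtain ⟨i, hi⟩ : ∃ i, ∀ j, |y j| ≤ |y i| := by
    obtain ⟨i, -, hi⟩ := Finset.exists_max_image Finset.univ (fun i => |y i|) ⟨0, by simp⟩
    exact ⟨i, fun j => hi j (Finset.mem_univ _)⟩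
  have h1 : ‖y‖ ≤ 3 * |y i| := by
    rw [EuclideanSpace.norm_eq]
    apply Real.sqrt_le_iff.2 ⟨by positivity, ?_⟩
    rw [Fin.sum_univ_three]
    simp only [Real.norm_eq_abs]
    have := fun j => pow_le_pow_left₀ (abs_nonneg _) (hi j) 2
    nlinarith [this 0, this 1, this 2, sq_nonneg (|y i|)]
  calc ‖y‖ ^ n ≤ (3 * |y i|) ^ n := by gcongr
    _ = 3 ^ n * |y i| ^ n := by rw [mul_pow]
    _ ≤ _ := by
      gcongr
      exact Finset.single_le_sum (f := fun i => |y i| ^ n) (fun j _ => by positivity)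
        (Finset.mem_univ i)

lemma one_add_norm_pow_le (n : ℕ) (y : E3) :
    (1 + ‖y‖) ^ n ≤ 2 ^ n * (1 + 3 ^ n * ∑ i : Fin 3, |y i| ^ n) := by
  have h := norm_pow_le_sum_coord n y
  have hpos : 0 ≤ ∑ i : Fin 3, |y i| ^ n := Finset.sum_nonneg fun i _ => by positivity
  rcases le_total ‖y‖ 1 with h1 | h1
  · calc (1 + ‖y‖) ^ n ≤ 2 ^ n * 1 := by rw [mul_one]; gcongr; linarith
      _ ≤ _ := by gcongr; linarith [mul_nonneg (by positivity : (0 : ℝ) ≤ 3 ^ n) hpos]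
  · calc (1 + ‖y‖) ^ n ≤ (2 * ‖y‖) ^ n := by gcongr; linarith
      _ = 2 ^ n * ‖y‖ ^ n := mul_pow _ _ _
      _ ≤ _ := by gcongr; linarith

lemma exists_norm_gaussIntegral_le (n : ℕ) {P : E3 → ℂ} (hP : Function.HasTemperateGrowth P) :
    ∃ C, ∀ y, (1 + ‖y‖) ^ n * ‖gaussIntegral P 1 y‖ ≤ C := by
  have h := fun i : Fin 3 =>
    abs_inner_pow_mul_norm_gaussIntegral_le (EuclideanSpace.single i (1 : ℝ)) n hP
  choose C hC using h
  refine ⟨2 ^ n * ((∫ ξ : E3, ‖P ξ * (Real.exp (-1 * ‖ξ‖ ^ 2) : ℝ)‖) + 3 ^ n * ∑ i, C i),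
    fun y => ?_⟩
  calc (1 + ‖y‖) ^ n * ‖gaussIntegral P 1 y‖
      ≤ 2 ^ n * (1 + 3 ^ n * ∑ i : Fin 3, |y i| ^ n) * ‖gaussIntegral P 1 y‖ := by
        gcongr; exact one_add_norm_pow_le n y
    _ = 2 ^ n * (‖gaussIntegral P 1 y‖ +
          3 ^ n * ∑ i : Fin 3, |y i| ^ n * ‖gaussIntegral P 1 y‖) := by
        rw [← Finset.sum_mul]; ring
    _ ≤ _ := by
        gcongr with i
        · exact norm_gaussIntegral_le P 1 y
        · simpa [EuclideanSpace.inner_single_right] using hC i y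

/-! ### The Oseen heat kernel with a homogeneous symbol -/

/-- Smooth symbols on `ℝ³` which are positively homogeneous of degree `m`. -/
structure IsHomSymbol (m : ℕ) (P : E3 → ℂ) : Prop where
  temperate : Function.HasTemperateGrowth P
  hom : ∀ c : ℝ, 0 < c → ∀ ξ, P (c • ξ) = (c : ℂ) ^ m * P ξ

lemma IsHomSymbol.mul {m n : ℕ} {P Q : E3 → ℂ} (hP : IsHomSymbol m P) (hQ : IsHomSymbol n Q) :
    IsHomSymbol (m + n) (fun ξ => P ξ * Q ξ) where
  temperate := hP.temperate.mul hQ.temperate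
  hom c hc ξ := by rw [hP.hom c hc, hQ.hom c hc, pow_add]; ring

lemma IsHomSymbol.const_mul {m : ℕ} {P : E3 → ℂ} (hP : IsHomSymbol m P) (a : ℂ) :
    IsHomSymbol m (fun ξ => a * P ξ) where
  temperate := (Function.HasTemperateGrowth.const a).mul hP.temperate
  hom c hc ξ := by rw [hP.hom c hc]; ring

lemma IsHomSymbol.sub {m : ℕ} {P Q : E3 → ℂ} (hP : IsHomSymbol m P) (hQ : IsHomSymbol m Q) :
    IsHomSymbol m (fun ξ => P ξ - Q ξ) where
  temperate := hP.temperate.sub hQ.temperate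
  hom c hc ξ := by rw [hP.hom c hc, hQ.hom c hc]; ring

lemma isHomSymbol_normSq : IsHomSymbol 2 (fun ξ => ((‖ξ‖ ^ 2 : ℝ) : ℂ)) where
  temperate := Function.Complex.hasTemperateGrowth_ofReal.comp
    (Function.hasTemperateGrowth_norm_sq (H := E3))
  hom c hc ξ := by rw [norm_smul, mul_pow, Real.norm_eq_abs, sq_abs]; push_cast; ring

lemma isHomSymbol_coord (i : Fin 3) : IsHomSymbol 1 (fun ξ => ((ξ i : ℝ) : ℂ)) where
  temperate := (Complex.ofRealCLM.comp (EuclideanSpace.proj i : E3 →L[ℝ] ℝ)).hasTemperateGrowth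
  hom c hc ξ := by simp

/-- Homogeneity reduces the bound to the unit sphere, where polynomial growth gives `C * 2 ^ n`. At
the origin, scaling by `2` with `m ≠ 0` forces the value zero. -/
lemma IsHomSymbol.norm_le {m : ℕ} {P : E3 → ℂ} (hP : IsHomSymbol m P) (hm : m ≠ 0) :
    ∃ C, 0 ≤ C ∧ ∀ ξ, ‖P ξ‖ ≤ C * ‖ξ‖ ^ m := by
  obtain ⟨n, C, h⟩ := HasTemperateGrowth.exists_bound hP.temperate
  have hC : 0 ≤ C := by
    have := (norm_nonneg _).trans (h 0)
    simpa using this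
  refine ⟨C * 2 ^ n, by positivity, fun ξ => ?_⟩
  rcases eq_or_ne ξ 0 with rfl | hξ
  · have h2 := hP.hom 2 two_pos 0
    rw [smul_zero] at h2
    have h3 : ((2 : ℝ) : ℂ) ^ m ≠ 1 := by
      norm_cast
      exact (one_lt_pow₀ (by norm_num) hm).ne'
    have : P 0 = 0 := by
      by_contra h0
      exact h3 (mul_right_cancel₀ h0 (by rw [one_mul]; exact h2.symm))
    simp [this, hm]
  · have hpos : 0 < ‖ξ‖ := norm_pos_iff.2 hξ
    have h1 := hP.hom ‖ξ‖ hpos (‖ξ‖⁻¹ • ξ)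
    rw [smul_smul, mul_inv_cancel₀ hpos.ne', one_smul] at h1
    have h2 := h (‖ξ‖⁻¹ • ξ)
    rw [norm_smul, norm_inv, norm_norm, inv_mul_cancel₀ hpos.ne', one_add_one_eq_two] at h2
    rw [h1, norm_mul, norm_pow, Complex.norm_real, norm_norm, mul_comm]
    gcongr

/-- Substitution `ξ ↦ √τ ξ`: the symbol contributes `m` powers of `√τ` and the Jacobian three. -/
lemma IsHomSymbol.gaussIntegral_eq {m : ℕ} {P : E3 → ℂ} (hP : IsHomSymbol m P) {τ : ℝ}
    (hτ : 0 < τ) (y : E3) :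
    ((√τ : ℝ) : ℂ) ^ (m + 3) * gaussIntegral P τ y = gaussIntegral P 1 ((√τ)⁻¹ • y) := by
  have hs : 0 < √τ := Real.sqrt_pos.2 hτ
  have h := Measure.integral_comp_smul (volume : Measure E3)
    (fun ξ => planeWave ξ ((√τ)⁻¹ • y) * (P ξ * (Real.exp (-1 * ‖ξ‖ ^ 2) : ℝ))) (√τ)
  rw [← gaussIntegral] at h
  have h2 : ∀ ξ : E3, planeWave (√τ • ξ) ((√τ)⁻¹ • y) *
      (P (√τ • ξ) * (Real.exp (-1 * ‖√τ • ξ‖ ^ 2) : ℝ)) =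
      ((√τ : ℝ) : ℂ) ^ m * (planeWave ξ y * (P ξ * (Real.exp (-τ * ‖ξ‖ ^ 2) : ℝ))) := by
    intro ξ
    rw [hP.hom _ hs, norm_smul, mul_pow, Real.norm_eq_abs, sq_abs, Real.sq_sqrt hτ.le, planeWave,
      inner_smul_left, inner_smul_right, ← mul_assoc (starRingEnd ℝ √τ), planeWave]
    simp only [conj_trivial, mul_inv_cancel₀ hs.ne', one_mul]
    ring_nf
  simp_rw [h2] at h
  rw [integral_const_mul, ← gaussIntegral, finrank_euclideanSpace_fin, abs_of_pos (by positivity),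
    Complex.real_smul] at h
  have h3 : ((√τ : ℝ) : ℂ) ≠ 0 := by exact_mod_cast hs.ne'
  rw [pow_add, mul_comm (_ ^ m), mul_assoc, h]
  push_cast
  field_simp

/-- Decay of order exactly `m + 3` at `τ = 1` combines with the scaling factor into `(√τ + ‖y‖) ^ (m
+ 3)`, which dominates the parabolic distance to that power. -/
lemma IsHomSymbol.norm_gaussIntegral_le {m : ℕ} {P : E3 → ℂ} (hP : IsHomSymbol m P) :
    ∃ C, 0 ≤ C ∧ ∀ τ : ℝ, 0 < τ → ∀ y,
      ‖gaussIntegral P τ y‖ ≤ C * (τ + ‖y‖ ^ 2) ^ (-((m + 3 : ℝ) / 2)) := by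
  obtain ⟨C, hC⟩ := exists_norm_gaussIntegral_le (m + 3) hP.temperate
  have hC0 : 0 ≤ C := (by positivity : (0 : ℝ) ≤ _).trans (hC 0)
  refine ⟨C, hC0, fun τ hτ y => ?_⟩
  have hs : 0 < √τ := Real.sqrt_pos.2 hτ
  have h := hC ((√τ)⁻¹ • y)
  rw [← hP.gaussIntegral_eq hτ, norm_mul, norm_pow, Complex.norm_real, Real.norm_of_nonneg hs.le,
    ← mul_assoc, ← mul_pow, norm_smul, norm_inv, Real.norm_of_nonneg hs.le] at h
  have h1 : (1 + (√τ)⁻¹ * ‖y‖) * √τ = √τ + ‖y‖ := by field_simp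
  rw [h1] at h
  have h2 : √(τ + ‖y‖ ^ 2) ≤ √τ + ‖y‖ := by
    rw [Real.sqrt_le_left (by positivity)]
    nlinarith [Real.sq_sqrt hτ.le, norm_nonneg y]
  have h3 : √(τ + ‖y‖ ^ 2) ^ (m + 3) = (τ + ‖y‖ ^ 2) ^ ((m + 3 : ℝ) / 2) := by
    rw [Real.sqrt_eq_rpow, ← Real.rpow_natCast, ← Real.rpow_mul (by positivity)]
    push_cast; ring_nf
  rw [Real.rpow_neg (by positivity), ← div_eq_mul_inv, le_div_iff₀ (by positivity), ← h3, mul_comm]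
  refine le_trans ?_ h
  gcongr

lemma integral_Ioi_add_rpow {a s b : ℝ} (ha : a < -1) (h : 0 < s + b) :
    ∫ τ in Ioi s, (τ + b) ^ a = - (s + b) ^ (a + 1) / (a + 1) := by
  have := (measurePreserving_add_right volume b).setIntegral_preimage_emb
    (measurableEmbedding_addRight b) (fun τ => τ ^ a) (Ioi (s + b))
  rw [preimage_add_const_Ioi, add_sub_cancel_right] at this
  rw [this, integral_Ioi_rpow_of_lt ha h]

/-- Measurable symbols of at most polynomial growth. -/
structure IsPolyGrowth (Q : E3 → ℂ) : Prop where
  measurable : Measurable Q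
  bound : ∃ (n : ℕ) (C : ℝ), ∀ ξ, ‖Q ξ‖ ≤ C * (1 + ‖ξ‖) ^ n

lemma IsPolyGrowth.integrable_mul_exp {Q : E3 → ℂ} (hQ : IsPolyGrowth Q) {a : ℝ} (ha : 0 < a) :
    Integrable fun ξ : E3 => Q ξ * (Real.exp (-a * ‖ξ‖ ^ 2) : ℝ) := by
  obtain ⟨n, C, h⟩ := hQ.bound
  exact integrable_mul_exp_of_polynomial_bound hQ.measurable.aestronglyMeasurable h ha

lemma IsPolyGrowth.mul {P Q : E3 → ℂ} (hP : IsPolyGrowth P) (hQ : IsPolyGrowth Q) :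
    IsPolyGrowth (fun ξ => P ξ * Q ξ) := by
  obtain ⟨n, C, h⟩ := hP.bound
  obtain ⟨k, D, h'⟩ := hQ.bound
  refine ⟨hP.measurable.mul hQ.measurable, n + k, C * D, fun ξ => ?_⟩
  rw [norm_mul, pow_add]
  calc ‖P ξ‖ * ‖Q ξ‖ ≤ (C * (1 + ‖ξ‖) ^ n) * (D * (1 + ‖ξ‖) ^ k) :=
        mul_le_mul (h ξ) (h' ξ) (norm_nonneg _) ((norm_nonneg _).trans (h ξ))
    _ = _ := by ring

lemma HasTemperateGrowth.isPolyGrowth {P : E3 → ℂ} (hP : Function.HasTemperateGrowth P) :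
    IsPolyGrowth P :=
  ⟨hP.1.continuous.measurable, HasTemperateGrowth.exists_bound hP⟩

lemma IsPolyGrowth.pow {Q : E3 → ℂ} (hQ : IsPolyGrowth Q) (n : ℕ) :
    IsPolyGrowth (fun ξ => Q ξ ^ n) := by
  induction n with
  | zero => simpa using HasTemperateGrowth.isPolyGrowth (.const 1)
  | succ n ih => simpa only [pow_succ] using ih.mul hQ

/-- The symbol `P(ξ) / |ξ|²`. -/
noncomputable def divNormSq (P : E3 → ℂ) : E3 → ℂ := fun ξ => P ξ / ((‖ξ‖ ^ 2 : ℝ) : ℂ)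

lemma IsHomSymbol.norm_divNormSq_le {m : ℕ} {P : E3 → ℂ} (hP : IsHomSymbol m P) (hm : 2 ≤ m) :
    ∃ C, 0 ≤ C ∧ ∀ ξ, ‖divNormSq P ξ‖ ≤ C * ‖ξ‖ ^ (m - 2) := by
  obtain ⟨C, hC, h⟩ := hP.norm_le (by omega)
  refine ⟨C, hC, fun ξ => ?_⟩
  rw [divNormSq, norm_div, Complex.norm_real, Real.norm_of_nonneg (by positivity)]
  rcases eq_or_ne ξ 0 with rfl | hξ
  · simp; positivity
  · have hpos : 0 < ‖ξ‖ := norm_pos_iff.2 hξ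
    rw [div_le_iff₀ (by positivity), mul_assoc, ← pow_add, Nat.sub_add_cancel hm]
    exact h ξ

/-- Division by `|ξ|²` may destroy smoothness at the origin, so temperate growth is no longer
available. Measurability and polynomial growth remain, and they suffice for absolute convergence and
for differentiation in `s`. -/
lemma IsHomSymbol.isPolyGrowth_divNormSq {m : ℕ} {P : E3 → ℂ} (hP : IsHomSymbol m P)
    (hm : 2 ≤ m) : IsPolyGrowth (divNormSq P) := by
  obtain ⟨C, hC, h⟩ := hP.norm_divNormSq_le hm
  have hm' := hP.temperate.1.continuous.measurable
  refine ⟨by unfold divNormSq; fun_prop, m - 2, C, fun ξ => (h ξ).trans ?_⟩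
  gcongr
  linarith

/-- Since `exp(-s|ξ|²)/|ξ|² = ∫ₛ^∞ exp(-τ|ξ|²) dτ`, the nonsmooth symbol is a superposition of
Gaussian integrals with the smooth symbol `P`, to which the scaling estimate applies. -/
lemma IsHomSymbol.gaussIntegral_divNormSq_eq {m : ℕ} {P : E3 → ℂ} (hP : IsHomSymbol m P)
    (hm : 2 ≤ m) {s : ℝ} (hs : 0 < s) (y : E3) :
    gaussIntegral (divNormSq P) s y = ∫ τ in Ioi s, gaussIntegral P τ y := by
  unfold gaussIntegral
  have hPm := hP.temperate.1.continuous
  rw [integral_integral_swap]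
  · refine integral_congr_ae ?_
    have : ∀ᵐ ξ : E3, ξ ≠ 0 := by simp [ae_iff, measure_singleton]
    filter_upwards [this] with ξ hξ
    have hpos : 0 < ‖ξ‖ := norm_pos_iff.2 hξ
    rw [integral_const_mul, integral_const_mul, integral_complex_ofReal]
    have h := integral_exp_mul_Ioi (a := - ‖ξ‖ ^ 2) (by simpa only [Left.neg_neg_iff] using pow_pos hpos 2) s
    have h2 : ∀ τ : ℝ, Real.exp (-τ * ‖ξ‖ ^ 2) = Real.exp (- ‖ξ‖ ^ 2 * τ) := fun τ => by ring_nf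
    simp_rw [h2, h, divNormSq]
    push_cast
    have : (‖ξ‖ : ℂ) ≠ 0 := by exact_mod_cast hpos.ne'
    field_simp
  -- For fixed `ξ ≠ 0` the integral in `τ` of the norms is exactly `|P(ξ)|/|ξ|² · exp(-s|ξ|²)`,
  -- which is integrable in `ξ`.
  · rw [integrable_prod_iff']
    · constructor
      · have : ∀ᵐ ξ : E3, ξ ≠ 0 := by simp [ae_iff, measure_singleton]
        filter_upwards [this] with ξ hξ
        have hpos : 0 < ‖ξ‖ := norm_pos_iff.2 hξ
        have h := integrableOn_exp_mul_Ioi (a := - ‖ξ‖ ^ 2) (by simpa only [Left.neg_neg_iff] using pow_pos hpos 2) s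
        have h2 : ∀ τ : ℝ, Real.exp (-τ * ‖ξ‖ ^ 2) = Real.exp (- ‖ξ‖ ^ 2 * τ) :=
          fun τ => by ring_nf
        simp only [Function.uncurry, h2]
        exact ((h.ofReal).const_mul _).const_mul _
      · have hint := ((hP.isPolyGrowth_divNormSq hm).integrable_mul_exp hs).norm
        refine hint.congr ?_
        have : ∀ᵐ ξ : E3, ξ ≠ 0 := by simp [ae_iff, measure_singleton]
        filter_upwards [this] with ξ hξ
        have hpos : 0 < ‖ξ‖ := norm_pos_iff.2 hξ
        have h := integral_exp_mul_Ioi (a := - ‖ξ‖ ^ 2) (by simpa only [Left.neg_neg_iff] using pow_pos hpos 2) s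
        have h2 : ∀ τ : ℝ, Real.exp (-τ * ‖ξ‖ ^ 2) = Real.exp (- ‖ξ‖ ^ 2 * τ) :=
          fun τ => by ring_nf
        simp only [Function.uncurry, norm_mul, norm_planeWave, one_mul, Complex.norm_real,
          Real.norm_of_nonneg (Real.exp_nonneg _), h2]
        rw [integral_const_mul, h, divNormSq, norm_div, Complex.norm_real,
          Real.norm_of_nonneg (by positivity)]
        field_simp
    · refine Continuous.aestronglyMeasurable ?_
      simp only [Function.uncurry_def]
      fun_prop

lemma IsHomSymbol.norm_gaussIntegral_divNormSq_le {m : ℕ} {P : E3 → ℂ} (hP : IsHomSymbol m P)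
    (hm : 2 ≤ m) : ∃ C, 0 ≤ C ∧ ∀ s : ℝ, 0 < s → ∀ y,
      ‖gaussIntegral (divNormSq P) s y‖ ≤ C * (s + ‖y‖ ^ 2) ^ (-((m + 1 : ℝ) / 2)) := by
  obtain ⟨C, hC, h⟩ := hP.norm_gaussIntegral_le
  refine ⟨C * (2 / (m + 1)), by positivity, fun s hs y => ?_⟩
  have ha : -((m + 3 : ℝ) / 2) < -1 := by
    have : (0 : ℝ) ≤ m := by positivity
    linarith
  rw [hP.gaussIntegral_divNormSq_eq hm hs]
  have hint : IntegrableOn (fun τ => C * (τ + ‖y‖ ^ 2) ^ (-((m + 3 : ℝ) / 2))) (Ioi s) :=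
    (integrableOn_add_rpow_Ioi_of_lt ha (by nlinarith [norm_nonneg y])).const_mul C
  refine (norm_integral_le_of_norm_le hint ?_).trans_eq ?_
  · filter_upwards [ae_restrict_mem measurableSet_Ioi] with τ hτ
    exact h τ (hs.trans hτ) y
  · rw [integral_const_mul, integral_Ioi_add_rpow ha (by positivity)]
    have e1 : -((m + 3 : ℝ) / 2) + 1 = -((m + 1 : ℝ) / 2) := by ring
    rw [e1]
    have : (m + 1 : ℝ) ≠ 0 := by positivity
    field_simp

/-- The exponent `-|ξ|² + iλξ₁`. -/
noncomputable def oseenSymbol (lam : ℝ) (ξ : E3) : ℂ :=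
  -((‖ξ‖ ^ 2 : ℝ) : ℂ) + Complex.I * ((lam * ξ 0 : ℝ) : ℂ)

lemma continuous_oseenSymbol (lam : ℝ) : Continuous (oseenSymbol lam) := by
  unfold oseenSymbol; fun_prop

lemma isPolyGrowth_oseenSymbol (lam : ℝ) : IsPolyGrowth (oseenSymbol lam) := by
  have h1 := isHomSymbol_normSq.temperate
  have h2 := ((isHomSymbol_coord 0).const_mul (Complex.I * lam)).temperate
  have h3 := HasTemperateGrowth.isPolyGrowth (h2.sub h1)
  convert h3 using 1
  ext ξ
  simp [oseenSymbol]
  ring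

/-- The drift is a pure phase: it translates the heat kernel by `λs e₁`. -/
lemma exp_mul_oseenSymbol (lam s : ℝ) (ξ : E3) :
    Complex.exp (s * oseenSymbol lam ξ) =
      planeWave ξ ((lam * s) • EuclideanSpace.single 0 1) * (Real.exp (-s * ‖ξ‖ ^ 2) : ℝ) := by
  rw [planeWave, Complex.ofReal_exp, ← Complex.exp_add, oseenSymbol, inner_smul_right,
    EuclideanSpace.inner_single_right]
  congr 1
  push_cast
  simp
  ring

lemma norm_exp_mul_oseenSymbol (lam s : ℝ) (ξ : E3) :
    ‖Complex.exp (s * oseenSymbol lam ξ)‖ = Real.exp (-s * ‖ξ‖ ^ 2) := by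
  rw [exp_mul_oseenSymbol, norm_mul, norm_planeWave, one_mul, Complex.norm_real,
    Real.norm_of_nonneg (Real.exp_nonneg _)]

lemma planeWave_add (ξ x y : E3) : planeWave ξ (x + y) = planeWave ξ x * planeWave ξ y := by
  rw [planeWave, planeWave, planeWave, ← Complex.exp_add, inner_add_right]
  push_cast; ring_nf

/-- The kernel whose spatial Fourier transform is `Q(ξ) exp(s(-|ξ|² + iλξ₁))`. -/
noncomputable def oseenKernel (lam : ℝ) (Q : E3 → ℂ) (s : ℝ) (x : E3) : ℂ :=
  (((2 * Real.pi) ^ 3 : ℝ) : ℂ)⁻¹ *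
    ∫ ξ : E3, planeWave ξ x * (Complex.exp (s * oseenSymbol lam ξ) * Q ξ)

lemma oseenKernel_eq_gaussIntegral (lam : ℝ) (Q : E3 → ℂ) (s : ℝ) (x : E3) :
    oseenKernel lam Q s x = (((2 * Real.pi) ^ 3 : ℝ) : ℂ)⁻¹ *
      gaussIntegral Q s (x + (lam * s) • EuclideanSpace.single 0 1) := by
  rw [oseenKernel, gaussIntegral]
  congr 2
  ext ξ
  rw [planeWave_add, exp_mul_oseenSymbol]
  ring

lemma integrable_exp_mul_oseenSymbol (lam : ℝ) {Q : E3 → ℂ} (hQ : IsPolyGrowth Q) {s : ℝ}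
    (hs : 0 < s) : Integrable fun ξ => Complex.exp (s * oseenSymbol lam ξ) * Q ξ := by
  refine (hQ.integrable_mul_exp hs).norm.mono' ?_ (ae_of_all _ fun ξ => ?_)
  · exact (Continuous.aestronglyMeasurable
      (by have := continuous_oseenSymbol lam; fun_prop)).mul hQ.measurable.aestronglyMeasurable
  · rw [norm_mul, norm_exp_mul_oseenSymbol, norm_mul, Complex.norm_real,
      Real.norm_of_nonneg (Real.exp_nonneg _), mul_comm]

lemma oseenKernel_add (lam : ℝ) {Q R : E3 → ℂ} (hQ : IsPolyGrowth Q) (hR : IsPolyGrowth R)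
    {s : ℝ} (hs : 0 < s) (x : E3) :
    oseenKernel lam (fun ξ => Q ξ + R ξ) s x = oseenKernel lam Q s x + oseenKernel lam R s x := by
  have h := integral_add (integrable_planeWave_mul (integrable_exp_mul_oseenSymbol lam hQ hs) x)
    (integrable_planeWave_mul (integrable_exp_mul_oseenSymbol lam hR hs) x)
  simp only [oseenKernel, mul_add, h]

lemma measurable_oseenKernel (lam : ℝ) {Q : E3 → ℂ} (hQ : IsPolyGrowth Q) :
    Measurable fun p : ℝ × E3 => oseenKernel lam Q p.1 p.2 := by
  have h1 : Measurable fun z : (ℝ × E3) × E3 => planeWave z.2 z.1.2 := by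
    unfold planeWave
    exact Continuous.measurable (by fun_prop)
  have h2 : Measurable fun z : (ℝ × E3) × E3 => Complex.exp (z.1.1 * oseenSymbol lam z.2) := by
    have := continuous_oseenSymbol lam
    exact Continuous.measurable (by fun_prop)
  have h3 : Measurable fun z : (ℝ × E3) × E3 => Q z.2 := hQ.measurable.comp measurable_snd
  exact ((h1.mul (h2.mul h3)).stronglyMeasurable.integral_prod_right'.measurable).const_mul _

/-- The squared parabolic distance along the drift. -/
noncomputable def driftDist (lam s : ℝ) (x : E3) : ℝ :=
  s + ‖x + (lam * s) • EuclideanSpace.single (0 : Fin 3) (1 : ℝ)‖ ^ 2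

lemma driftDist_pos {lam s : ℝ} (hs : 0 < s) (x : E3) : 0 < driftDist lam s x := by
  unfold driftDist; positivity

lemma IsHomSymbol.norm_oseenKernel_le {m : ℕ} {P : E3 → ℂ} (hP : IsHomSymbol m P)
    (hm : 2 ≤ m) (lam : ℝ) : ∃ C, 0 ≤ C ∧ ∀ s : ℝ, 0 < s → ∀ x,
      ‖oseenKernel lam (divNormSq P) s x‖ ≤ C * driftDist lam s x ^ (-((m + 1 : ℝ) / 2)) := by
  obtain ⟨C, hC, h⟩ := hP.norm_gaussIntegral_divNormSq_le hm
  refine ⟨‖(((2 * Real.pi) ^ 3 : ℝ) : ℂ)⁻¹‖ * C, by positivity, fun s hs x => ?_⟩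
  rw [oseenKernel_eq_gaussIntegral, norm_mul, mul_assoc]
  gcongr
  exact h s hs _

/-- Away from the singularity, every factor `-|ξ|² + iλξ₁` gains a power of the distance. -/
lemma IsHomSymbol.norm_oseenKernel_mul_pow_le (lam : ℝ) {c : ℝ} (hc : 0 < c) (n : ℕ) :
    ∀ {m : ℕ} {P : E3 → ℂ}, IsHomSymbol m P → 2 ≤ m → ∃ C, 0 ≤ C ∧ ∀ s : ℝ, 0 < s → ∀ x,
      c ≤ driftDist lam s x →
      ‖oseenKernel lam (fun ξ => divNormSq P ξ * oseenSymbol lam ξ ^ n) s x‖ ≤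
        C * driftDist lam s x ^ (-((m + n + 1 : ℝ) / 2)) := by
  induction n with
  | zero =>
    intro m P hP hm
    obtain ⟨C, hC, h⟩ := hP.norm_oseenKernel_le hm lam
    exact ⟨C, hC, fun s hs x _ => by simpa using h s hs x⟩
  | succ n ih =>
    intro m P hP hm
    have hP1 : IsHomSymbol (m + 2) (fun ξ => P ξ * ((-1) * ((‖ξ‖ ^ 2 : ℝ) : ℂ))) :=
      hP.mul (isHomSymbol_normSq.const_mul (-1))
    have hP2 : IsHomSymbol (m + 1) (fun ξ => P ξ * ((Complex.I * lam) * ((ξ 0 : ℝ) : ℂ))) :=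
      hP.mul ((isHomSymbol_coord 0).const_mul _)
    obtain ⟨C1, hC1, h1⟩ := ih hP1 (by omega)
    obtain ⟨C2, hC2, h2⟩ := ih hP2 (by omega)
    -- The term `iλξ₁` raises the degree by one, which is the claimed gain. The term `-|ξ|²` raises
    -- it by two, and the surplus factor `D^(-1/2)` is at most `c^(-1/2)`.
    refine ⟨C1 * c ^ (-(1 / 2) : ℝ) + C2, by positivity, fun s hs x hx => ?_⟩
    have hq := (isPolyGrowth_oseenSymbol lam).pow n
    have e : (fun ξ => divNormSq P ξ * oseenSymbol lam ξ ^ (n + 1)) =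
        fun ξ => divNormSq (fun ξ => P ξ * ((-1) * ((‖ξ‖ ^ 2 : ℝ) : ℂ))) ξ * oseenSymbol lam ξ ^ n +
          divNormSq (fun ξ => P ξ * ((Complex.I * lam) * ((ξ 0 : ℝ) : ℂ))) ξ *
            oseenSymbol lam ξ ^ n := by
      ext ξ
      simp only [divNormSq, pow_succ, oseenSymbol]
      push_cast
      ring
    rw [e, oseenKernel_add lam ((hP1.isPolyGrowth_divNormSq (by omega)).mul hq)
      ((hP2.isPolyGrowth_divNormSq (by omega)).mul hq) hs]
    refine (norm_add_le _ _).trans ?_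
    have hpos := hc.trans_le hx
    rw [add_mul]
    refine add_le_add ((h1 s hs x hx).trans ?_) ((h2 s hs x hx).trans_eq ?_)
    · rw [mul_assoc]
      gcongr
      have e2 : -(((m + 2 : ℕ) + n + 1 : ℝ) / 2) =
          -(1 / 2) + -((m + (n + 1 : ℕ) + 1 : ℝ) / 2) := by push_cast; ring
      rw [e2, Real.rpow_add hpos]
      gcongr ?_ * _
      exact Real.rpow_le_rpow_of_nonpos hc hx (by norm_num)
    · push_cast; ring_nf

/-- Differentiation under the integral, dominated on `(s/2, ∞)` by the Gaussian at time `s/2`. -/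
lemma hasDerivAt_oseenKernel (lam : ℝ) {Q : E3 → ℂ} (hQ : IsPolyGrowth Q) {s : ℝ} (hs : 0 < s)
    (x : E3) : HasDerivAt (fun s => oseenKernel lam Q s x)
      (oseenKernel lam (fun ξ => Q ξ * oseenSymbol lam ξ) s x) s := by
  have hq := isPolyGrowth_oseenSymbol lam
  have hqc := continuous_oseenSymbol lam
  unfold oseenKernel
  refine HasDerivAt.const_mul _ ?_
  refine (hasDerivAt_integral_of_dominated_loc_of_deriv_le
    (𝕜 := ℝ) (s := Ioi (s / 2)) (x₀ := s) (μ := (volume : Measure E3))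
    (F := fun s ξ => planeWave ξ x * (Complex.exp (s * oseenSymbol lam ξ) * Q ξ))
    (F' := fun s ξ => planeWave ξ x * (Complex.exp (s * oseenSymbol lam ξ) *
      (Q ξ * oseenSymbol lam ξ)))
    (bound := fun ξ => ‖Q ξ * oseenSymbol lam ξ * (Real.exp (-(s / 2) * ‖ξ‖ ^ 2) : ℝ)‖)
    (Ioi_mem_nhds (by linarith)) ?_ ?_ ?_ ?_ ?_ ?_).2
  · refine .of_forall fun r => AEStronglyMeasurable.mul (by fun_prop)
      (AEStronglyMeasurable.mul (by fun_prop) hQ.measurable.aestronglyMeasurable)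
  · exact integrable_planeWave_mul (integrable_exp_mul_oseenSymbol lam hQ hs) x
  · exact (integrable_planeWave_mul (integrable_exp_mul_oseenSymbol lam (hQ.mul hq) hs) x).1
  · refine ae_of_all _ fun ξ r hr => ?_
    rw [norm_mul, norm_planeWave, one_mul, norm_mul, norm_exp_mul_oseenSymbol, norm_mul (_ * _),
      Complex.norm_real, Real.norm_of_nonneg (Real.exp_nonneg _), mul_comm]
    gcongr
    exact le_of_lt hr
  · exact ((hQ.mul hq).integrable_mul_exp (by linarith)).norm
  · refine ae_of_all _ fun ξ r hr => ?_
    have h1 : HasDerivAt (fun r : ℝ => ((r : ℂ) * oseenSymbol lam ξ)) (1 * oseenSymbol lam ξ) r :=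
      (Complex.ofRealCLM.hasDerivAt (x := r)).mul_const _
    have h2 := ((h1.cexp.mul_const (Q ξ)).const_mul (planeWave ξ x))
    exact h2.congr_deriv (by ring)

/-! ### Periodization of decaying functions on the half line -/

section Periodization

variable {E : Type*} [NormedAddCommGroup E]

/-- Continuous functions on `(0, ∞)` which are `O((1 + s)^(-3/2))`. -/
structure HasDecay (g : ℝ → E) : Prop where
  continuousOn : ContinuousOn g (Ioi 0)
  bound : ∃ C, 0 ≤ C ∧ ∀ s, 0 < s → ‖g s‖ ≤ C * (1 + s) ^ (-(3 / 2) : ℝ)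

lemma HasDecay.norm {g : ℝ → E} (hg : HasDecay g) : HasDecay fun s => ‖g s‖ :=
  ⟨hg.continuousOn.norm, by simpa using hg.bound⟩

lemma integrableOn_one_add_rpow : IntegrableOn (fun s : ℝ => (1 + s) ^ (-(3 / 2) : ℝ)) (Ioi 0) := by
  simpa only [add_comm] using
    integrableOn_add_rpow_Ioi_of_lt (a := -(3 / 2)) (c := 0) (m := 1) (by norm_num) (by norm_num)

lemma HasDecay.integrableOn {g : ℝ → E} (hg : HasDecay g) : IntegrableOn g (Ioi 0) := by
  obtain ⟨C, -, h⟩ := hg.bound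
  refine (integrableOn_one_add_rpow.const_mul C).mono'
    (hg.continuousOn.aestronglyMeasurable measurableSet_Ioi) ?_
  filter_upwards [ae_restrict_mem measurableSet_Ioi] with s hs using h s hs

lemma summable_one_add_mul_rpow {T : ℝ} (hT : 0 < T) :
    Summable fun j : ℕ => (1 + j * T) ^ (-(3 / 2) : ℝ) := by
  have h1 : Summable fun j : ℕ => ((j + 1 : ℕ) : ℝ) ^ (-(3 / 2) : ℝ) :=
    (summable_nat_add_iff 1).2 (Real.summable_nat_rpow.2 (by norm_num))
  have hc : 0 < min 1 T := lt_min one_pos hT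
  refine Summable.of_nonneg_of_le (fun j => by positivity) (fun j => ?_)
    (h1.mul_left ((min 1 T) ^ (-(3 / 2) : ℝ)))
  rw [← Real.mul_rpow hc.le (by positivity)]
  refine Real.rpow_le_rpow_of_nonpos (by positivity) ?_ (by norm_num)
  push_cast
  have h2 : min 1 T ≤ 1 := min_le_left _ _
  have h3 : min 1 T ≤ T := min_le_right _ _
  have h4 : (0 : ℝ) ≤ j := by positivity
  nlinarith [mul_le_mul_of_nonneg_left h3 h4]

/-- The majorant does not depend on `t`, so it justifies every later exchange of the periodizing sum
with an integral in `t`. -/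
lemma HasDecay.exists_summable_bound {g : ℝ → E} (hg : HasDecay g) {T : ℝ} (hT : 0 < T) :
    ∃ b : ℕ → ℝ, Summable b ∧ ∀ (j : ℕ) (t : ℝ), 0 < t → ‖g (t + j * T)‖ ≤ b j := by
  obtain ⟨C, hC, h⟩ := hg.bound
  refine ⟨_, (summable_one_add_mul_rpow hT).mul_left C, fun j t ht => ?_⟩
  have h1 : 0 < t + j * T := by positivity
  refine (h _ h1).trans ?_
  gcongr ?_ * ?_
  exact Real.rpow_le_rpow_of_nonpos (by positivity) (by linarith) (by norm_num)

lemma iUnion_Ioc_nat_mul {T : ℝ} (hT : 0 < T) :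
    ⋃ j : ℕ, Ioc (0 + j * T) (T + j * T) = Ioi (0 : ℝ) := by
  ext s
  simp only [mem_iUnion, mem_Ioc, mem_Ioi]
  constructor
  · rintro ⟨j, h, -⟩
    exact lt_of_le_of_lt (by positivity) h
  · intro hs
    have hc : 0 < ⌈s / T⌉₊ := Nat.ceil_pos.2 (by positivity)
    -- The intervals are closed on the right, hence the ceiling minus one and not the floor.
    refine ⟨⌈s / T⌉₊ - 1, ?_, ?_⟩
    · have := Nat.lt_ceil.1 (Nat.sub_lt hc one_pos)
      rw [lt_div_iff₀ hT] at this
      linarith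
    · have h1 : s ≤ ⌈s / T⌉₊ * T := (div_le_iff₀ hT).1 (Nat.le_ceil _)
      rw [Nat.cast_sub (Nat.one_le_iff_ne_zero.2 hc.ne')]
      push_cast
      linarith

lemma pairwise_disjoint_Ioc_nat_mul {T : ℝ} (hT : 0 < T) :
    Pairwise (Function.onFun Disjoint fun j : ℕ => Ioc (0 + j * T) (T + j * T)) := by
  have hm : Monotone fun j : ℕ => (j : ℝ) * T := fun a b hab => by
    dsimp only; gcongr
  have := hm.pairwise_disjoint_on_Ioc_succ
  convert this using 3 with j
  rw [Order.succ_eq_add_one]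
  push_cast
  ring_nf

lemma setLIntegral_tsum_shift {T : ℝ} (hT : 0 < T) {g : ℝ → ℝ≥0∞} (hg : Measurable g) :
    ∫⁻ t in Ioc 0 T, ∑' j : ℕ, g (t + j * T) = ∫⁻ s in Ioi 0, g s := by
  rw [lintegral_tsum (f := fun (j : ℕ) t => g (t + j * T)) fun j => by fun_prop, ← iUnion_Ioc_nat_mul hT,
    lintegral_iUnion (fun j => measurableSet_Ioc) (pairwise_disjoint_Ioc_nat_mul hT)]
  congr 1
  ext j
  have := (measurePreserving_add_right volume (j * T)).setLIntegral_comp_preimage_emb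
    (measurableEmbedding_addRight _) g (Ioc (0 + j * T) (T + j * T))
  simpa using this

lemma HasDecay.continuousOn_shift {g : ℝ → E} (hg : HasDecay g) {T : ℝ} (hT : 0 < T) (j : ℕ) :
    ContinuousOn (fun t => g (t + j * T)) (Ioi 0) :=
  hg.continuousOn.comp (by fun_prop) fun t (ht : 0 < t) => by
    have : 0 < t + j * T := by positivity
    exact this

lemma HasDecay.aestronglyMeasurable_shift {g : ℝ → E} (hg : HasDecay g) {T : ℝ} (hT : 0 < T)
    (j : ℕ) {a b : ℝ} (ha : 0 ≤ a) :
    AEStronglyMeasurable (fun t => g (t + j * T)) (volume.restrict (Ioc a b)) :=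
  ((hg.continuousOn_shift hT j).mono fun _ ht => lt_of_le_of_lt ha ht.1).aestronglyMeasurable
    measurableSet_Ioc

lemma HasDecay.summable_shift [CompleteSpace E] {g : ℝ → E} (hg : HasDecay g) {T : ℝ} (hT : 0 < T) {t : ℝ}
    (ht : 0 < t) : Summable fun j : ℕ => g (t + j * T) := by
  obtain ⟨b, hb, h⟩ := hg.exists_summable_bound hT
  exact .of_norm_bounded hb fun j => h j t ht

lemma HasDecay.integrableOn_tsum_shift [CompleteSpace E] {g : ℝ → E} (hg : HasDecay g) {T : ℝ} (hT : 0 < T)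
    {a b : ℝ} (ha : 0 ≤ a) : IntegrableOn (fun t => ∑' j : ℕ, g (t + j * T)) (Ioc a b) := by
  obtain ⟨B, hB, h⟩ := hg.exists_summable_bound hT
  refine Integrable.mono' (g := fun _ => ∑' j, B j) (integrable_const _) ?_ ?_
  · refine aestronglyMeasurable_of_tendsto_ae atTop (f := fun (n : ℕ) t =>
      ∑ j ∈ Finset.range n, g (t + j * T)) (fun n => ?_) ?_
    · exact Finset.aestronglyMeasurable_fun_sum _
        fun j _ => hg.aestronglyMeasurable_shift hT j ha
    · filter_upwards [ae_restrict_mem measurableSet_Ioc] with t ht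
      exact (hg.summable_shift hT (lt_of_le_of_lt ha ht.1)).hasSum.tendsto_sum_nat
  · filter_upwards [ae_restrict_mem measurableSet_Ioc] with t ht
    exact tsum_of_norm_bounded hB.hasSum fun j => h j t (lt_of_le_of_lt ha ht.1)

variable [NormedSpace ℝ E]

lemma setIntegral_shift {T : ℝ} (j : ℕ) (g : ℝ → E) :
    ∫ t in Ioc 0 T, g (t + j * T) = ∫ s in Ioc (0 + j * T) (T + j * T), g s := by
  have := (measurePreserving_add_right volume (j * T)).setIntegral_preimage_emb
    (measurableEmbedding_addRight _) g (Ioc (0 + j * T) (T + j * T))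
  simpa using this

variable [CompleteSpace E]

lemma HasDecay.hasSum_setIntegral_shift {g : ℝ → E} (hg : HasDecay g) {T : ℝ} (hT : 0 < T)
    {a b : ℝ} (ha : 0 ≤ a) :
    HasSum (fun j : ℕ => ∫ t in Ioc a b, g (t + j * T))
      (∫ t in Ioc a b, ∑' j : ℕ, g (t + j * T)) := by
  obtain ⟨B, hB, h⟩ := hg.exists_summable_bound hT
  refine hasSum_integral_of_dominated_convergence (fun j _ => B j)
    (fun j => hg.aestronglyMeasurable_shift hT j ha) (fun j => ?_) (ae_of_all _ fun _ => hB)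
    (integrable_const _) ?_
  · filter_upwards [ae_restrict_mem measurableSet_Ioc] with t ht
    exact h j t (lt_of_le_of_lt ha ht.1)
  · filter_upwards [ae_restrict_mem measurableSet_Ioc] with t ht
    exact (hg.summable_shift hT (lt_of_le_of_lt ha ht.1)).hasSum

lemma HasDecay.setIntegral_tsum_shift {g : ℝ → E} (hg : HasDecay g) {T : ℝ} (hT : 0 < T) :
    ∫ t in Ioc 0 T, ∑' j : ℕ, g (t + j * T) = ∫ s in Ioi 0, g s := by
  refine (hg.hasSum_setIntegral_shift hT le_rfl).unique ?_
  simp_rw [setIntegral_shift]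
  have := hasSum_integral_iUnion (μ := volume) (f := g) (fun j => measurableSet_Ioc)
    (pairwise_disjoint_Ioc_nat_mul hT) (by rw [iUnion_Ioc_nat_mul hT]; exact hg.integrableOn)
  rwa [iUnion_Ioc_nat_mul hT] at this

end Periodization

/-- As `g` vanishes at infinity, the integral of `g'` is minus the boundary value of `g` at `0+`; a
bound for `g` on `(0, r]` therefore suffices. The limit at `0+` is avoided by cutting at a small
`δ`, where the bounded `g'` contributes at most `Cδ`. -/
lemma HasDecay.norm_integral_le_of_hasDerivAt {g g' : ℝ → ℂ} (hg : HasDecay g)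
    (hg' : HasDecay g') (hd : ∀ s, 0 < s → HasDerivAt g (g' s) s) {r D : ℝ} (hr : 0 < r)
    (hD : ∀ s, 0 < s → s ≤ r → ‖g s‖ ≤ D) : ‖∫ s in Ioi 0, g' s‖ ≤ D := by
  obtain ⟨C, hC, h⟩ := hg'.bound
  obtain ⟨B, -, hB⟩ := hg.bound
  refine le_of_forall_pos_le_add fun ε hε => ?_
  obtain ⟨δ, hδ, hδr, hδε⟩ : ∃ δ, 0 < δ ∧ δ ≤ r ∧ C * δ ≤ ε := by
    refine ⟨min r (ε / (C + 1)), by positivity, min_le_left _ _, ?_⟩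
    calc C * min r (ε / (C + 1)) ≤ (C + 1) * (ε / (C + 1)) := by
          gcongr
          · linarith
          · exact min_le_right _ _
      _ = ε := by field_simp
  have hsplit : ∫ s in Ioi 0, g' s = (∫ s in Ioc 0 δ, g' s) + ∫ s in Ioi δ, g' s := by
    rw [← setIntegral_union (Ioc_disjoint_Ioi le_rfl) measurableSet_Ioi
      (hg'.integrableOn.mono_set Ioc_subset_Ioi_self)
      (hg'.integrableOn.mono_set (Ioi_subset_Ioi hδ.le)), Ioc_union_Ioi_eq_Ioi hδ.le]
  have htend : Tendsto g atTop (𝓝 0) := by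
    have h1 : Tendsto (fun s : ℝ => B * (1 + s) ^ (-(3 / 2) : ℝ)) atTop (𝓝 0) := by
      have := ((tendsto_rpow_neg_atTop (y := 3 / 2) (by norm_num)).comp
        (tendsto_atTop_add_const_left atTop 1 tendsto_id)).const_mul B
      simpa using this
    refine squeeze_zero_norm' ?_ h1
    filter_upwards [eventually_gt_atTop 0] with s hs using hB s hs
  have h2 : ∫ s in Ioi δ, g' s = 0 - g δ :=
    integral_Ioi_of_hasDerivAt_of_tendsto (hd δ hδ).continuousAt.continuousWithinAt
      (fun s hs => hd s (hδ.trans hs)) (hg'.integrableOn.mono_set (Ioi_subset_Ioi hδ.le)) htend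
  have h3 : ‖∫ s in Ioc 0 δ, g' s‖ ≤ C * δ := by
    have := norm_setIntegral_le_of_norm_le_const (μ := volume) (s := Ioc 0 δ) (f := g') (C := C)
      (by simp) (fun s hs => (h s hs.1).trans ?_)
    · simpa [hδ.le] using this
    · refine mul_le_of_le_one_right hC (Real.rpow_le_one_of_one_le_of_nonpos ?_ (by norm_num))
      linarith [hs.1]
  rw [hsplit, h2, zero_sub]
  calc ‖(∫ s in Ioc 0 δ, g' s) + -g δ‖ ≤ C * δ + D :=
        (norm_add_le _ _).trans (add_le_add h3 (by rw [norm_neg]; exact hD δ hδ hδr))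
    _ ≤ D + ε := by linarith

/-! ### Euler-Maclaurin bounds for the mean-free periodization -/

/-- The mean-free part of the `T`-periodization of a function on `(0, ∞)`, for `t ∈ (0, T]`. -/
noncomputable def periodicPart (T : ℝ) (g : ℝ → ℂ) (t : ℝ) : ℂ :=
  T * ∑' j : ℕ, g (t + j * T) - ∫ s in Ioi 0, g s

variable {T : ℝ}

lemma HasDecay.integrableOn_periodicPart {g : ℝ → ℂ} (hT : 0 < T) (hg : HasDecay g) {a b : ℝ}
    (ha : 0 ≤ a) : IntegrableOn (periodicPart T g) (Ioc a b) :=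
  ((hg.integrableOn_tsum_shift hT ha).const_mul _).sub (integrable_const _)

lemma HasDecay.setIntegral_periodicPart {g : ℝ → ℂ} (hT : 0 < T) (hg : HasDecay g) :
    ∫ t in Ioc 0 T, periodicPart T g t = 0 := by
  unfold periodicPart
  rw [integral_sub ((hg.integrableOn_tsum_shift hT le_rfl).const_mul _) (integrable_const _),
    integral_const_mul, hg.setIntegral_tsum_shift hT]
  simp [hT.le]

lemma periodicPart_sub {g g' : ℝ → ℂ} (hT : 0 < T) (hg : HasDecay g)
    (hg' : HasDecay g') (hd : ∀ s, 0 < s → HasDerivAt g (g' s) s) {u t : ℝ} (hu : 0 < u)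
    (hut : u ≤ t) : periodicPart T g t - periodicPart T g u =
      T * ∫ v in Ioc u t, ∑' j : ℕ, g' (v + j * T) := by
  rw [periodicPart, periodicPart, sub_sub_sub_cancel_right, ← mul_sub,
    ← (hg.summable_shift hT (hu.trans_le hut)).tsum_sub (hg.summable_shift hT hu),
    ← (hg'.hasSum_setIntegral_shift hT hu.le).tsum_eq]
  congr 2
  ext j
  rw [← intervalIntegral.integral_of_le hut]
  symm
  refine intervalIntegral.integral_eq_sub_of_hasDerivAt (f := fun v => g (v + j * T)) ?_ ?_
  · intro v hv
    rw [uIcc_of_le hut] at hv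
    have : 0 < v + j * T := by have := hu.trans_le hv.1; positivity
    exact (hd _ this).comp_add_const v (j * T)
  · refine ContinuousOn.intervalIntegrable ?_
    rw [uIcc_of_le hut]
    exact (hg'.continuousOn_shift hT j).mono fun v hv => hu.trans_le hv.1

/-- A function of mean zero is the average over `u` of its differences `f(t) - f(u)`, so its size is
at most its oscillation. -/
lemma norm_periodicPart_le_of_forall_sub {g : ℝ → ℂ} (hT : 0 < T) (hg : HasDecay g) {D : ℝ}
    (h : ∀ u t, 0 < u → u ≤ t → t ≤ T → ‖periodicPart T g t - periodicPart T g u‖ ≤ D) {t : ℝ}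
    (ht : t ∈ Ioc 0 T) : ‖periodicPart T g t‖ ≤ D := by
  have h1 : ∫ u in Ioc 0 T, (periodicPart T g t - periodicPart T g u) =
      T * periodicPart T g t := by
    rw [integral_sub (integrable_const _) (hg.integrableOn_periodicPart hT le_rfl),
      hg.setIntegral_periodicPart hT]
    simp [hT.le]
  have h2 : ‖∫ u in Ioc 0 T, (periodicPart T g t - periodicPart T g u)‖ ≤
      D * volume.real (Ioc 0 T) := by
    refine norm_setIntegral_le_of_norm_le_const (by simp) fun u hu => ?_
    rcases le_total u t with hut | hut
    · exact h u t hu.1 hut ht.2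
    · rw [norm_sub_rev]; exact h t u ht.1 hut hu.2
  rw [h1, norm_mul, Complex.norm_real, Real.norm_of_nonneg hT.le] at h2
  simp only [measureReal_def, Real.volume_Ioc, sub_zero, ENNReal.toReal_ofReal hT.le] at h2
  rw [mul_comm] at h2
  exact le_of_mul_le_mul_right h2 hT

/-- The oscillation over one period is at most the total variation of the periodization, and this is
at most `T` times the integral of `‖g'‖` over the half line. -/
lemma norm_periodicPart_le_integral {g g' : ℝ → ℂ} (hT : 0 < T) (hg : HasDecay g)
    (hg' : HasDecay g') (hd : ∀ s, 0 < s → HasDerivAt g (g' s) s) {t : ℝ} (ht : t ∈ Ioc 0 T) :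
    ‖periodicPart T g t‖ ≤ T * ∫ s in Ioi 0, ‖g' s‖ := by
  refine norm_periodicPart_le_of_forall_sub hT hg (fun u t hu hut htT => ?_) ht
  rw [periodicPart_sub hT hg hg' hd hu hut, norm_mul, Complex.norm_real,
    Real.norm_of_nonneg hT.le, ← hg'.norm.setIntegral_tsum_shift hT]
  gcongr
  calc ‖∫ v in Ioc u t, ∑' j : ℕ, g' (v + j * T)‖
      ≤ ∫ v in Ioc u t, ∑' j : ℕ, ‖g' (v + j * T)‖ := by
        refine norm_integral_le_of_norm_le (hg'.norm.integrableOn_tsum_shift hT hu.le) ?_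
        filter_upwards [ae_restrict_mem measurableSet_Ioc] with v hv
        exact norm_tsum_le_tsum_norm (hg'.norm.summable_shift hT (hu.trans hv.1))
    _ ≤ _ := by
        refine setIntegral_mono_set (hg'.norm.integrableOn_tsum_shift hT le_rfl)
          (ae_of_all _ fun v => tsum_nonneg fun j => norm_nonneg _)
          (Ioc_subset_Ioc hu.le htT).eventuallyLE

/-- The derivative of the periodization of `g` is the periodization of `g'`, that is, its mean-free
part plus `∫ g'`. Passing to the derivative thus costs only this boundary term, which makes the
estimate iterable. -/
lemma norm_periodicPart_le_of_deriv {g g' : ℝ → ℂ} (hT : 0 < T) (hg : HasDecay g)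
    (hg' : HasDecay g') (hd : ∀ s, 0 < s → HasDerivAt g (g' s) s) {B : ℝ}
    (hB : ∀ t ∈ Ioc 0 T, ‖periodicPart T g' t‖ ≤ B) {t : ℝ} (ht : t ∈ Ioc 0 T) :
    ‖periodicPart T g t‖ ≤ T * (B + ‖∫ s in Ioi 0, g' s‖) := by
  have hB0 : 0 ≤ B := (norm_nonneg _).trans (hB t ht)
  refine norm_periodicPart_le_of_forall_sub hT hg (fun u t hu hut htT => ?_) ht
  rw [periodicPart_sub hT hg hg' hd hu hut, ← integral_const_mul]
  have := norm_setIntegral_le_of_norm_le_const (μ := volume) (s := Ioc u t)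
    (f := fun v => (T : ℂ) * ∑' j : ℕ, g' (v + j * T)) (C := B + ‖∫ s in Ioi 0, g' s‖)
    (by simp) (fun v hv => ?_)
  · refine this.trans ?_
    simp only [measureReal_def, Real.volume_Ioc, ENNReal.toReal_ofReal (sub_nonneg.2 hut)]
    rw [mul_comm]
    gcongr
    linarith
  · have e : (T : ℂ) * ∑' j : ℕ, g' (v + j * T) = periodicPart T g' v + ∫ s in Ioi 0, g' s := by
      rw [periodicPart, sub_add_cancel]
    rw [e]
    exact (norm_add_le _ _).trans (by gcongr; exact hB v ⟨hu.trans hv.1, hv.2.trans htT⟩)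

/-- A crude form of the Euler-Maclaurin estimate. -/
lemma exists_norm_periodicPart_le (hT : 0 < T) (N : ℕ) : ∃ C, 0 ≤ C ∧
    ∀ (g : ℕ → ℝ → ℂ) (D : ℝ), (∀ n, HasDecay (g n)) →
      (∀ n s, 0 < s → HasDerivAt (g n) (g (n + 1) s) s) →
      (∀ n ≤ N, ‖∫ s in Ioi 0, g (n + 1) s‖ ≤ D) → (∫ s in Ioi 0, ‖g (N + 1) s‖) ≤ D →
      ∀ t ∈ Ioc 0 T, ‖periodicPart T (g 0) t‖ ≤ C * D := by
  induction N with
  | zero =>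
    refine ⟨T, hT.le, fun g D hg hd h1 h2 t ht => ?_⟩
    refine (norm_periodicPart_le_integral hT (hg 0) (hg 1) (hd 0) ht).trans ?_
    gcongr
  | succ N ih =>
    obtain ⟨C, hC, h⟩ := ih
    refine ⟨T * (C + 1), by positivity, fun g D hg hd h1 h2 t ht => ?_⟩
    -- The inductive hypothesis is applied to the chain of derivatives shifted by one.
    have h3 := h (fun n => g (n + 1)) D (fun n => hg (n + 1)) (fun n => hd (n + 1))
      (fun n hn => h1 (n + 1) (by omega)) h2
    refine (norm_periodicPart_le_of_deriv hT (hg 0) (hg 1) (hd 0) h3 ht).trans ?_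
    rw [mul_assoc, add_mul, one_mul]
    gcongr
    exact h1 0 (Nat.zero_le _)

/-! ### Pointwise decay of the purely periodic kernel -/

lemma le_driftDist (lam s : ℝ) (x : E3) : s ≤ driftDist lam s x := by
  unfold driftDist; nlinarith [norm_nonneg (x + (lam * s) • EuclideanSpace.single (0 : Fin 3) (1 : ℝ))]

/-- As long as the drift has covered at most half of `‖x‖`, the translated point stays at distance
at least `‖x‖ / 2` from the origin. -/
lemma le_driftDist_of_abs_mul_le {lam s : ℝ} {x : E3} (hs : 0 < s) (h : |lam| * s ≤ ‖x‖ / 2) :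
    s + ‖x‖ ^ 2 / 4 ≤ driftDist lam s x := by
  have h1 : ‖(lam * s) • EuclideanSpace.single (0 : Fin 3) (1 : ℝ)‖ = |lam| * s := by
    rw [norm_smul, PiLp.norm_single, norm_one, mul_one, Real.norm_eq_abs, abs_mul, abs_of_pos hs]
  have h2 : ‖x‖ / 2 ≤ ‖x + (lam * s) • EuclideanSpace.single (0 : Fin 3) (1 : ℝ)‖ := by
    have := norm_sub_le (x + (lam * s) • EuclideanSpace.single (0 : Fin 3) (1 : ℝ))
      ((lam * s) • EuclideanSpace.single (0 : Fin 3) (1 : ℝ))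
    rw [add_sub_cancel_right, h1] at this
    linarith
  unfold driftDist
  nlinarith [norm_nonneg x]

lemma exists_le_driftDist {lam : ℝ} (hlam : lam ≠ 0) {ε : ℝ} (hε : 0 < ε) :
    ∃ c, 0 < c ∧ ∀ s : ℝ, 0 < s → ∀ x : E3, ε ≤ ‖x‖ → c * (s + ‖x‖) ≤ driftDist lam s x := by
  have hl : 0 < |lam| := abs_pos.2 hlam
  -- At early times `ε / 4` turns `‖x‖² / 4` into a multiple of `‖x‖`. At late times `‖x‖ ≤ 2|λ|s`,
  -- and the other two constants bound `cs` and `c‖x‖` by `s/2` each.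
  refine ⟨min (1 / 2) (min (ε / 4) (1 / (4 * |lam|))), by positivity, fun s hs x hx => ?_⟩
  set c := min (1 / 2) (min (ε / 4) (1 / (4 * |lam|)))
  have c1 : c ≤ 1 / 2 := min_le_left _ _
  have c2 : c ≤ ε / 4 := (min_le_right _ _).trans (min_le_left _ _)
  have c3 : c ≤ 1 / (4 * |lam|) := (min_le_right _ _).trans (min_le_right _ _)
  have hx0 : 0 < ‖x‖ := hε.trans_le hx
  rcases le_total (|lam| * s) (‖x‖ / 2) with h | h
  · refine le_trans ?_ (le_driftDist_of_abs_mul_le hs h)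
    nlinarith
  · refine le_trans ?_ (le_driftDist lam s x)
    have h1 : ‖x‖ ≤ 2 * |lam| * s := by linarith
    have h2 : c * ‖x‖ ≤ s / 2 := by
      calc c * ‖x‖ ≤ 1 / (4 * |lam|) * (2 * |lam| * s) := by gcongr
        _ = s / 2 := by field_simp; norm_num
    nlinarith

section Kernel

variable {m : ℕ} {P : E3 → ℂ}

lemma IsHomSymbol.isPolyGrowth_mul_pow (hP : IsHomSymbol m P) (hm : 2 ≤ m) (lam : ℝ) (n : ℕ) :
    IsPolyGrowth fun ξ => divNormSq P ξ * oseenSymbol lam ξ ^ n :=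
  (hP.isPolyGrowth_divNormSq hm).mul ((isPolyGrowth_oseenSymbol lam).pow n)

lemma IsHomSymbol.hasDerivAt_oseenKernel_pow (hP : IsHomSymbol m P) (hm : 2 ≤ m) (lam : ℝ)
    (n : ℕ) {s : ℝ} (hs : 0 < s) (x : E3) :
    HasDerivAt (fun s => oseenKernel lam (fun ξ => divNormSq P ξ * oseenSymbol lam ξ ^ n) s x)
      (oseenKernel lam (fun ξ => divNormSq P ξ * oseenSymbol lam ξ ^ (n + 1)) s x) s := by
  simpa only [mul_assoc, ← pow_succ] using
    hasDerivAt_oseenKernel lam (hP.isPolyGrowth_mul_pow hm lam n) hs x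

lemma IsHomSymbol.hasDecay_oseenKernel_pow (hP : IsHomSymbol m P) (hm : 2 ≤ m) {lam : ℝ}
    (hlam : lam ≠ 0) (n : ℕ) {x : E3} (hx : x ≠ 0) :
    HasDecay fun s => oseenKernel lam (fun ξ => divNormSq P ξ * oseenSymbol lam ξ ^ n) s x := by
  have hx0 : 0 < ‖x‖ := norm_pos_iff.2 hx
  obtain ⟨c, hc, h⟩ := exists_le_driftDist hlam hx0
  obtain ⟨C, hC, hb⟩ := hP.norm_oseenKernel_mul_pow_le lam (c := c * ‖x‖) (by positivity) n hm
  refine ⟨fun s hs => (hP.hasDerivAt_oseenKernel_pow hm lam n hs x).continuousAt.continuousWithinAt,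
    ?_⟩
  set k := min c (c * ‖x‖)
  have hk : 0 < k := by positivity
  refine ⟨C * k ^ (-((m + n + 1 : ℝ) / 2)), by positivity, fun s hs => ?_⟩
  have h1 := h s hs x le_rfl
  have h2 : k * (1 + s) ≤ driftDist lam s x := by
    have k1 : k ≤ c := min_le_left _ _
    have k2 : k ≤ c * ‖x‖ := min_le_right _ _
    nlinarith
  have h3 : c * ‖x‖ ≤ driftDist lam s x := by nlinarith
  refine (hb s hs x h3).trans ?_
  rw [mul_assoc]
  gcongr
  have hm' : (2 : ℝ) ≤ m := by exact_mod_cast hm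
  have hn : (0 : ℝ) ≤ n := by positivity
  calc driftDist lam s x ^ (-((m + n + 1 : ℝ) / 2))
      ≤ (k * (1 + s)) ^ (-((m + n + 1 : ℝ) / 2)) :=
        Real.rpow_le_rpow_of_nonpos (by positivity) h2 (by linarith)
    _ = k ^ (-((m + n + 1 : ℝ) / 2)) * (1 + s) ^ (-((m + n + 1 : ℝ) / 2)) :=
        Real.mul_rpow hk.le (by positivity)
    _ ≤ _ := by
        gcongr ?_ * ?_
        -- The condition `m ≥ 2` makes the exponent `(m + n + 1)/2` at least the `3/2` required by
        -- `HasDecay`.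
        exact Real.rpow_le_rpow_of_exponent_le (by linarith) (by linarith)

lemma IsHomSymbol.hasDecay_oseenKernel (hP : IsHomSymbol m P) (hm : 2 ≤ m) {lam : ℝ}
    (hlam : lam ≠ 0) {x : E3} (hx : x ≠ 0) :
    HasDecay fun s => oseenKernel lam (divNormSq P) s x := by
  simpa using hP.hasDecay_oseenKernel_pow hm hlam 0 hx

/-- The integrand is the derivative of the kernel with `n` factors, so only times before the drift
covers half of `‖x‖` matter. There `D ≥ ‖x‖² / 4` yields `‖x‖^(-(m+n+1))`, and the `n` surplus
powers are bounded through `‖x‖ ≥ ε`. -/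
lemma IsHomSymbol.exists_norm_integral_oseenKernel_le (hP : IsHomSymbol m P) (hm : 2 ≤ m)
    {lam : ℝ} (hlam : lam ≠ 0) {ε : ℝ} (hε : 0 < ε) (n : ℕ) :
    ∃ C, 0 ≤ C ∧ ∀ x : E3, ε ≤ ‖x‖ →
      ‖∫ s in Ioi 0, oseenKernel lam (fun ξ => divNormSq P ξ * oseenSymbol lam ξ ^ (n + 1)) s x‖ ≤
        C * ‖x‖ ^ (-(m + 1 : ℝ)) := by
  obtain ⟨C, hC, hb⟩ := hP.norm_oseenKernel_mul_pow_le lam (c := ε ^ 2 / 4) (by positivity) n hm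
  refine ⟨C * ((1 / 4) ^ (-((m + n + 1 : ℝ) / 2)) * ε ^ (-(n : ℝ))), by positivity,
    fun x hx => ?_⟩
  have hx0 : 0 < ‖x‖ := hε.trans_le hx
  have hxne : x ≠ 0 := norm_pos_iff.1 hx0
  have hl : 0 < |lam| := abs_pos.2 hlam
  refine (hP.hasDecay_oseenKernel_pow hm hlam n hxne).norm_integral_le_of_hasDerivAt
    (hP.hasDecay_oseenKernel_pow hm hlam (n + 1) hxne)
    (fun s hs => hP.hasDerivAt_oseenKernel_pow hm lam n hs x)
    (r := ‖x‖ / (2 * |lam|)) (by positivity) fun s hs hsr => ?_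
  have h1 : |lam| * s ≤ ‖x‖ / 2 := by
    rw [le_div_iff₀ (by positivity)] at hsr
    linarith
  have h2 := le_driftDist_of_abs_mul_le hs h1
  have h3 : ‖x‖ ^ 2 * (1 / 4) ≤ driftDist lam s x := by linarith
  refine (hb s hs x (by nlinarith)).trans ?_
  rw [mul_assoc]
  gcongr
  calc driftDist lam s x ^ (-((m + n + 1 : ℝ) / 2))
      ≤ (‖x‖ ^ 2 * (1 / 4)) ^ (-((m + n + 1 : ℝ) / 2)) :=
        Real.rpow_le_rpow_of_nonpos (by positivity) h3 (by
          have : (0 : ℝ) ≤ m + n + 1 := by positivity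
          linarith)
    _ = (1 / 4) ^ (-((m + n + 1 : ℝ) / 2)) * (‖x‖ ^ (-(n : ℝ)) * ‖x‖ ^ (-(m + 1 : ℝ))) := by
        rw [Real.mul_rpow (by positivity) (by positivity), mul_comm, ← Real.rpow_natCast,
          ← Real.rpow_mul hx0.le, ← Real.rpow_add hx0]
        congr 2
        push_cast; ring
    _ ≤ _ := by
        rw [← mul_assoc]
        gcongr _ * ?_ * _
        exact Real.rpow_le_rpow_of_nonpos hε hx (by simp)

/-- In the wake only `D ≥ c(s + ‖x‖)` is available, so each derivative gains merely half a power of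
`s + ‖x‖`. With `m + 3` derivatives the exponent `(m + (m+3) + 1)/2 = m + 2` is reached, and
integration in `s` leaves `m + 1`. -/
lemma IsHomSymbol.exists_integral_norm_oseenKernel_le (hP : IsHomSymbol m P) (hm : 2 ≤ m)
    {lam : ℝ} (hlam : lam ≠ 0) {ε : ℝ} (hε : 0 < ε) :
    ∃ C, 0 ≤ C ∧ ∀ x : E3, ε ≤ ‖x‖ →
      ∫ s in Ioi 0, ‖oseenKernel lam (fun ξ => divNormSq P ξ * oseenSymbol lam ξ ^ (m + 3)) s x‖ ≤
        C * ‖x‖ ^ (-(m + 1 : ℝ)) := by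
  obtain ⟨c, hc, h⟩ := exists_le_driftDist hlam hε
  obtain ⟨C, hC, hb⟩ := hP.norm_oseenKernel_mul_pow_le lam (c := c * ε) (by positivity) (m + 3) hm
  refine ⟨C * c ^ (-(m + 2 : ℝ)) / (m + 1), by positivity, fun x hx => ?_⟩
  have hx0 : 0 < ‖x‖ := hε.trans_le hx
  have ha : -(m + 2 : ℝ) < -1 := by
    have : (0 : ℝ) ≤ m := by positivity
    linarith
  have hint : IntegrableOn (fun s : ℝ => C * c ^ (-(m + 2 : ℝ)) * (s + ‖x‖) ^ (-(m + 2 : ℝ)))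
      (Ioi 0) :=
    (integrableOn_add_rpow_Ioi_of_lt ha (by linarith)).const_mul _
  have hle : ∀ s ∈ Ioi (0 : ℝ),
      ‖oseenKernel lam (fun ξ => divNormSq P ξ * oseenSymbol lam ξ ^ (m + 3)) s x‖ ≤
        C * c ^ (-(m + 2 : ℝ)) * (s + ‖x‖) ^ (-(m + 2 : ℝ)) := by
    intro s (hs : 0 < s)
    have h1 := h s hs x hx
    refine (hb s hs x (by nlinarith)).trans ?_
    have e : -((m + (m + 3 : ℕ) + 1 : ℝ) / 2) = -(m + 2 : ℝ) := by push_cast; ring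
    rw [e, mul_assoc, ← Real.mul_rpow hc.le (by positivity)]
    exact mul_le_mul_of_nonneg_left
      (Real.rpow_le_rpow_of_nonpos (mul_pos hc (by linarith)) h1 (by linarith)) hC
  refine (integral_mono_of_nonneg (ae_of_all _ fun s => norm_nonneg _) hint ?_).trans_eq ?_
  · filter_upwards [ae_restrict_mem measurableSet_Ioi] with s hs using hle s hs
  · rw [integral_const_mul, integral_Ioi_add_rpow ha (by linarith), zero_add]
    have e : -(m + 2 : ℝ) + 1 = -(m + 1 : ℝ) := by ring
    rw [e]
    have : (m + 1 : ℝ) ≠ 0 := by positivity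
    field_simp

/-- The purely periodic kernel of degree `m` decays like `|x|^(-(m+1))`, uniformly in time. -/
theorem IsHomSymbol.exists_norm_periodicPart_oseenKernel_le (hP : IsHomSymbol m P) (hm : 2 ≤ m)
    {lam : ℝ} (hlam : lam ≠ 0) {T : ℝ} (hT : 0 < T) {ε : ℝ} (hε : 0 < ε) :
    ∃ C, 0 ≤ C ∧ ∀ x : E3, ε ≤ ‖x‖ → ∀ t ∈ Ioc 0 T,
      ‖periodicPart T (fun s => oseenKernel lam (divNormSq P) s x) t‖ ≤
        C * ‖x‖ ^ (-(m + 1 : ℝ)) := by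
  -- With `N = m + 2` the last derivative, of order `N + 1`, has the order `m + 3` treated by the
  -- absolute integral bound.
  obtain ⟨C₀, hC₀, h₀⟩ := exists_norm_periodicPart_le hT (m + 2)
  obtain ⟨C₁, hC₁, h₁⟩ := hP.exists_integral_norm_oseenKernel_le hm hlam hε
  choose C₂ hC₂ h₂ using hP.exists_norm_integral_oseenKernel_le hm hlam hε
  have hsum : 0 ≤ ∑ n ∈ Finset.range (m + 3), C₂ n := Finset.sum_nonneg fun n _ => hC₂ n
  refine ⟨C₀ * (C₁ + ∑ n ∈ Finset.range (m + 3), C₂ n), by positivity, fun x hx t ht => ?_⟩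
  have hxne : x ≠ 0 := norm_pos_iff.1 (hε.trans_le hx)
  have := h₀ (fun n s => oseenKernel lam (fun ξ => divNormSq P ξ * oseenSymbol lam ξ ^ n) s x)
    ((C₁ + ∑ n ∈ Finset.range (m + 3), C₂ n) * ‖x‖ ^ (-(m + 1 : ℝ)))
    (fun n => hP.hasDecay_oseenKernel_pow hm hlam n hxne)
    (fun n s hs => hP.hasDerivAt_oseenKernel_pow hm lam n hs x) (fun n hn => ?_) ?_ t ht
  · simpa [mul_assoc] using this
  · refine (h₂ n x hx).trans ?_
    gcongr
    refine (Finset.single_le_sum (f := C₂) (fun n _ => hC₂ n)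
      (Finset.mem_range.2 (by omega : n < m + 3))).trans ?_
    linarith
  · refine (h₁ x hx).trans ?_
    gcongr
    linarith

/-! ### Integrability of the kernel -/

/-- The polynomial weight `(1 + |x|)⁻⁴`. -/
noncomputable def weight (x : E3) : ℝ := (1 + ‖x‖) ^ (-4 : ℝ)

lemma weight_pos (x : E3) : 0 < weight x := by unfold weight; positivity

lemma weight_le_one (x : E3) : weight x ≤ 1 :=
  Real.rpow_le_one_of_one_le_of_nonpos (by linarith [norm_nonneg x]) (by norm_num)

lemma measurable_weight : Measurable weight := by unfold weight; fun_prop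

lemma integrable_weight : Integrable weight :=
  integrable_one_add_norm (by simp; norm_num)

lemma integrableOn_ball_norm_rpow :
    IntegrableOn (fun y : E3 => ‖y‖ ^ (-(5 / 2) : ℝ)) (Metric.ball 0 1) := by
  rw [integrableOn_fun_norm_addHaar volume (f := fun r : ℝ => r ^ (-(5 / 2) : ℝ))]
  have h : IntegrableOn (fun r : ℝ => r ^ (-(1 / 2) : ℝ)) (Ioo 0 1) :=
    (intervalIntegral.integrableOn_Ioo_rpow_iff one_pos).2 (by norm_num)
  refine h.congr_fun (fun r hr => ?_) measurableSet_Ioo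
  simp only [finrank_euclideanSpace_fin, smul_eq_mul]
  rw [← Real.rpow_natCast, ← Real.rpow_add hr.1]
  norm_num

/-- Near the singularity the power `(m+1)/2` is split as `(2m-3)/4 + 5/4`, with `D ≥ s` used for the
first part and `D ≥ |y|²` for the second. For `m ≤ 3` the resulting exponents are at most `3/4` in
time and equal to `5/2` in space, both locally integrable. Elsewhere `D ≥ (1 + s)/2`. -/
lemma driftDist_rpow_mul_weight_le (hm : 2 ≤ m) {lam s : ℝ} (hs : 0 < s) {x : E3}
    (hy : x + (lam * s) • EuclideanSpace.single (0 : Fin 3) (1 : ℝ) ≠ 0) :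
    driftDist lam s x ^ (-((m + 1 : ℝ) / 2)) * weight x ≤
      (Ioc 0 1).indicator (fun s : ℝ => s ^ (-((2 * m - 3 : ℝ) / 4))) s *
        (Metric.ball 0 1).indicator (fun y : E3 => ‖y‖ ^ (-(5 / 2) : ℝ))
          (x + (lam * s) • EuclideanSpace.single (0 : Fin 3) (1 : ℝ)) +
      2 ^ ((m + 1 : ℝ) / 2) * (1 + s) ^ (-(3 / 2) : ℝ) * weight x := by
  have hm' : (2 : ℝ) ≤ m := by exact_mod_cast hm
  have hw := weight_pos x
  have hD := driftDist_pos (lam := lam) hs x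
  have hDs := le_driftDist lam s x
  set y := x + (lam * s) • EuclideanSpace.single (0 : Fin 3) (1 : ℝ) with hydef
  have hDy : ‖y‖ ^ 2 ≤ driftDist lam s x := by rw [driftDist, ← hydef]; linarith
  have hypos : 0 < ‖y‖ := norm_pos_iff.2 hy
  have hn1 : 0 ≤ (Ioc 0 1).indicator (fun s : ℝ => s ^ (-((2 * m - 3 : ℝ) / 4))) s :=
    indicator_nonneg (fun r hr => Real.rpow_nonneg hr.1.le _) _
  have hn2 : 0 ≤ (Metric.ball 0 1).indicator (fun y : E3 => ‖y‖ ^ (-(5 / 2) : ℝ)) y :=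
    indicator_nonneg (fun r hr => by positivity) _
  by_cases hcase : s ≤ 1 ∧ y ∈ Metric.ball (0 : E3) 1
  · rw [indicator_of_mem (show s ∈ Ioc 0 1 from ⟨hs, hcase.1⟩), indicator_of_mem hcase.2]
    refine le_add_of_le_of_nonneg ?_ (by positivity)
    calc driftDist lam s x ^ (-((m + 1 : ℝ) / 2)) * weight x
        ≤ driftDist lam s x ^ (-((m + 1 : ℝ) / 2)) * 1 := by gcongr; exact weight_le_one x
      _ = driftDist lam s x ^ (-((2 * m - 3 : ℝ) / 4)) * driftDist lam s x ^ (-(5 / 4) : ℝ) := by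
          rw [mul_one, ← Real.rpow_add hD]; congr 1; ring
      _ ≤ s ^ (-((2 * m - 3 : ℝ) / 4)) * (‖y‖ ^ 2) ^ (-(5 / 4) : ℝ) := by
          gcongr ?_ * ?_
          · exact Real.rpow_le_rpow_of_nonpos hs hDs (by linarith)
          · exact Real.rpow_le_rpow_of_nonpos (by positivity) hDy (by norm_num)
      _ = _ := by
          rw [← Real.rpow_natCast, ← Real.rpow_mul hypos.le]
          norm_num
  · refine le_add_of_nonneg_of_le (mul_nonneg hn1 hn2) ?_
    gcongr
    have h1 : (1 + s) * 2⁻¹ ≤ driftDist lam s x := by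
      rcases lt_or_ge 1 s with h | h
      · linarith
      · have hy1 : 1 ≤ ‖y‖ := by
          by_contra! h2
          exact hcase ⟨h, by simpa using h2⟩
        rw [driftDist, ← hydef]
        nlinarith
    calc driftDist lam s x ^ (-((m + 1 : ℝ) / 2)) ≤ ((1 + s) * 2⁻¹) ^ (-((m + 1 : ℝ) / 2)) :=
          Real.rpow_le_rpow_of_nonpos (by positivity) h1 (by linarith)
      _ = 2 ^ ((m + 1 : ℝ) / 2) * (1 + s) ^ (-((m + 1 : ℝ) / 2)) := by
          rw [Real.mul_rpow (by positivity) (by positivity), Real.inv_rpow (by norm_num),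
            ← Real.rpow_neg (by norm_num), neg_neg, mul_comm]
      _ ≤ _ := by
          gcongr ?_ * ?_
          exact Real.rpow_le_rpow_of_exponent_le (by linarith) (by linarith)

/-- The half space-time `(0, ∞) × ℝ³`. -/
noncomputable abbrev halfMeasure : Measure (ℝ × E3) := (volume.restrict (Ioi 0)).prod volume

/-- At fixed `s`, translation invariance removes the drift from the singular spatial factor, so its
integral does not depend on `s`. The remaining time integrals converge at `0` because `m ≤ 3` and at
infinity because of the exponent `3/2`. -/
theorem IsHomSymbol.lintegral_oseenKernel_mul_weight_lt_top (hP : IsHomSymbol m P) (hm : 2 ≤ m)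
    (hm3 : m ≤ 3) (lam : ℝ) :
    ∫⁻ p, ‖oseenKernel lam (divNormSq P) p.1 p.2‖ₑ * ENNReal.ofReal (weight p.2) ∂halfMeasure
      < ⊤ := by
  obtain ⟨C, hC, hb⟩ := hP.norm_oseenKernel_le hm lam
  have hFm := measurable_oseenKernel lam (hP.isPolyGrowth_divNormSq hm)
  have hw := measurable_weight
  rw [lintegral_prod _ (by fun_prop)]
  set a : ℝ → ℝ := (Ioc 0 1).indicator (fun s : ℝ => s ^ (-((2 * m - 3 : ℝ) / 4)))
  set k : E3 → ℝ := (Metric.ball 0 1).indicator (fun y : E3 => ‖y‖ ^ (-(5 / 2) : ℝ))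
  have ha0 : ∀ s, 0 ≤ a s := indicator_nonneg (fun r hr => Real.rpow_nonneg hr.1.le _)
  have hk0 : ∀ y, 0 ≤ k y := indicator_nonneg (fun r hr => by positivity)
  have ham : Measurable a := (by fun_prop : Measurable _).indicator measurableSet_Ioc
  have hkm : Measurable k := (by fun_prop : Measurable _).indicator measurableSet_ball
  set A : ℝ := 2 ^ ((m + 1 : ℝ) / 2)
  have hA : 0 ≤ A := by positivity
  have hint_a : IntegrableOn a (Ioi 0) := by
    refine Integrable.integrableOn ?_
    rw [integrable_indicator_iff measurableSet_Ioc, integrableOn_Ioc_iff_integrableOn_Ioo]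
    refine (intervalIntegral.integrableOn_Ioo_rpow_iff one_pos).2 ?_
    have : (m : ℝ) ≤ 3 := by exact_mod_cast hm3
    linarith
  have hint_k : Integrable k := by
    rw [integrable_indicator_iff measurableSet_ball]; exact integrableOn_ball_norm_rpow
  set K := ∫⁻ y, ENNReal.ofReal (k y)
  set W := ∫⁻ y, ENNReal.ofReal (weight y)
  have hK : K < ⊤ := by
    have := hint_k.2
    rwa [hasFiniteIntegral_iff_ofReal (ae_of_all _ hk0)] at this
  have hW : W < ⊤ := by
    have := integrable_weight.2
    rwa [hasFiniteIntegral_iff_ofReal (ae_of_all _ fun x => (weight_pos x).le)] at this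
  have hinner : ∀ s ∈ Ioi (0 : ℝ),
      ∫⁻ x, ‖oseenKernel lam (divNormSq P) s x‖ₑ * ENNReal.ofReal (weight x) ≤
        ENNReal.ofReal C * (ENNReal.ofReal (a s) * K +
          ENNReal.ofReal (A * (1 + s) ^ (-(3 / 2) : ℝ)) * W) := by
    intro s (hs : 0 < s)
    set e : E3 := (lam * s) • EuclideanSpace.single (0 : Fin 3) (1 : ℝ) with he
    have hne : ∀ᵐ x : E3, x + e ≠ 0 := by
      have : ∀ᵐ x : E3, x ≠ -e := by simp [ae_iff, measure_singleton]
      filter_upwards [this] with x hx h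
      exact hx (eq_neg_of_add_eq_zero_left h)
    calc ∫⁻ x, ‖oseenKernel lam (divNormSq P) s x‖ₑ * ENNReal.ofReal (weight x)
        ≤ ∫⁻ x, ENNReal.ofReal C * (ENNReal.ofReal (a s) * ENNReal.ofReal (k (x + e)) +
            ENNReal.ofReal (A * (1 + s) ^ (-(3 / 2) : ℝ)) * ENNReal.ofReal (weight x)) := by
          refine lintegral_mono_ae ?_
          filter_upwards [hne] with x hx
          rw [← ofReal_norm, ← ENNReal.ofReal_mul (norm_nonneg _),
            ← ENNReal.ofReal_mul (ha0 s), ← ENNReal.ofReal_mul (by positivity),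
            ← ENNReal.ofReal_add (mul_nonneg (ha0 _) (hk0 _))
              (mul_nonneg (by positivity) (weight_pos x).le), ← ENNReal.ofReal_mul hC]
          refine ENNReal.ofReal_le_ofReal ?_
          calc _ ≤ C * driftDist lam s x ^ (-((m + 1 : ℝ) / 2)) * weight x := by
                gcongr
                · exact (weight_pos x).le
                · exact hb s hs x
            _ = C * (driftDist lam s x ^ (-((m + 1 : ℝ) / 2)) * weight x) := mul_assoc _ _ _
            _ ≤ _ := by
                gcongr
                exact driftDist_rpow_mul_weight_le hm hs hx
      _ = _ := by
          rw [lintegral_const_mul _ (by fun_prop), lintegral_add_left (by fun_prop),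
            lintegral_const_mul _ (by fun_prop), lintegral_const_mul _ (by fun_prop),
            lintegral_add_right_eq_self (fun x => ENNReal.ofReal (k x)) e]
  refine (setLIntegral_mono (by fun_prop) hinner).trans_lt ?_
  rw [lintegral_const_mul _ (by fun_prop), lintegral_add_left (by fun_prop),
    lintegral_mul_const _ (by fun_prop), lintegral_mul_const _ (by fun_prop)]
  have h1 : ∫⁻ s in Ioi 0, ENNReal.ofReal (a s) < ⊤ := by
    have := hint_a.2
    rwa [hasFiniteIntegral_iff_ofReal (ae_of_all _ ha0)] at this
  have h2 : ∫⁻ s in Ioi 0, ENNReal.ofReal (A * (1 + s) ^ (-(3 / 2) : ℝ)) < ⊤ := by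
    have := (integrableOn_one_add_rpow.const_mul A).2
    rwa [hasFiniteIntegral_iff_ofReal] at this
    filter_upwards [ae_restrict_mem measurableSet_Ioi] with s hs
    have : (0 : ℝ) < s := hs
    positivity
  exact ENNReal.mul_lt_top ENNReal.ofReal_lt_top
    (ENNReal.add_lt_top.2 ⟨ENNReal.mul_lt_top h1 hK, ENNReal.mul_lt_top h2 hW⟩)

end Kernel

open AddCircle

/-! ### Schwartz-Bruhat functions and their Fourier coefficients -/

section SchwartzBruhat

variable {T : ℝ}

lemma isOpenQuotientMap_coe_prod : IsOpenQuotientMap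
    (Prod.map (fun t : ℝ => (t : AddCircle T)) (id : E3 → E3)) :=
  QuotientAddGroup.isOpenQuotientMap_mk.prodMap IsOpenQuotientMap.id

lemma IsSchwartzBruhat.continuous {φ : G T → ℂ} (hφ : IsSchwartzBruhat T φ) : Continuous φ :=
  isOpenQuotientMap_coe_prod.continuous_comp_iff.1 hφ.smooth.continuous

lemma IsSchwartzBruhat.exists_norm_le {φ : G T → ℂ} (hφ : IsSchwartzBruhat T φ) :
    ∃ C, 0 ≤ C ∧ ∀ p, ‖φ p‖ ≤ C * weight p.2 := by
  obtain ⟨C, h⟩ := hφ.decay 4 0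
  have hC : 0 ≤ C := (by positivity : (0 : ℝ) ≤ _).trans (h 0 0)
  refine ⟨C, hC, fun ⟨t, x⟩ => ?_⟩
  induction t using QuotientAddGroup.induction_on with
  | H t =>
    have := h t x
    rw [norm_iteratedFDeriv_zero] at this
    rw [weight, Real.rpow_neg (by positivity), ← div_eq_mul_inv, le_div_iff₀ (by positivity),
      mul_comm]
    exact_mod_cast this

/-- The time derivative of a function on `G`. -/
noncomputable def timeDeriv (φ : G T → ℂ) : G T → ℂ :=
  fun p => deriv (fun s : ℝ => φ (p.1 + (s : AddCircle T), p.2)) 0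

/-- Common source of the stability of the test space under space and time derivatives. -/
lemma IsSchwartzBruhat.of_lift_eq_fderiv {φ ψ : G T → ℂ} (hφ : IsSchwartzBruhat T φ)
    (v : ℝ × E3) (h : ∀ (t : ℝ) (x : E3), ψ ((t : AddCircle T), x) =
      fderiv ℝ (fun p : ℝ × E3 => φ ((p.1 : AddCircle T), p.2)) (t, x) v) :
    IsSchwartzBruhat T ψ := by
  have e : (fun p : ℝ × E3 => ψ ((p.1 : AddCircle T), p.2)) =
      fun p => fderiv ℝ (fun p : ℝ × E3 => φ ((p.1 : AddCircle T), p.2)) p v :=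
    funext fun p => h p.1 p.2
  have hd : ContDiff ℝ ∞ (fderiv ℝ (fun p : ℝ × E3 => φ ((p.1 : AddCircle T), p.2))) :=
    hφ.smooth.fderiv_right (by norm_num)
  constructor
  · rw [e]
    exact hd.clm_apply contDiff_const
  · intro m n
    obtain ⟨C, hC⟩ := hφ.decay m (n + 1)
    refine ⟨‖v‖ * C, fun t x => ?_⟩
    rw [e]
    calc _ ≤ (1 + ‖x‖) ^ m * (‖v‖ * ‖iteratedFDeriv ℝ n (fderiv ℝ
          (fun p : ℝ × E3 => φ ((p.1 : AddCircle T), p.2))) (t, x)‖) := by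
          gcongr
          exact norm_iteratedFDeriv_clm_apply_const hd.contDiffAt (by exact_mod_cast le_top)
      _ = ‖v‖ * ((1 + ‖x‖) ^ m * ‖iteratedFDeriv ℝ (n + 1)
          (fun p : ℝ × E3 => φ ((p.1 : AddCircle T), p.2)) (t, x)‖) := by
          rw [norm_iteratedFDeriv_fderiv]; ring
      _ ≤ _ := by gcongr; exact hC t x

lemma IsSchwartzBruhat.differentiable_lift {φ : G T → ℂ} (hφ : IsSchwartzBruhat T φ) :
    Differentiable ℝ (fun p : ℝ × E3 => φ ((p.1 : AddCircle T), p.2)) :=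
  hφ.smooth.differentiable (by simp)

lemma IsSchwartzBruhat.hasFDerivAt_space {φ : G T → ℂ} (hφ : IsSchwartzBruhat T φ) (t : ℝ)
    (x : E3) : HasFDerivAt (fun y : E3 => φ ((t : AddCircle T), y))
      ((fderiv ℝ (fun p : ℝ × E3 => φ ((p.1 : AddCircle T), p.2)) (t, x)).comp
        (ContinuousLinearMap.inr ℝ ℝ E3)) x :=
  (hφ.differentiable_lift (t, x)).hasFDerivAt.comp x (hasFDerivAt_prodMk_right t x)

lemma IsSchwartzBruhat.differentiable_space {φ : G T → ℂ} (hφ : IsSchwartzBruhat T φ)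
    (t : AddCircle T) : Differentiable ℝ (fun y : E3 => φ (t, y)) := by
  induction t using QuotientAddGroup.induction_on with
  | H t => exact fun x => (hφ.hasFDerivAt_space t x).differentiableAt

lemma IsSchwartzBruhat.spaceDeriv {φ : G T → ℂ} (hφ : IsSchwartzBruhat T φ) (i : Fin 3) :
    IsSchwartzBruhat T (spaceDeriv i φ) := by
  refine hφ.of_lift_eq_fderiv (0, EuclideanSpace.single i 1) fun t x => ?_
  rw [TPOseen.spaceDeriv, (hφ.hasFDerivAt_space t x).fderiv]
  rfl

lemma IsSchwartzBruhat.hasDerivAt_time {φ : G T → ℂ} (hφ : IsSchwartzBruhat T φ) (t : ℝ)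
    (x : E3) : HasDerivAt (fun s : ℝ => φ ((s : AddCircle T), x))
      (fderiv ℝ (fun p : ℝ × E3 => φ ((p.1 : AddCircle T), p.2)) (t, x) (1, 0)) t :=
  HasFDerivAt.comp_hasDerivAt (l := fun p : ℝ × E3 => φ ((p.1 : AddCircle T), p.2))
    (f := fun s : ℝ => (s, x)) t (hφ.differentiable_lift (t, x)).hasFDerivAt
    ((hasDerivAt_id t).prodMk (hasDerivAt_const t x))

lemma IsSchwartzBruhat.timeDeriv_coe {φ : G T → ℂ} (hφ : IsSchwartzBruhat T φ) (t : ℝ)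
    (x : E3) : timeDeriv φ ((t : AddCircle T), x) =
      fderiv ℝ (fun p : ℝ × E3 => φ ((p.1 : AddCircle T), p.2)) (t, x) (1, 0) := by
  have h := hφ.hasDerivAt_time t x
  rw [← add_zero t] at h
  have h2 := h.comp_const_add t 0
  simp only [AddCircle.coe_add] at h2
  rw [TPOseen.timeDeriv, h2.deriv, add_zero]

lemma IsSchwartzBruhat.timeDeriv {φ : G T → ℂ} (hφ : IsSchwartzBruhat T φ) :
    IsSchwartzBruhat T (timeDeriv φ) :=
  hφ.of_lift_eq_fderiv (1, 0) hφ.timeDeriv_coe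

lemma norm_fourier_apply (k : ℤ) (t : AddCircle T) : ‖fourier k t‖ = 1 := by
  rw [fourier_apply]; exact Circle.norm_coe _

lemma continuous_character (k : ℤ) (ξ : E3) :
    Continuous fun p : G T => fourier k p.1 * planeWave ξ p.2 := by
  unfold planeWave; fun_prop

lemma IsSchwartzBruhat.integrable_space {φ : G T → ℂ} (hφ : IsSchwartzBruhat T φ)
    (t : AddCircle T) : Integrable (fun x => φ (t, x)) := by
  obtain ⟨C, -, h⟩ := hφ.exists_norm_le
  refine (integrable_weight.const_mul C).mono' ?_ (ae_of_all _ fun x => h (t, x))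
  exact (hφ.continuous.comp (by fun_prop)).aestronglyMeasurable

variable [hT : Fact (0 < T)]

instance : Measure.IsAddHaarMeasure (haarG T) := by unfold haarG; infer_instance

instance : SigmaFinite (haarG T) := by unfold haarG; infer_instance

lemma integrable_weight_haarG : Integrable (fun p : G T => weight p.2) (haarG T) :=
  integrable_weight.comp_snd _

lemma IsSchwartzBruhat.integrable {φ : G T → ℂ} (hφ : IsSchwartzBruhat T φ) :
    Integrable φ (haarG T) := by
  obtain ⟨C, -, h⟩ := hφ.exists_norm_le
  exact (integrable_weight_haarG.const_mul C).mono' hφ.continuous.aestronglyMeasurable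
    (ae_of_all _ h)

lemma invFourierG_eq (φ : G T → ℂ) (k : ℤ) (ξ : E3) :
    invFourierG φ k ξ = ∫ p, fourier k p.1 * planeWave ξ p.2 * φ p ∂(haarG T) := rfl

lemma IsSchwartzBruhat.integrable_character_mul {φ : G T → ℂ} (hφ : IsSchwartzBruhat T φ) (k : ℤ)
    (ξ : E3) : Integrable (fun p : G T => fourier k p.1 * planeWave ξ p.2 * φ p) (haarG T) := by
  refine hφ.integrable.norm.mono' ?_ (ae_of_all _ fun p => ?_)
  · exact ((continuous_character k ξ).mul hφ.continuous).aestronglyMeasurable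
  · rw [norm_mul, norm_mul, norm_fourier_apply, norm_planeWave, one_mul, one_mul]

lemma IsSchwartzBruhat.norm_invFourierG_le (φ : G T → ℂ) (k : ℤ) (ξ : E3) :
    ‖invFourierG φ k ξ‖ ≤ ∫ p, ‖φ p‖ ∂(haarG T) := by
  rw [invFourierG_eq]
  refine (norm_integral_le_integral_norm _).trans_eq ?_
  simp_rw [norm_mul, norm_fourier_apply, norm_planeWave, one_mul]

lemma IsSchwartzBruhat.invFourierG_spaceDeriv {φ : G T → ℂ} (hφ : IsSchwartzBruhat T φ)
    (i : Fin 3) (k : ℤ) (ξ : E3) :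
    invFourierG (TPOseen.spaceDeriv i φ) k ξ = -(Complex.I * ((ξ i : ℝ) : ℂ)) * invFourierG φ k ξ := by
  have hψ := hφ.spaceDeriv i
  have h1 := hφ.integrable_character_mul k ξ
  have h2 := hψ.integrable_character_mul k ξ
  rw [haarG] at h1 h2
  rw [invFourierG_eq, invFourierG_eq, haarG, integral_prod _ h1, integral_prod _ h2,
    ← integral_const_mul]
  congr 1
  ext t
  simp_rw [mul_assoc (fourier k t)]
  rw [integral_const_mul, integral_const_mul]
  have hw : ∀ x, fderiv ℝ (planeWave ξ) x (EuclideanSpace.single i 1) =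
      Complex.I * ((ξ i : ℝ) : ℂ) * planeWave ξ x := by
    intro x
    rw [(hasFDerivAt_planeWave ξ x).fderiv]
    simp [EuclideanSpace.inner_single_right]
    ring
  have hwm : ∀ f : E3 → ℂ, Integrable f → Integrable fun x => planeWave ξ x * f x := by
    intro f hf
    simp_rw [planeWave_comm ξ]
    exact integrable_planeWave_mul hf ξ
  have key := integral_mul_fderiv_eq_neg_fderiv_mul_of_integrable (μ := (volume : Measure E3))
    (f := planeWave ξ) (g := fun x => φ (t, x)) (v := EuclideanSpace.single i 1) ?_ ?_ ?_
    (fun x _ => (hasFDerivAt_planeWave ξ x).differentiableAt)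
    (fun x _ => hφ.differentiable_space t x)
  · have e : ∫ x, planeWave ξ x * TPOseen.spaceDeriv i φ (t, x) =
        - ∫ x, (Complex.I * ((ξ i : ℝ) : ℂ)) * (planeWave ξ x * φ (t, x)) := by
      refine Eq.trans key ?_
      congr 2
      ext x
      rw [hw]; ring
    rw [e, integral_const_mul]
    ring
  · simp_rw [hw, mul_assoc]
    simpa only [mul_assoc] using
      (hwm _ (hφ.integrable_space t)).const_mul (Complex.I * ((ξ i : ℝ) : ℂ))
  · exact hwm _ (hψ.integrable_space t)
  · exact hwm _ (hφ.integrable_space t)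

lemma integral_haarAddCircle_eq {E : Type*} [NormedAddCommGroup E] [NormedSpace ℝ E]
    (f : AddCircle T → E) :
    ∫ t, f t ∂haarAddCircle = T⁻¹ • ∫ t in Ioc 0 T, f (t : AddCircle T) := by
  rw [integral_haarAddCircle, ← AddCircle.integral_preimage T 0 f, zero_add]

lemma lintegral_haarAddCircle_eq (f : AddCircle T → ℝ≥0∞) :
    ∫⁻ t, f t ∂haarAddCircle = (ENNReal.ofReal T)⁻¹ * ∫⁻ t in Ioc 0 T, f (t : AddCircle T) := by
  have h := AddCircle.lintegral_preimage T 0 f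
  rw [zero_add, volume_eq_smul_haarAddCircle, lintegral_smul_measure] at h
  rw [h, smul_eq_mul, ← mul_assoc, ENNReal.inv_mul_cancel (by simpa using hT.out)
    ENNReal.ofReal_ne_top, one_mul]

/-- Integration by parts over one period; the boundary terms cancel by periodicity. -/
lemma IsSchwartzBruhat.integral_fourier_mul_timeDeriv {φ : G T → ℂ} (hφ : IsSchwartzBruhat T φ)
    (k : ℤ) (x : E3) :
    ∫ t, fourier k t * TPOseen.timeDeriv φ (t, x) ∂haarAddCircle =
      -(2 * Real.pi * Complex.I * k / T) * ∫ t, fourier k t * φ (t, x) ∂haarAddCircle := by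
  have hψ := hφ.timeDeriv
  have hd : ∀ t : ℝ, HasDerivAt (fun s : ℝ => fourier k (s : AddCircle T) * φ ((s : AddCircle T), x))
      (2 * Real.pi * Complex.I * k / T * fourier k (t : AddCircle T) * φ ((t : AddCircle T), x) +
        fourier k (t : AddCircle T) * TPOseen.timeDeriv φ ((t : AddCircle T), x)) t := by
    intro t
    rw [hφ.timeDeriv_coe]
    exact (hasDerivAt_fourier T k t).mul (hφ.hasDerivAt_time t x)
  have hcφ : Continuous fun t : ℝ => φ ((t : AddCircle T), x) :=
    hφ.continuous.comp ((AddCircle.continuous_mk' T).prodMk continuous_const)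
  have hcψ : Continuous fun t : ℝ => TPOseen.timeDeriv φ ((t : AddCircle T), x) :=
    hψ.continuous.comp ((AddCircle.continuous_mk' T).prodMk continuous_const)
  have hcf : Continuous fun t : ℝ => fourier k (t : AddCircle T) :=
    (fourier k).continuous.comp (AddCircle.continuous_mk' T)
  have hc1 : Continuous fun t : ℝ =>
      2 * Real.pi * Complex.I * k / T * fourier k (t : AddCircle T) * φ ((t : AddCircle T), x) :=
    (continuous_const.mul hcf).mul hcφ
  have hc2 : Continuous fun t : ℝ =>
      fourier k (t : AddCircle T) * TPOseen.timeDeriv φ ((t : AddCircle T), x) := hcf.mul hcψ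
  have hftc := intervalIntegral.integral_eq_sub_of_hasDerivAt (a := 0) (b := T)
    (fun t _ => hd t) ((hc1.add hc2).intervalIntegrable _ _)
  rw [AddCircle.coe_period, ← AddCircle.coe_zero, sub_self, intervalIntegral.integral_add
    (hc1.intervalIntegrable _ _) (hc2.intervalIntegrable _ _)] at hftc
  simp_rw [mul_assoc (2 * Real.pi * Complex.I * k / T : ℂ)] at hftc
  rw [intervalIntegral.integral_const_mul, intervalIntegral.integral_of_le hT.out.le,
    intervalIntegral.integral_of_le hT.out.le] at hftc
  rw [integral_haarAddCircle_eq, integral_haarAddCircle_eq, eq_neg_of_add_eq_zero_right hftc]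
  simp only [Complex.real_smul]
  ring

lemma IsSchwartzBruhat.invFourierG_timeDeriv {φ : G T → ℂ} (hφ : IsSchwartzBruhat T φ)
    (k : ℤ) (ξ : E3) : invFourierG (TPOseen.timeDeriv φ) k ξ =
      -(2 * Real.pi * Complex.I * k / T) * invFourierG φ k ξ := by
  have hψ := hφ.timeDeriv
  have h1 := hφ.integrable_character_mul k ξ
  have h2 := hψ.integrable_character_mul k ξ
  rw [haarG] at h1 h2
  rw [invFourierG_eq, invFourierG_eq, haarG, integral_prod_symm _ h1, integral_prod_symm _ h2,
    ← integral_const_mul]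
  congr 1
  ext x
  simp_rw [mul_comm (fourier k _) (planeWave ξ x), mul_assoc (planeWave ξ x)]
  rw [integral_const_mul, integral_const_mul, hφ.integral_fourier_mul_timeDeriv]
  ring

lemma IsSchwartzBruhat.exists_abs_coord_pow_mul_le (i : Fin 3) (n : ℕ) :
    ∀ {φ : G T → ℂ}, IsSchwartzBruhat T φ →
      ∃ C, ∀ k ξ, |ξ i| ^ n * ‖invFourierG φ k ξ‖ ≤ C := by
  induction n with
  | zero => exact fun {φ} _ => ⟨_, fun k ξ => by simpa using norm_invFourierG_le φ k ξ⟩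
  | succ n ih =>
    intro φ hφ
    obtain ⟨C, hC⟩ := ih (hφ.spaceDeriv i)
    refine ⟨C, fun k ξ => ?_⟩
    have := hC k ξ
    rw [hφ.invFourierG_spaceDeriv, norm_mul, norm_neg, norm_mul, Complex.norm_I, one_mul,
      Complex.norm_real, Real.norm_eq_abs, ← mul_assoc, ← pow_succ] at this
    exact this

lemma IsSchwartzBruhat.exists_norm_invFourierG_mul_le {φ : G T → ℂ} (hφ : IsSchwartzBruhat T φ)
    (n : ℕ) : ∃ C, ∀ k ξ, (1 + ‖ξ‖) ^ n * ‖invFourierG φ k ξ‖ ≤ C := by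
  choose C hC using fun i => hφ.exists_abs_coord_pow_mul_le i n
  refine ⟨2 ^ n * ((∫ p, ‖φ p‖ ∂(haarG T)) + 3 ^ n * ∑ i, C i), fun k ξ => ?_⟩
  calc (1 + ‖ξ‖) ^ n * ‖invFourierG φ k ξ‖
      ≤ 2 ^ n * (1 + 3 ^ n * ∑ i : Fin 3, |ξ i| ^ n) * ‖invFourierG φ k ξ‖ := by
        gcongr; exact one_add_norm_pow_le n ξ
    _ = 2 ^ n * (‖invFourierG φ k ξ‖ + 3 ^ n * ∑ i : Fin 3, |ξ i| ^ n * ‖invFourierG φ k ξ‖) := by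
        rw [← Finset.sum_mul]; ring
    _ ≤ _ := by
        gcongr with i
        · exact norm_invFourierG_le φ k ξ
        · exact hC i k ξ

/-- Fourier coefficients of Schwartz-Bruhat functions decay rapidly. -/
lemma IsSchwartzBruhat.exists_norm_invFourierG_le {φ : G T → ℂ} (hφ : IsSchwartzBruhat T φ) :
    ∃ C, 0 ≤ C ∧ ∀ (k : ℤ) ξ, k ≠ 0 →
      ‖invFourierG φ k ξ‖ ≤ C * (1 / (k : ℝ) ^ 2) * weight ξ := by
  -- Two time derivatives supply the summable factor `1/k²`, and four powers of `ξ` supply the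
  -- weight.
  obtain ⟨C, hC⟩ := hφ.timeDeriv.timeDeriv.exists_norm_invFourierG_mul_le 4
  have hC0 : 0 ≤ C := (by positivity : (0 : ℝ) ≤ _).trans (hC 0 0)
  have hT0 := hT.out
  refine ⟨C * (T / (2 * Real.pi)) ^ 2, by positivity, fun k ξ hk => ?_⟩
  have h := hC k ξ
  have hk' : (0 : ℝ) < |(k : ℝ)| := abs_pos.2 (by exact_mod_cast hk)
  have hn : ‖-(2 * Real.pi * Complex.I * k / T : ℂ)‖ = 2 * Real.pi * |(k : ℝ)| / T := by
    rw [norm_neg, norm_div, norm_mul, norm_mul, norm_mul, Complex.norm_I, Complex.norm_real,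
      Complex.norm_real, Complex.norm_intCast, Real.norm_of_nonneg Real.pi_pos.le,
      Real.norm_of_nonneg hT0.le]
    simp
  rw [hφ.timeDeriv.invFourierG_timeDeriv, hφ.invFourierG_timeDeriv, norm_mul, norm_mul, hn] at h
  rw [weight, Real.rpow_neg (by positivity), ← sq_abs (k : ℝ)]
  have e : (1 + ‖ξ‖) ^ (4 : ℝ) = (1 + ‖ξ‖) ^ 4 := by norm_cast
  have h2 : ‖invFourierG φ k ξ‖ = ((1 + ‖ξ‖) ^ 4 * (2 * Real.pi * |(k : ℝ)| / T *
      (2 * Real.pi * |(k : ℝ)| / T * ‖invFourierG φ k ξ‖))) *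
      ((T / (2 * Real.pi)) ^ 2 * (1 / |(k : ℝ)| ^ 2) * ((1 + ‖ξ‖) ^ 4)⁻¹) := by
    have := Real.pi_pos
    field_simp
  rw [e, h2]
  calc _ ≤ C * ((T / (2 * Real.pi)) ^ 2 * (1 / |(k : ℝ)| ^ 2) * ((1 + ‖ξ‖) ^ 4)⁻¹) := by
        gcongr
    _ = _ := by ring

end SchwartzBruhat

/-! ### The function representing the purely periodic fundamental solution -/

section Representation

variable {T : ℝ} [hT : Fact (0 < T)] {m : ℕ} {P : E3 → ℂ}

/-- The purely periodic part of the time periodization of an Oseen kernel, as a function on `G`. -/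
noncomputable def kernelFun (T lam : ℝ) [Fact (0 < T)] (P : E3 → ℂ) : G T → ℂ := fun p =>
  periodicPart T (fun s => oseenKernel lam (divNormSq P) s p.2) (equivIoc T 0 p.1 : ℝ)

lemma kernelFun_coe (lam : ℝ) (P : E3 → ℂ) {t : ℝ} (ht : t ∈ Ioc 0 T) (x : E3) :
    kernelFun T lam P ((t : AddCircle T), x) =
      periodicPart T (fun s => oseenKernel lam (divNormSq P) s x) t := by
  rw [kernelFun, equivIoc_coe_of_mem (by rwa [zero_add])]

lemma IsHomSymbol.exists_norm_kernelFun_le (hP : IsHomSymbol m P) (hm : 2 ≤ m)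
    {lam : ℝ} (hlam : lam ≠ 0) {ε : ℝ} (hε : 0 < ε) :
    ∃ C, 0 ≤ C ∧ ∀ p : G T, ε ≤ ‖p.2‖ → ‖kernelFun T lam P p‖ ≤ C * ‖p.2‖ ^ (-(m + 1 : ℝ)) := by
  obtain ⟨C, hC, h⟩ := hP.exists_norm_periodicPart_oseenKernel_le hm hlam hT.out hε
  refine ⟨C, hC, fun p hp => h p.2 hp _ ?_⟩
  simpa using (equivIoc T 0 p.1).2

lemma measurable_equivIoc : Measurable fun t : AddCircle T => (equivIoc T 0 t : ℝ) :=
  measurable_subtype_coe.comp (measurableEquivIoc T 0).measurable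

lemma ae_snd_ne_zero : ∀ᵐ p : G T ∂(haarG T), p.2 ≠ 0 := by
  have h : ∀ᵐ x : E3, x ≠ 0 := by simp [ae_iff, measure_singleton]
  exact Measure.quasiMeasurePreserving_snd.ae h

lemma IsHomSymbol.aestronglyMeasurable_kernelFun (hP : IsHomSymbol m P) (hm : 2 ≤ m)
    {lam : ℝ} (hlam : lam ≠ 0) : AEStronglyMeasurable (kernelFun T lam P) (haarG T) := by
  have hF := measurable_oseenKernel lam (hP.isPolyGrowth_divNormSq hm)
  have hr := measurable_equivIoc (T := T)
  have h1 : AEStronglyMeasurable (fun p : G T => ∑' j : ℕ,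
      oseenKernel lam (divNormSq P) ((equivIoc T 0 p.1 : ℝ) + j * T) p.2) (haarG T) := by
    refine aestronglyMeasurable_of_tendsto_ae atTop (f := fun (n : ℕ) (p : G T) =>
      ∑ j ∈ Finset.range n, oseenKernel lam (divNormSq P) ((equivIoc T 0 p.1 : ℝ) + j * T) p.2)
      (fun n => ?_) ?_
    · refine Finset.aestronglyMeasurable_fun_sum _ fun j _ => Measurable.aestronglyMeasurable ?_
      exact hF.comp (g := fun p : ℝ × E3 => oseenKernel lam (divNormSq P) p.1 p.2)
        (f := fun p : G T => ((equivIoc T 0 p.1 : ℝ) + j * T, p.2))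
        (((hr.comp measurable_fst).add_const _).prodMk measurable_snd)
    · filter_upwards [ae_snd_ne_zero] with p hp
      have ht : 0 < (equivIoc T 0 p.1 : ℝ) := (equivIoc T 0 p.1).2.1
      exact ((hP.hasDecay_oseenKernel hm hlam hp).summable_shift hT.out ht).hasSum.tendsto_sum_nat
  have h2 : AEStronglyMeasurable (fun p : G T =>
      ∫ s in Ioi 0, oseenKernel lam (divNormSq P) s p.2) (haarG T) := by
    refine StronglyMeasurable.aestronglyMeasurable ?_
    exact (hF.stronglyMeasurable.integral_prod_left (μ := volume.restrict (Ioi 0))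
      (f := fun s x => oseenKernel lam (divNormSq P) s x)).comp_measurable measurable_snd
  exact (h1.const_mul _).sub h2

/-- By Tonelli the periodized sum unfolds to an integral over the half line. The sum and the mean
each contribute the same half-space integral, which is the source of the factor `2`. -/
lemma IsHomSymbol.lintegral_kernelFun_mul_weight_lt_top (hP : IsHomSymbol m P) (hm : 2 ≤ m)
    (hm3 : m ≤ 3) (lam : ℝ) :
    ∫⁻ p, ‖kernelFun T lam P p‖ₑ * ENNReal.ofReal (weight p.2) ∂(haarG T) < ⊤ := by
  have hF := measurable_oseenKernel lam (hP.isPolyGrowth_divNormSq hm)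
  have hr := measurable_equivIoc (T := T)
  have hw := measurable_weight
  set F : ℝ → E3 → ℂ := oseenKernel lam (divNormSq P) with hFdef
  set J : E3 → ℝ≥0∞ := fun x => ∫⁻ s in Ioi 0, ‖F s x‖ₑ with hJ
  have hJm : Measurable J :=
    Measurable.lintegral_prod_left' (μ := volume.restrict (Ioi 0))
      (f := fun p : ℝ × E3 => ‖F p.1 p.2‖ₑ) (by fun_prop)
  have hFs : ∀ x, Measurable fun s => ‖F s x‖ₑ := fun x =>
    (hF.comp (measurable_id.prodMk measurable_const)).enorm
  have hmain := hP.lintegral_oseenKernel_mul_weight_lt_top hm hm3 lam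
  rw [← hFdef, lintegral_prod_symm _ (by fun_prop)] at hmain
  have e1 : ∀ x, ∫⁻ s in Ioi 0, ‖F s x‖ₑ * ENNReal.ofReal (weight x) =
      J x * ENNReal.ofReal (weight x) := fun x => lintegral_mul_const _ (hFs x)
  simp_rw [e1] at hmain
  have hsum : Measurable fun p : G T => ∑' j : ℕ, ‖F ((equivIoc T 0 p.1 : ℝ) + j * T) p.2‖ₑ := by
    refine Measurable.tsum fun j => ?_
    exact (hF.comp (g := fun p : ℝ × E3 => F p.1 p.2)
        (f := fun p : G T => ((equivIoc T 0 p.1 : ℝ) + j * T, p.2))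
        (((hr.comp measurable_fst).add_const _).prodMk measurable_snd)).enorm
  calc ∫⁻ p, ‖kernelFun T lam P p‖ₑ * ENNReal.ofReal (weight p.2) ∂(haarG T)
      ≤ ∫⁻ p : G T, (ENNReal.ofReal T * ∑' j : ℕ, ‖F ((equivIoc T 0 p.1 : ℝ) + j * T) p.2‖ₑ +
          J p.2) * ENNReal.ofReal (weight p.2) ∂(haarG T) := by
        refine lintegral_mono fun p => ?_
        gcongr
        rw [kernelFun, periodicPart]
        refine enorm_sub_le.trans (add_le_add ?_ (enorm_integral_le_lintegral_enorm _))
        rw [enorm_mul]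
        gcongr
        · rw [← ofReal_norm, Complex.norm_real, Real.norm_of_nonneg hT.out.le]
        · exact enorm_tsum_le_tsum_enorm
    _ = ∫⁻ x, (ENNReal.ofReal T)⁻¹ * ∫⁻ t in Ioc 0 T,
          (ENNReal.ofReal T * ∑' j : ℕ, ‖F (t + j * T) x‖ₑ + J x) * ENNReal.ofReal (weight x) := by
        rw [haarG, lintegral_prod_symm _ (by fun_prop)]
        congr 1
        ext x
        rw [lintegral_haarAddCircle_eq]
        congr 1
        refine setLIntegral_congr_fun measurableSet_Ioc fun t ht => ?_
        simp only [equivIoc_coe_of_mem (show t ∈ Ioc 0 (0 + T) by rwa [zero_add])]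
    _ = ∫⁻ x, 2 * (J x * ENNReal.ofReal (weight x)) := by
        congr 1
        ext x
        have hms : Measurable fun t => ∑' j : ℕ, ‖F (t + j * T) x‖ₑ :=
          Measurable.tsum fun j => (hFs x).comp (by fun_prop : Measurable fun t : ℝ => t + j * T)
        rw [lintegral_mul_const _ (by fun_prop), lintegral_add_left (by fun_prop),
          lintegral_const_mul _ hms, setLIntegral_tsum_shift hT.out (hFs x), setLIntegral_const,
          Real.volume_Ioc, sub_zero]
        change _ * ((ENNReal.ofReal T * J x + J x * ENNReal.ofReal T) * _) = _
        rw [mul_comm (J x) (ENNReal.ofReal T), ← two_mul]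
        have : (ENNReal.ofReal T)⁻¹ * ENNReal.ofReal T = 1 :=
          ENNReal.inv_mul_cancel (by simpa using hT.out) ENNReal.ofReal_ne_top
        calc _ = ((ENNReal.ofReal T)⁻¹ * ENNReal.ofReal T) *
              (2 * (J x * ENNReal.ofReal (weight x))) := by ring
          _ = _ := by rw [this, one_mul]
    _ = 2 * ∫⁻ x, J x * ENNReal.ofReal (weight x) := lintegral_const_mul _ (by fun_prop)
    _ < ⊤ := ENNReal.mul_lt_top (by simp) hmain

lemma IsHomSymbol.integrable_kernelFun_mul_weight (hP : IsHomSymbol m P) (hm : 2 ≤ m)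
    (hm3 : m ≤ 3) {lam : ℝ} (hlam : lam ≠ 0) :
    Integrable (fun p : G T => ‖kernelFun T lam P p‖ * weight p.2) (haarG T) := by
  refine ⟨(hP.aestronglyMeasurable_kernelFun hm hlam).norm.mul
    (measurable_weight.comp measurable_snd).aestronglyMeasurable, ?_⟩
  rw [hasFiniteIntegral_iff_enorm]
  refine lt_of_eq_of_lt ?_ (hP.lintegral_kernelFun_mul_weight_lt_top (T := T) hm hm3 lam)
  congr 1
  ext p
  rw [enorm_mul, enorm_norm, ← ofReal_norm (weight p.2), Real.norm_of_nonneg (weight_pos _).le]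

lemma IsHomSymbol.integrable_oseenKernel_mul_weight (hP : IsHomSymbol m P) (hm : 2 ≤ m)
    (hm3 : m ≤ 3) (lam : ℝ) :
    Integrable (fun p => ‖oseenKernel lam (divNormSq P) p.1 p.2‖ * weight p.2) halfMeasure := by
  have hF := measurable_oseenKernel lam (hP.isPolyGrowth_divNormSq hm)
  have hw := measurable_weight
  refine ⟨Measurable.aestronglyMeasurable (by fun_prop), ?_⟩
  rw [hasFiniteIntegral_iff_enorm]
  refine lt_of_eq_of_lt ?_ (hP.lintegral_oseenKernel_mul_weight_lt_top hm hm3 lam)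
  congr 1
  ext p
  rw [enorm_mul, enorm_norm, ← ofReal_norm (weight p.2), Real.norm_of_nonneg (weight_pos _).le]

lemma IsHomSymbol.integrable_oseenKernel_mul (hP : IsHomSymbol m P) (hm : 2 ≤ m)
    (hm3 : m ≤ 3) (lam : ℝ) {ψ : ℝ × E3 → ℂ} (hψ : AEStronglyMeasurable ψ halfMeasure) {C : ℝ}
    (hC : ∀ p, ‖ψ p‖ ≤ C * weight p.2) :
    Integrable (fun p => oseenKernel lam (divNormSq P) p.1 p.2 * ψ p) halfMeasure := by
  have hF := measurable_oseenKernel lam (hP.isPolyGrowth_divNormSq hm)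
  refine ((hP.integrable_oseenKernel_mul_weight hm hm3 lam).const_mul C).mono'
    (hF.aestronglyMeasurable.mul hψ) (ae_of_all _ fun p => ?_)
  rw [norm_mul, mul_left_comm]
  gcongr
  exact hC p

/-- The `k`-th Fourier coefficient in time. -/
noncomputable def timeCoeff (φ : G T → ℂ) (k : ℤ) (x : E3) : ℂ :=
  ∫ t, fourier k t * φ (t, x) ∂haarAddCircle

lemma norm_timeCoeff_le {φ : G T → ℂ} {C : ℝ} (hC : ∀ p, ‖φ p‖ ≤ C * weight p.2) (k : ℤ) (x : E3) :
    ‖timeCoeff φ k x‖ ≤ C * weight x := by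
  have := norm_integral_le_of_norm_le_const (μ := (haarAddCircle : Measure (AddCircle T)))
    (f := fun t => fourier k t * φ (t, x)) (C := C * weight x)
    (ae_of_all _ fun t => by rw [norm_mul, norm_fourier_apply, one_mul]; exact hC (t, x))
  exact this.trans_eq (by simp)

lemma IsSchwartzBruhat.measurable_timeCoeff {φ : G T → ℂ} (hφ : IsSchwartzBruhat T φ) (k : ℤ) :
    Measurable (timeCoeff φ k) := by
  have hφc := hφ.continuous
  have : StronglyMeasurable fun p : AddCircle T × E3 => fourier k p.1 * φ p :=
    Continuous.stronglyMeasurable (by fun_prop)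
  exact (this.integral_prod_left' (μ := (haarAddCircle : Measure (AddCircle T)))).measurable

lemma IsSchwartzBruhat.integrable_timeCoeff {φ : G T → ℂ} (hφ : IsSchwartzBruhat T φ) (k : ℤ) :
    Integrable (timeCoeff φ k) := by
  obtain ⟨C, -, hC⟩ := hφ.exists_norm_le
  exact (integrable_weight.const_mul C).mono' (hφ.measurable_timeCoeff k).aestronglyMeasurable
    (ae_of_all _ (norm_timeCoeff_le hC k))

lemma IsSchwartzBruhat.invFourierG_eq_integral_timeCoeff {φ : G T → ℂ}
    (hφ : IsSchwartzBruhat T φ) (k : ℤ) (ξ : E3) :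
    invFourierG φ k ξ = ∫ x, planeWave ξ x * timeCoeff φ k x := by
  have h1 := hφ.integrable_character_mul k ξ
  rw [haarG] at h1
  rw [invFourierG_eq, haarG, integral_prod_symm _ h1]
  congr 1
  ext x
  rw [timeCoeff, ← integral_const_mul]
  congr 1
  ext t
  ring

lemma IsSchwartzBruhat.measurable_invFourierG {φ : G T → ℂ} (hφ : IsSchwartzBruhat T φ) (k : ℤ) :
    Measurable (invFourierG φ k) := by
  have hφm := hφ.measurable_timeCoeff k
  have h1 : Measurable fun p : E3 × E3 => planeWave p.1 p.2 := continuous_planeWave.measurable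
  have : StronglyMeasurable fun p : E3 × E3 => planeWave p.1 p.2 * timeCoeff φ k p.2 :=
    (h1.mul (hφm.comp measurable_snd)).stronglyMeasurable
  have e : invFourierG φ k = fun ξ => ∫ x, planeWave ξ x * timeCoeff φ k x :=
    funext fun ξ => hφ.invFourierG_eq_integral_timeCoeff k ξ
  rw [e]
  exact this.integral_prod_right'.measurable

/-- Parseval's relation in space at a fixed time `s > 0`, where the Gaussian makes Fubini
applicable. -/
lemma IsSchwartzBruhat.integral_oseenKernel_mul_timeCoeff {φ : G T → ℂ}
    (hφ : IsSchwartzBruhat T φ) (k : ℤ) (lam : ℝ) {Q : E3 → ℂ} (hQ : IsPolyGrowth Q) {s : ℝ}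
    (hs : 0 < s) : ∫ x, oseenKernel lam Q s x * timeCoeff φ k x =
      (((2 * Real.pi) ^ 3 : ℝ) : ℂ)⁻¹ *
        ∫ ξ, Complex.exp (s * oseenSymbol lam ξ) * Q ξ * invFourierG φ k ξ := by
  have h1 := integrable_exp_mul_oseenSymbol lam hQ hs
  have h2 := hφ.integrable_timeCoeff k
  have h3 := h2.mul_prod h1
  have h4 : Integrable (fun p : E3 × E3 => planeWave p.2 p.1 * (timeCoeff φ k p.1 *
      (Complex.exp (s * oseenSymbol lam p.2) * Q p.2))) (volume.prod volume) := by
    refine h3.norm.mono' (AEStronglyMeasurable.mul (Continuous.aestronglyMeasurable ?_) h3.1)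
      (ae_of_all _ fun p => ?_)
    · unfold planeWave; fun_prop
    · rw [norm_mul, norm_planeWave, one_mul]
  simp_rw [hφ.invFourierG_eq_integral_timeCoeff, ← integral_const_mul, oseenKernel, mul_assoc,
    ← integral_mul_const, integral_const_mul]
  congr 1
  rw [integral_integral_swap]
  · congr 1
    ext ξ
    rw [← integral_const_mul, ← integral_const_mul]
    congr 1
    ext x
    ring
  · refine h4.congr (ae_of_all _ fun p => ?_)
    simp only [Function.uncurry]
    ring

/-- The Fourier symbol of the purely periodic kernel with numerator `P`. -/
noncomputable def periodicSymbol (T lam : ℝ) (P : E3 → ℂ) (k : ℤ) (ξ : E3) : ℂ :=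
  ((1 - if k = 0 then 1 else 0 : ℝ) : ℂ) /
      (((‖ξ‖ ^ 2 : ℝ) : ℂ) +
        Complex.I * ((2 * Real.pi / T * (k : ℝ) - lam * ξ 0 : ℝ) : ℂ)) * divNormSq P ξ

/-- An integrable majorant with an admissible singularity at the origin. -/
noncomputable def singularWeight (ξ : E3) : ℝ :=
  (Metric.ball 0 1).indicator (fun y : E3 => ‖y‖ ^ (-(5 / 2) : ℝ)) ξ + weight ξ

lemma integrable_singularWeight : Integrable singularWeight :=
  ((integrable_indicator_iff measurableSet_ball).2 integrableOn_ball_norm_rpow).add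
    integrable_weight

lemma IsHomSymbol.exists_norm_div_mul_weight_le (hP : IsHomSymbol m P) (hm : 2 ≤ m)
    (hm3 : m ≤ 3) : ∃ C, 0 ≤ C ∧ ∀ ξ : E3, ξ ≠ 0 →
      ‖divNormSq P ξ‖ / ‖ξ‖ ^ 2 * weight ξ ≤ C * singularWeight ξ := by
  obtain ⟨C, hC, h⟩ := hP.norm_divNormSq_le hm
  refine ⟨C, hC, fun ξ hξ => ?_⟩
  have hpos : 0 < ‖ξ‖ := norm_pos_iff.2 hξ
  have hw := weight_pos ξ
  have h1 : ‖divNormSq P ξ‖ / ‖ξ‖ ^ 2 ≤ C * (‖ξ‖ ^ (m - 2) / ‖ξ‖ ^ 2) := by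
    rw [← mul_div_assoc]
    gcongr
    exact h ξ
  calc _ ≤ C * (‖ξ‖ ^ (m - 2) / ‖ξ‖ ^ 2) * weight ξ := by gcongr
    _ = C * ((‖ξ‖ ^ (m - 2) / ‖ξ‖ ^ 2) * weight ξ) := mul_assoc _ _ _
    _ ≤ _ := by
      gcongr
      unfold singularWeight
      by_cases hb : ξ ∈ Metric.ball (0 : E3) 1
      · have hb' : ‖ξ‖ < 1 := by simpa using hb
        rw [indicator_of_mem hb]
        refine le_add_of_le_of_nonneg ?_ hw.le
        calc _ ≤ (‖ξ‖ ^ (m - 2) / ‖ξ‖ ^ 2) * 1 := by gcongr; exact weight_le_one ξ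
          _ ≤ 1 / ‖ξ‖ ^ 2 := by
            rw [mul_one]
            gcongr
            exact pow_le_one₀ hpos.le hb'.le
          _ = ‖ξ‖ ^ (-2 : ℝ) := by
            rw [Real.rpow_neg hpos.le, one_div]; norm_cast
          -- The actual singularity is at most `|ξ|^(-2)`; it is weakened to `-5/2` so that the
          -- integrability already proved can be reused.
          _ ≤ _ := Real.rpow_le_rpow_of_exponent_ge hpos hb'.le (by norm_num)
      · have hb' : 1 ≤ ‖ξ‖ := by simpa using hb
        rw [indicator_of_notMem hb, zero_add]
        refine mul_le_of_le_one_left hw.le ?_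
        rw [div_le_one (by positivity)]
        exact pow_le_pow_right₀ hb' (by omega)

lemma le_norm_denominator (a b : ℝ) : |a| ≤ ‖(a : ℂ) + Complex.I * (b : ℂ)‖ := by
  have := Complex.abs_re_le_norm ((a : ℂ) + Complex.I * (b : ℂ))
  simpa using this

lemma norm_periodicSymbol_le (T lam : ℝ) (P : E3 → ℂ) (k : ℤ) {ξ : E3} (hξ : ξ ≠ 0) :
    ‖periodicSymbol T lam P k ξ‖ ≤ ‖divNormSq P ξ‖ / ‖ξ‖ ^ 2 := by
  have hpos : 0 < ‖ξ‖ := norm_pos_iff.2 hξ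
  have h := le_norm_denominator (‖ξ‖ ^ 2) (2 * Real.pi / T * (k : ℝ) - lam * ξ 0)
  rw [abs_of_pos (by positivity)] at h
  rw [periodicSymbol, norm_mul, norm_div, div_mul_eq_mul_div]
  refine div_le_div₀ (norm_nonneg _) ?_ (by positivity) h
  refine mul_le_of_le_one_left (norm_nonneg _) ?_
  rw [Complex.norm_real]
  split_ifs <;> simp

lemma IsHomSymbol.exists_norm_periodicSymbol_mul_le (hP : IsHomSymbol m P) (hm : 2 ≤ m)
    (hm3 : m ≤ 3) {φ : G T → ℂ} (hφ : IsSchwartzBruhat T φ) : ∃ C, 0 ≤ C ∧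
      ∀ (k : ℤ) (ξ : E3), k ≠ 0 → ξ ≠ 0 →
        ‖divNormSq P ξ‖ / ‖ξ‖ ^ 2 * ‖invFourierG φ k ξ‖ ≤
          C * (1 / (k : ℝ) ^ 2) * singularWeight ξ := by
  obtain ⟨C, hC, h⟩ := hP.exists_norm_div_mul_weight_le hm hm3
  obtain ⟨D, hD, h'⟩ := hφ.exists_norm_invFourierG_le
  refine ⟨C * D, by positivity, fun k ξ hk hξ => ?_⟩
  calc _ ≤ ‖divNormSq P ξ‖ / ‖ξ‖ ^ 2 * (D * (1 / (k : ℝ) ^ 2) * weight ξ) := by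
        gcongr; exact h' k ξ hk
    _ = D * (1 / (k : ℝ) ^ 2) * (‖divNormSq P ξ‖ / ‖ξ‖ ^ 2 * weight ξ) := by ring
    _ ≤ D * (1 / (k : ℝ) ^ 2) * (C * singularWeight ξ) := by gcongr ?_ * ?_; exact h ξ hξ
    _ = _ := by ring

lemma ae_ne_zero : ∀ᵐ ξ : E3, ξ ≠ 0 := by simp [ae_iff, measure_singleton]

/-- After Parseval in space, the time integral of `exp(zs)` with `Re z = -|ξ|² < 0` is `-1/z`, which
is the reciprocal of the denominator of the symbol. This is where the Cauchy kernel and the Fourier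
multiplier meet. -/
lemma IsHomSymbol.integral_halfMeasure_eq (hP : IsHomSymbol m P) (hm : 2 ≤ m) (hm3 : m ≤ 3)
    (lam : ℝ) {φ : G T → ℂ} (hφ : IsSchwartzBruhat T φ) {k : ℤ} (hk : k ≠ 0) :
    ∫ p, oseenKernel lam (divNormSq P) p.1 p.2 *
        (fourier k ((-p.1 : ℝ) : AddCircle T) * timeCoeff φ k p.2) ∂halfMeasure =
      (((2 * Real.pi) ^ 3 : ℝ) : ℂ)⁻¹ *
        ∫ ξ, periodicSymbol T lam P k ξ * invFourierG φ k ξ := by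
  obtain ⟨C, hC, hφC⟩ := hφ.exists_norm_le
  have hQ := hP.isPolyGrowth_divNormSq hm
  have hfm : Measurable fun s : ℝ => fourier k ((-s : ℝ) : AddCircle T) :=
    ((fourier k).continuous.comp ((AddCircle.continuous_mk' T).comp continuous_neg)).measurable
  have htm := hφ.measurable_timeCoeff k
  have hint := hP.integrable_oseenKernel_mul hm hm3 lam
    (ψ := fun p => fourier k ((-p.1 : ℝ) : AddCircle T) * timeCoeff φ k p.2)
    (((hfm.comp measurable_fst).mul (htm.comp measurable_snd)).aestronglyMeasurable) (C := C)
    (fun p => by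
      rw [norm_mul, norm_fourier_apply, one_mul]; exact norm_timeCoeff_le hφC k p.2)
  rw [integral_prod _ hint]
  have e1 : ∀ s ∈ Ioi (0 : ℝ), ∫ x, oseenKernel lam (divNormSq P) s x *
      (fourier k ((-s : ℝ) : AddCircle T) * timeCoeff φ k x) =
      (((2 * Real.pi) ^ 3 : ℝ) : ℂ)⁻¹ * ∫ ξ, Complex.exp ((oseenSymbol lam ξ -
        2 * Real.pi * Complex.I * k / T) * s) * (divNormSq P ξ * invFourierG φ k ξ) := by
    intro s (hs : 0 < s)
    have := hφ.integral_oseenKernel_mul_timeCoeff k lam hQ hs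
    simp_rw [mul_left_comm _ (fourier k ((-s : ℝ) : AddCircle T))]
    rw [integral_const_mul, this, mul_left_comm, ← integral_const_mul]
    congr 2
    ext ξ
    rw [fourier_coe_apply, sub_mul, sub_eq_add_neg, Complex.exp_add, mul_comm (oseenSymbol lam ξ)]
    push_cast
    ring_nf
  rw [setIntegral_congr_fun measurableSet_Ioi e1, integral_const_mul]
  congr 1
  have hre : ∀ ξ : E3, (oseenSymbol lam ξ - 2 * Real.pi * Complex.I * k / T).re = - ‖ξ‖ ^ 2 := by
    intro ξ
    have e : (2 * Real.pi * Complex.I * k / T : ℂ) =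
        ((2 * Real.pi * k / T : ℝ) : ℂ) * Complex.I := by push_cast; ring
    rw [e, oseenSymbol, Complex.sub_re, Complex.re_ofReal_mul]
    simp [-Complex.ofReal_pow]
  have hneg : ∀ ξ : E3, ξ ≠ 0 →
      (oseenSymbol lam ξ - 2 * Real.pi * Complex.I * k / T).re < 0 := by
    intro ξ hξ
    rw [hre, Left.neg_neg_iff]
    exact pow_pos (norm_pos_iff.2 hξ) 2
  have hqm := (continuous_oseenSymbol lam).measurable
  have him := hφ.measurable_invFourierG k
  have hQm := hQ.measurable
  obtain ⟨D, hD, hbound⟩ := hP.exists_norm_periodicSymbol_mul_le hm hm3 hφ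
  rw [integral_integral_swap]
  · refine integral_congr_ae ?_
    filter_upwards [ae_ne_zero] with ξ hξ
    have hne : oseenSymbol lam ξ - 2 * Real.pi * Complex.I * k / T ≠ 0 := by
      intro h
      have := hneg ξ hξ
      rw [h] at this
      simp at this
    rw [integral_mul_const, integral_exp_mul_complex_Ioi (hneg ξ hξ), periodicSymbol, if_neg hk]
    have e : ((‖ξ‖ ^ 2 : ℝ) : ℂ) + Complex.I * ((2 * Real.pi / T * (k : ℝ) - lam * ξ 0 : ℝ) : ℂ) =
        -(oseenSymbol lam ξ - 2 * Real.pi * Complex.I * k / T) := by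
      rw [oseenSymbol]; push_cast; ring
    rw [e]
    generalize oseenSymbol lam ξ - 2 * Real.pi * Complex.I * k / T = z at hne
    simp only [Complex.ofReal_zero, mul_zero, Complex.exp_zero, sub_zero, Complex.ofReal_one]
    field_simp
  · rw [integrable_prod_iff']
    · constructor
      · filter_upwards [ae_ne_zero] with ξ hξ
        simp only [Function.uncurry]
        exact Integrable.mul_const (integrableOn_exp_mul_complex_Ioi (hneg ξ hξ) 0) _
      · refine Integrable.mono' (integrable_singularWeight.const_mul (D * (1 / (k : ℝ) ^ 2))) ?_ ?_
        · have : StronglyMeasurable fun p : ℝ × E3 => ‖Complex.exp ((oseenSymbol lam p.2 -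
              2 * Real.pi * Complex.I * k / T) * p.1) *
                (divNormSq P p.2 * invFourierG φ k p.2)‖ :=
            Measurable.stronglyMeasurable (by fun_prop)
          exact (this.integral_prod_left' (μ := volume.restrict (Ioi 0))).aestronglyMeasurable
        · filter_upwards [ae_ne_zero] with ξ hξ
          have hpos : 0 < ‖ξ‖ := norm_pos_iff.2 hξ
          refine le_of_eq_of_le ?_ (hbound k ξ hk hξ)
          have e2 : ∀ s : ℝ, ‖Complex.exp ((oseenSymbol lam ξ - 2 * Real.pi * Complex.I * k / T) *
              s)‖ = Real.exp (-‖ξ‖ ^ 2 * s) := by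
            intro s
            rw [Complex.norm_exp, Complex.re_mul_ofReal, hre]
          simp only [Function.uncurry, norm_mul, e2]
          rw [integral_mul_const, integral_exp_mul_Ioi
            (by simpa only [Left.neg_neg_iff] using pow_pos hpos 2)]
          rw [Real.norm_of_nonneg (by
            have : 0 ≤ -Real.exp (-‖ξ‖ ^ 2 * 0) / -‖ξ‖ ^ 2 := by
              rw [neg_div_neg_eq]; positivity
            positivity)]
          rw [mul_zero, Real.exp_zero, neg_div_neg_eq]
          ring
    · refine Measurable.aestronglyMeasurable ?_
      simp only [Function.uncurry_def]
      fun_prop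

end Representation

/-! ### Pairing of the periodic kernel with test functions -/

section Representation

variable {m : ℕ} {P : E3 → ℂ}

lemma fourier_apply_add {T : ℝ} (k : ℤ) (s t : AddCircle T) :
    fourier k (s + t) = fourier k s * fourier k t := by
  rw [fourier_apply, fourier_apply, fourier_apply, smul_add, toCircle_add, Circle.coe_mul]

/-- The time correlation of the half-space kernel with a Schwartz-Bruhat function. -/
noncomputable def correlation (lam : ℝ) (P : E3 → ℂ) {T : ℝ} (φ : G T → ℂ) (τ : AddCircle T) : ℂ :=
  ∫ p, oseenKernel lam (divNormSq P) p.1 p.2 * φ ((p.1 : AddCircle T) + τ, p.2) ∂halfMeasure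

/-- Continuity is what allows the Fourier series of the correlation to be evaluated at a single
point. -/
lemma IsHomSymbol.continuous_correlation (hP : IsHomSymbol m P) (hm : 2 ≤ m) (hm3 : m ≤ 3)
    (lam : ℝ) {T : ℝ} {φ : G T → ℂ} (hφ : IsSchwartzBruhat T φ) :
    Continuous (correlation (T := T) lam P φ) := by
  obtain ⟨C, hC0, hC⟩ := hφ.exists_norm_le
  have hF := measurable_oseenKernel lam (hP.isPolyGrowth_divNormSq hm)
  have hφc := hφ.continuous
  have hmk := AddCircle.continuous_mk' T
  refine continuous_of_dominated
    (bound := fun p => C * (‖oseenKernel lam (divNormSq P) p.1 p.2‖ * weight p.2))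
    (fun τ => ?_) (fun τ => ae_of_all _ fun p => ?_)
    ((hP.integrable_oseenKernel_mul_weight hm hm3 lam).const_mul C) (ae_of_all _ fun p => ?_)
  · exact hF.aestronglyMeasurable.mul (Continuous.aestronglyMeasurable (hφc.comp
      (((hmk.comp continuous_fst).add continuous_const).prodMk continuous_snd)))
  · rw [norm_mul, mul_left_comm]
    gcongr
    exact hC _
  · exact continuous_const.mul (hφc.comp (by fun_prop))

variable {T : ℝ} [hT : Fact (0 < T)]

lemma HasDecay.mul_bounded {g ψ : ℝ → ℂ} (hg : HasDecay g) (hψ : Continuous ψ) {B : ℝ}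
    (hB : ∀ s, ‖ψ s‖ ≤ B) : HasDecay fun s => g s * ψ s := by
  obtain ⟨C, hC, h⟩ := hg.bound
  have hB0 : 0 ≤ B := (norm_nonneg _).trans (hB 0)
  refine ⟨hg.continuousOn.mul hψ.continuousOn, C * B, by positivity, fun s hs => ?_⟩
  rw [norm_mul]
  calc ‖g s‖ * ‖ψ s‖ ≤ (C * (1 + s) ^ (-(3 / 2) : ℝ)) * B := by
        gcongr
        · exact h s hs
        · exact hB s
    _ = _ := by ring

lemma IsHomSymbol.integrable_kernelFun_mul (hP : IsHomSymbol m P) (hm : 2 ≤ m)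
    (hm3 : m ≤ 3) {lam : ℝ} (hlam : lam ≠ 0) {φ : G T → ℂ} (hφ : IsSchwartzBruhat T φ) :
    Integrable (fun p => kernelFun T lam P p * φ p) (haarG T) := by
  obtain ⟨C, -, hC⟩ := hφ.exists_norm_le
  refine ((hP.integrable_kernelFun_mul_weight hm hm3 hlam).const_mul C).mono'
    ((hP.aestronglyMeasurable_kernelFun hm hlam).mul hφ.continuous.aestronglyMeasurable)
    (ae_of_all _ fun p => ?_)
  rw [norm_mul, mul_left_comm]
  gcongr
  exact hC p

lemma timeCoeff_zero_eq (φ : G T → ℂ) (x : E3) :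
    timeCoeff φ 0 x = (T : ℂ)⁻¹ * ∫ t in Ioc 0 T, φ ((t : AddCircle T), x) := by
  simp [timeCoeff, integral_haarAddCircle_eq]

/-- Unfolding of the periodization. -/
lemma IsHomSymbol.integral_kernelFun_mul_eq (hP : IsHomSymbol m P) (hm : 2 ≤ m)
    (hm3 : m ≤ 3) {lam : ℝ} (hlam : lam ≠ 0) {φ : G T → ℂ} (hφ : IsSchwartzBruhat T φ) :
    ∫ p, kernelFun T lam P p * φ p ∂(haarG T) =
      ∫ p, oseenKernel lam (divNormSq P) p.1 p.2 *
        (φ ((p.1 : AddCircle T), p.2) - timeCoeff φ 0 p.2) ∂halfMeasure := by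
  have hT0 := hT.out
  have hTne : (T : ℂ) ≠ 0 := by exact_mod_cast hT0.ne'
  obtain ⟨C, hC0, hC⟩ := hφ.exists_norm_le
  have hint1 := hP.integrable_kernelFun_mul hm hm3 hlam hφ
  have hφl : Continuous fun p : ℝ × E3 => φ ((p.1 : AddCircle T), p.2) :=
    hφ.smooth.continuous
  have hint2 := hP.integrable_oseenKernel_mul hm hm3 lam
    (ψ := fun p => φ ((p.1 : AddCircle T), p.2) - timeCoeff φ 0 p.2) (C := C + C)
    (hφl.aestronglyMeasurable.sub
      ((hφ.measurable_timeCoeff 0).comp measurable_snd).aestronglyMeasurable)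
    (fun p => by
      rw [add_mul]
      exact (norm_sub_le _ _).trans (add_le_add (hC _) (norm_timeCoeff_le hC 0 p.2)))
  rw [haarG] at hint1 ⊢
  rw [integral_prod_symm _ hint1, integral_prod_symm _ hint2]
  refine integral_congr_ae ?_
  filter_upwards [ae_ne_zero] with x hx
  have hdec := hP.hasDecay_oseenKernel hm hlam hx
  have hφx : Continuous fun t : ℝ => φ ((t : AddCircle T), x) := 
    hφl.comp (by fun_prop : Continuous fun t : ℝ => (t, x))
  have hg := hdec.mul_bounded hφx (B := C)
    (fun s => (hC _).trans (mul_le_of_le_one_right hC0 (weight_le_one _)))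
  set F : ℝ → ℂ := fun s => oseenKernel lam (divNormSq P) s x
  have e1 : ∫ s in Ioi 0, F s * (φ ((s : AddCircle T), x) - timeCoeff φ 0 x) =
      (∫ s in Ioi 0, F s * φ ((s : AddCircle T), x)) - (∫ s in Ioi 0, F s) * timeCoeff φ 0 x := by
    simp_rw [mul_sub]
    rw [integral_sub hg.integrableOn (hdec.integrableOn.mul_const _), integral_mul_const]
  -- Periodicity moves the test function inside the sum with shifted argument, so that the sum
  -- unfolds. The factor `T` will cancel the normalization of the Haar measure.
  have e2 : ∀ t ∈ Ioc 0 T, kernelFun T lam P ((t : AddCircle T), x) * φ ((t : AddCircle T), x) =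
      T * (∑' j : ℕ, F (t + j * T) * φ (((t + j * T : ℝ) : AddCircle T), x)) -
        (∫ s in Ioi 0, F s) * φ ((t : AddCircle T), x) := by
    intro t ht
    rw [kernelFun_coe lam P ht, periodicPart, sub_mul]
    have : ∀ j : ℕ, ((t + j * T : ℝ) : AddCircle T) = t := fun j => by
      rw [AddCircle.coe_add, ← nsmul_eq_mul, AddCircle.coe_nsmul, AddCircle.coe_period]
      simp
    simp_rw [this]
    rw [tsum_mul_right, mul_assoc]
  change _ = ∫ s in Ioi 0, F s * (φ ((s : AddCircle T), x) - timeCoeff φ 0 x)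
  rw [e1, integral_haarAddCircle_eq, setIntegral_congr_fun measurableSet_Ioc e2,
    integral_sub ((hg.integrableOn_tsum_shift hT0 le_rfl).const_mul _)
      ((hφx.integrableOn_Ioc).const_mul _),
    integral_const_mul, integral_const_mul, hg.setIntegral_tsum_shift hT0, timeCoeff_zero_eq,
    Complex.real_smul]
  push_cast
  field_simp
  rfl

/-- After Fubini, the shift `τ ↦ τ - s` separates the character in `s` from the time coefficient of
`φ`. -/
lemma IsHomSymbol.integral_fourier_mul_correlation (hP : IsHomSymbol m P) (hm : 2 ≤ m)
    (hm3 : m ≤ 3) (lam : ℝ) {φ : G T → ℂ} (hφ : IsSchwartzBruhat T φ) (k : ℤ) :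
    ∫ τ, fourier k τ * correlation lam P φ τ ∂haarAddCircle =
      ∫ p, oseenKernel lam (divNormSq P) p.1 p.2 *
        (fourier k ((-p.1 : ℝ) : AddCircle T) * timeCoeff φ k p.2) ∂halfMeasure := by
  obtain ⟨C, hC0, hC⟩ := hφ.exists_norm_le
  have hF := measurable_oseenKernel lam (hP.isPolyGrowth_divNormSq hm)
  have hφc := hφ.continuous
  have hmk := AddCircle.continuous_mk' T
  simp_rw [correlation, ← integral_const_mul]
  rw [integral_integral_swap]
  · congr 1
    ext p
    simp_rw [mul_left_comm (fourier k _)]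
    rw [integral_const_mul]
    congr 1
    rw [← integral_add_left_eq_self (μ := (haarAddCircle : Measure (AddCircle T))) _
      ((-p.1 : ℝ) : AddCircle T), timeCoeff, ← integral_const_mul]
    congr 1
    ext τ
    rw [fourier_apply_add, AddCircle.coe_neg, add_neg_cancel_left, mul_assoc]
  · refine Integrable.mono' (((hP.integrable_oseenKernel_mul_weight hm hm3 lam).const_mul C).comp_snd
      (haarAddCircle : Measure (AddCircle T))) ?_ (ae_of_all _ fun q => ?_)
    · have h1 : AEStronglyMeasurable (fun q : AddCircle T × (ℝ × E3) =>
          fourier k q.1 * φ ((q.2.1 : AddCircle T) + q.1, q.2.2))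
          ((haarAddCircle : Measure (AddCircle T)).prod halfMeasure) :=
        Continuous.aestronglyMeasurable (((fourier k).continuous.comp continuous_fst).mul
          (hφc.comp (((hmk.comp (by fun_prop : Continuous fun q : AddCircle T × (ℝ × E3) => q.2.1)).add
            continuous_fst).prodMk (by fun_prop))))
      have h2 : AEStronglyMeasurable (fun q : AddCircle T × (ℝ × E3) =>
          oseenKernel lam (divNormSq P) q.2.1 q.2.2)
          ((haarAddCircle : Measure (AddCircle T)).prod halfMeasure) :=
        (hF.comp measurable_snd).aestronglyMeasurable
      refine (h2.mul h1).congr (ae_of_all _ fun q => ?_)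
      simp only [Function.uncurry, Pi.mul_apply]
      ring
    · simp only [Function.uncurry]
      rw [norm_mul, norm_fourier_apply, one_mul, norm_mul, mul_left_comm]
      gcongr
      exact hC _

/-- Fourier representation of the pairing of the periodic kernel with a Schwartz-Bruhat function. -/
theorem IsHomSymbol.hasSum_integral_kernelFun (hP : IsHomSymbol m P) (hm : 2 ≤ m)
    (hm3 : m ≤ 3) {lam : ℝ} (hlam : lam ≠ 0) {φ : G T → ℂ} (hφ : IsSchwartzBruhat T φ) :
    HasSum (fun k : ℤ => (((2 * Real.pi) ^ 3 : ℝ) : ℂ)⁻¹ *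
      ∫ ξ, periodicSymbol T lam P k ξ * invFourierG φ k ξ)
      (∫ p, kernelFun T lam P p * φ p ∂(haarG T)) := by
  obtain ⟨C, hC0, hC⟩ := hφ.exists_norm_le
  set u : ℤ → ℂ := fun k => (((2 * Real.pi) ^ 3 : ℝ) : ℂ)⁻¹ *
      ∫ ξ, periodicSymbol T lam P k ξ * invFourierG φ k ξ with hu
  have hu0 : u 0 = 0 := by simp [hu, periodicSymbol]
  -- For `k ≠ 0` the terms `u k` are the Fourier coefficients of this function at `-k`. The series
  -- therefore sums to the value at `0` minus the zeroth coefficient, which is the unfolded pairing.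
  let c : C(AddCircle T, ℂ) := ⟨correlation lam P φ, hP.continuous_correlation hm hm3 lam hφ⟩
  have hcoef : ∀ k : ℤ, fourierCoeff c (-k) =
      ∫ τ, fourier k τ * correlation lam P φ τ ∂haarAddCircle := fun k => by
    simp only [fourierCoeff, neg_neg, smul_eq_mul]
    rfl
  have hck : ∀ k : ℤ, k ≠ 0 → fourierCoeff c (-k) = u k := fun k hk => by
    rw [hcoef, hP.integral_fourier_mul_correlation hm hm3 lam hφ,
      hP.integral_halfMeasure_eq hm hm3 lam hφ hk]
  obtain ⟨D, hD, hbound⟩ := hP.exists_norm_periodicSymbol_mul_le hm hm3 hφ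
  have husum : Summable u := by
    have hs : Summable fun k : ℤ => ‖(((2 * Real.pi) ^ 3 : ℝ) : ℂ)⁻¹‖ * D *
        (∫ ξ, singularWeight ξ) * (1 / (k : ℝ) ^ 2) :=
      (Real.summable_one_div_int_pow.2 one_lt_two).mul_left _
    refine Summable.of_norm_bounded hs fun k => ?_
    rcases eq_or_ne k 0 with rfl | hk
    · simp [hu0]
    · rw [hu, norm_mul]
      have h1 : ‖∫ ξ, periodicSymbol T lam P k ξ * invFourierG φ k ξ‖ ≤
          ∫ ξ, D * (1 / (k : ℝ) ^ 2) * singularWeight ξ := by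
        refine norm_integral_le_of_norm_le (integrable_singularWeight.const_mul _) ?_
        filter_upwards [ae_ne_zero] with ξ hξ
        rw [norm_mul]
        refine le_trans ?_ (hbound k ξ hk hξ)
        gcongr
        exact norm_periodicSymbol_le T lam P k hξ
      rw [integral_const_mul] at h1
      calc _ ≤ ‖(((2 * Real.pi) ^ 3 : ℝ) : ℂ)⁻¹‖ *
            (D * (1 / (k : ℝ) ^ 2) * ∫ ξ, singularWeight ξ) := by gcongr
        _ = _ := by ring
  have hcsum : Summable fun k => fourierCoeff c (-k) := by
    -- The two families differ at most at `k = 0`, which does not affect summability.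
    refine (summable_congr_cofinite ?_).2 husum
    filter_upwards [(Set.finite_singleton (0 : ℤ)).compl_mem_cofinite] with k hk
    exact hck k hk
  have hcsum' : Summable (fourierCoeff c) := by
    have := (Equiv.neg ℤ).summable_iff (f := fun k => fourierCoeff c (-k))
    refine (this.2 hcsum).congr fun k => ?_
    simp
  have h0 := has_pointwise_sum_fourier_series_of_summable hcsum' 0
  simp only [fourier_eval_zero, smul_eq_mul, mul_one] at h0
  have h1 := (Equiv.neg ℤ).hasSum_iff.2 h0
  have h2 := hasSum_ite_sub_hasSum h1 0
  have hval : c 0 - (fourierCoeff c ∘ Equiv.neg ℤ) 0 =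
      ∫ p, kernelFun T lam P p * φ p ∂(haarG T) := by
    have hφl : Continuous fun p : ℝ × E3 => φ ((p.1 : AddCircle T), p.2) :=
      hφ.smooth.continuous
    have e0 := hcoef 0
    rw [hP.integral_fourier_mul_correlation hm hm3 lam hφ] at e0
    simp only [fourier_zero, one_mul] at e0
    simp only [Function.comp, Equiv.neg_apply]
    rw [e0, hP.integral_kernelFun_mul_eq hm hm3 hlam hφ]
    change correlation lam P φ 0 - _ = _
    simp_rw [correlation, add_zero, mul_sub]
    rw [integral_sub (hP.integrable_oseenKernel_mul hm hm3 lam hφl.aestronglyMeasurable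
        (fun p => hC _))
      (hP.integrable_oseenKernel_mul hm hm3 lam (ψ := fun p => timeCoeff φ 0 p.2)
        ((hφ.measurable_timeCoeff 0).comp measurable_snd).aestronglyMeasurable
        (fun p => norm_timeCoeff_le hC 0 p.2))]
  rw [← hval]
  have hfun : u = fun n => if n = 0 then 0 else (fourierCoeff c ∘ Equiv.neg ℤ) n := by
    funext k
    rcases eq_or_ne k 0 with rfl | hk
    · simp [hu0]
    · simp [hk, hck k hk]
  rw [hfun]
  exact h2

end Representation

/-! ### The velocity fundamental solution and its gradient -/

/-- The numerator `|ξ|² δⱼₗ - ξⱼ ξₗ` of the Helmholtz projection. -/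
noncomputable def lerayNumerator (j l : Fin 3) (ξ : E3) : ℂ :=
  (if j = l then 1 else 0) * ((‖ξ‖ ^ 2 : ℝ) : ℂ) - ((ξ j : ℝ) : ℂ) * ((ξ l : ℝ) : ℂ)

lemma isHomSymbol_lerayNumerator (j l : Fin 3) : IsHomSymbol 2 (lerayNumerator j l) :=
  (isHomSymbol_normSq.const_mul _).sub ((isHomSymbol_coord j).mul (isHomSymbol_coord l))

/-- The numerator of the symbol of the gradient. -/
noncomputable def gradNumerator (i j l : Fin 3) (ξ : E3) : ℂ :=
  lerayNumerator j l ξ * (Complex.I * ((ξ i : ℝ) : ℂ))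

lemma isHomSymbol_gradNumerator (i j l : Fin 3) : IsHomSymbol 3 (gradNumerator i j l) :=
  (isHomSymbol_lerayNumerator j l).mul ((isHomSymbol_coord i).const_mul _)

lemma symbolPerp_eq (T lam : ℝ) (j l : Fin 3) (k : ℤ) {ξ : E3} (hξ : ξ ≠ 0) :
    symbolPerp T lam j l k ξ = periodicSymbol T lam (lerayNumerator j l) k ξ := by
  have hpos : (‖ξ‖ : ℂ) ≠ 0 := by exact_mod_cast (norm_pos_iff.2 hξ).ne'
  rw [symbolPerp, periodicSymbol]
  congr 1
  rw [divNormSq, lerayNumerator]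
  push_cast
  field_simp
  split_ifs <;> simp

variable {T : ℝ} [hT : Fact (0 < T)]

theorem isGammaPerp_kernelFun {lam : ℝ} (hlam : lam ≠ 0) :
    IsGammaPerp T lam (fun p j l => kernelFun T lam (lerayNumerator j l) p) := by
  intro j l
  have hP := isHomSymbol_lerayNumerator j l
  refine ⟨fun φ hφ => hP.integrable_kernelFun_mul le_rfl (by norm_num) hlam hφ, fun φ hφ => ?_⟩
  rw [← (hP.hasSum_integral_kernelFun le_rfl (by norm_num) hlam hφ).tsum_eq, gammaPerp,
    invFourierDistribution]
  congr 1
  ext k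
  congr 1
  refine integral_congr_ae ?_
  filter_upwards [ae_ne_zero] with ξ hξ
  rw [symbolPerp_eq T lam j l k hξ]

/-- On the Fourier side the derivative of the test function brings out `-iξᵢ`; the sign of the
distributional derivative cancels the minus, and `iξᵢ` joins the numerator, raising its degree to
three. -/
theorem isGradGammaPerp_kernelFun {lam : ℝ} (hlam : lam ≠ 0) :
    IsGradGammaPerp T lam (fun i p j l => kernelFun T lam (gradNumerator i j l) p) := by
  intro i j l
  have hP := isHomSymbol_gradNumerator i j l
  refine ⟨fun φ hφ => hP.integrable_kernelFun_mul (by norm_num) le_rfl hlam hφ, fun φ hφ => ?_⟩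
  rw [← (hP.hasSum_integral_kernelFun (by norm_num) le_rfl hlam hφ).tsum_eq, distribDeriv, gammaPerp,
    invFourierDistribution, ← tsum_neg]
  congr 1
  ext k
  rw [← mul_neg, ← integral_neg]
  congr 1
  refine integral_congr_ae ?_
  filter_upwards [ae_ne_zero] with ξ hξ
  rw [symbolPerp_eq T lam j l k hξ, hφ.invFourierG_spaceDeriv, periodicSymbol, periodicSymbol,
    divNormSq, divNormSq, gradNumerator]
  ring

/-! ### Uniqueness of the representing function -/

section Uniqueness

lemma exists_bounds_of_tsupport_subset {T : ℝ} {g : ℝ × E3 → ℝ} (hg : HasCompactSupport g)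
    (hsub : tsupport g ⊆ Ioo 0 T ×ˢ univ) :
    ∃ a b : ℝ, 0 < a ∧ b < T ∧ ∀ t x, t < a ∨ b < t → g (t, x) = 0 := by
  rcases (tsupport g).eq_empty_or_nonempty with he | hne
  · refine ⟨1, T - 1, one_pos, by linarith, fun t x _ => ?_⟩
    rw [tsupport_eq_empty_iff] at he
    simp [he]
  · have hK : IsCompact (Prod.fst '' tsupport g) := hg.isCompact.image continuous_fst
    have hKne := hne.image Prod.fst
    have hKsub : Prod.fst '' tsupport g ⊆ Ioo 0 T := by
      rintro _ ⟨p, hp, rfl⟩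
      exact (hsub hp).1
    refine ⟨sInf (Prod.fst '' tsupport g), sSup (Prod.fst '' tsupport g),
      (hKsub (hK.sInf_mem hKne)).1, (hKsub (hK.sSup_mem hKne)).2, fun t x h => ?_⟩
    refine image_eq_zero_of_notMem_tsupport fun hmem => ?_
    have hmem' : t ∈ Prod.fst '' tsupport g := ⟨(t, x), hmem, rfl⟩
    rcases h with h | h
    · exact absurd (csInf_le hK.bddBelow hmem') (not_le.2 h)
    · exact absurd (le_csSup hK.bddAbove hmem') (not_le.2 h)

variable {T : ℝ} [hT : Fact (0 < T)]

/-- The function on `G` which agrees with `g` on the fundamental domain `(0, T] × ℝ³`. -/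
noncomputable def liftDomain (T : ℝ) [Fact (0 < T)] (g : ℝ × E3 → ℝ) (p : G T) : ℂ :=
  (g ((AddCircle.equivIoc T 0 p.1 : ℝ), p.2) : ℂ)

lemma liftDomain_coe (g : ℝ × E3 → ℝ) (t : ℝ) (x : E3) :
    liftDomain T g ((t : AddCircle T), x) = (g (t - toIocDiv hT.out 0 t • T, x) : ℂ) := by
  rfl

lemma liftDomain_coe_of_mem (g : ℝ × E3 → ℝ) {t : ℝ} (n : ℤ)
    (ht : t ∈ Ioc (n * T) (n * T + T)) (x : E3) :
    liftDomain T g ((t : AddCircle T), x) = (g (t - n * T, x) : ℂ) := by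
  have : toIocDiv hT.out 0 t = n :=
    toIocDiv_eq_of_sub_zsmul_mem_Ioc hT.out (by
      simp only [zsmul_eq_mul, mem_Ioc] at ht ⊢; constructor <;> linarith [ht.1, ht.2])
  rw [liftDomain_coe, this, zsmul_eq_mul]

/-- Locally the periodic extension is a single translate of `g`, even across a multiple of `T`,
because `g` vanishes for times near both ends of the period. -/
lemma isSchwartzBruhat_liftDomain {g : ℝ × E3 → ℝ} (hs : ContDiff ℝ ∞ g)
    (hg : HasCompactSupport g) (hsub : tsupport g ⊆ Ioo 0 T ×ˢ univ) :
    IsSchwartzBruhat T (liftDomain T g) := by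
  have hT0 := hT.out
  obtain ⟨a, b, ha, hb, hab⟩ := exists_bounds_of_tsupport_subset hg hsub
  set gc : ℝ × E3 → ℂ := fun p => (g p : ℂ) with hgc
  have hgcs : ContDiff ℝ ∞ gc := Complex.ofRealCLM.contDiff.comp hs
  have hgcc : HasCompactSupport gc := hg.comp_left Complex.ofReal_zero
  have hloc : ∀ p : ℝ × E3, (fun p : ℝ × E3 => liftDomain T g ((p.1 : AddCircle T), p.2)) =ᶠ[𝓝 p]
      fun q => gc (q + (-(toIocDiv hT.out 0 p.1 * T), 0)) := by
    rintro ⟨t, x⟩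
    set n := toIocDiv hT.out 0 t
    have hmem : t - n • T ∈ Ioc 0 (0 + T) := sub_toIocDiv_zsmul_mem_Ioc hT.out 0 t
    rw [zsmul_eq_mul, zero_add] at hmem
    -- The window is the `n`-th period enlarged on both sides into the parts of the adjacent periods
    -- where the extension vanishes.
    have hopen : IsOpen ((Ioo ((n - 1) * T + max b 0) ((n + 1) * T + min a T) : Set ℝ) ×ˢ
        (univ : Set E3)) := isOpen_Ioo.prod isOpen_univ
    have hmem' : (t, x) ∈ ((Ioo ((n - 1) * T + max b 0) ((n + 1) * T + min a T) : Set ℝ) ×ˢ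
        (univ : Set E3)) := by
      have h1 : max b 0 < T := max_lt hb hT0
      have h2 : 0 < min a T := lt_min ha hT0
      refine ⟨⟨?_, ?_⟩, mem_univ _⟩ <;> dsimp only <;> linarith [hmem.1, hmem.2]
    filter_upwards [hopen.mem_nhds hmem'] with q hq
    obtain ⟨s, y⟩ := q
    obtain ⟨⟨h1, h2⟩, -⟩ := hq
    dsimp only at h1 h2
    have h3 := le_max_left b 0
    have h4 := le_max_right b 0
    have h5 := min_le_left a T
    have h6 := min_le_right a T
    have harg : ((s, y) : ℝ × E3) + (-(n * T), 0) = (s - n * T, y) := by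
      simp [sub_eq_add_neg]
    simp only [harg]
    rcases le_or_gt s (n * T) with hs1 | hs1
    · rw [liftDomain_coe_of_mem g (n - 1) (by
        push_cast; constructor <;> linarith) y, hgc]
      dsimp only
      rw [hab _ _ (Or.inl (by linarith : s - n * T < a)),
        hab _ _ (Or.inr (by push_cast; linarith : b < s - ((n - 1 : ℤ) : ℝ) * T))]
    rcases le_or_gt s (n * T + T) with hs2 | hs2
    · rw [liftDomain_coe_of_mem g n ⟨hs1, hs2⟩ y]
    · rw [liftDomain_coe_of_mem g (n + 1) (by
        push_cast; constructor <;> linarith) y, hgc]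
      dsimp only
      rw [hab _ _ (Or.inr (by linarith : b < s - n * T)),
        hab _ _ (Or.inl (by push_cast; linarith : s - ((n + 1 : ℤ) : ℝ) * T < a))]
  refine ⟨contDiff_iff_contDiffAt.2 fun p => ContDiffAt.congr_of_eventuallyEq
    (hgcs.comp (contDiff_id.add contDiff_const)).contDiffAt (hloc p), fun m n => ?_⟩
  have hcont : Continuous fun p : ℝ × E3 => (1 + ‖p.2‖) ^ m * ‖iteratedFDeriv ℝ n gc p‖ :=
    ((continuous_const.add continuous_snd.norm).pow m).mul
      (hgcs.continuous_iteratedFDeriv (by exact_mod_cast le_top)).norm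
  have hcs : HasCompactSupport fun p : ℝ × E3 => (1 + ‖p.2‖) ^ m * ‖iteratedFDeriv ℝ n gc p‖ :=
    ((hgcc.iteratedFDeriv n).norm).mul_left
  obtain ⟨C, hC⟩ := hcs.exists_bound_of_continuous hcont
  refine ⟨C, fun t x => ?_⟩
  rw [(Filter.EventuallyEq.iteratedFDeriv ℝ (hloc (t, x)) n).eq_of_nhds, iteratedFDeriv_comp_add_right]
  have := (le_abs_self _).trans (hC ((t, x) + (-(toIocDiv hT.out 0 t * T), 0)))
  simpa using this

lemma measurePreserving_coe_prod :
    MeasurePreserving (fun p : ℝ × E3 => (((p.1 : AddCircle T), p.2) : G T))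
      ((volume.restrict (Ioc 0 T)).prod volume)
      ((volume : Measure (AddCircle T)).prod (volume : Measure E3)) := by
  have h := AddCircle.measurePreserving_mk T 0
  rw [zero_add] at h
  exact h.prod (MeasurePreserving.id volume)

lemma volume_prod_eq_smul_haarG :
    ((volume : Measure (AddCircle T)).prod (volume : Measure E3)) =
      ENNReal.ofReal T • haarG T := by
  rw [haarG, AddCircle.volume_eq_smul_haarAddCircle, Measure.prod_smul_left]

lemma integrable_comp_coe_prod {f : G T → ℂ} (hf : Integrable f (haarG T)) :
    Integrable (fun p : ℝ × E3 => f ((p.1 : AddCircle T), p.2))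
      ((volume.restrict (Ioc 0 T)).prod volume) := by
  refine (measurePreserving_coe_prod (T := T)).integrable_comp_of_integrable ?_
  rw [volume_prod_eq_smul_haarG]
  exact hf.smul_measure ENNReal.ofReal_ne_top

lemma integral_comp_coe_prod {f : G T → ℂ} (hf : Integrable f (haarG T)) :
    ∫ p : ℝ × E3, f ((p.1 : AddCircle T), p.2) ∂((volume.restrict (Ioc 0 T)).prod volume) =
      T • ∫ p, f p ∂(haarG T) := by
  have hsm : AEStronglyMeasurable f (Measure.map
      (fun p : ℝ × E3 => (((p.1 : AddCircle T), p.2) : G T))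
      ((volume.restrict (Ioc 0 T)).prod volume)) := by
    rw [measurePreserving_coe_prod.map_eq, volume_prod_eq_smul_haarG]
    exact (hf.smul_measure ENNReal.ofReal_ne_top).aestronglyMeasurable
  rw [← integral_map measurePreserving_coe_prod.measurable.aemeasurable hsm,
    measurePreserving_coe_prod.map_eq, volume_prod_eq_smul_haarG, integral_smul_measure,
    ENNReal.toReal_ofReal hT.out.le]

/-- A function which is integrable against, and orthogonal to, all Schwartz-Bruhat functions
vanishes almost everywhere. -/
theorem ae_eq_zero_of_forall_integral_mul_eq_zero {h : G T → ℂ}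
    (hint : ∀ φ, IsSchwartzBruhat T φ → Integrable (fun p => h p * φ p) (haarG T))
    (hzero : ∀ φ, IsSchwartzBruhat T φ → ∫ p, h p * φ p ∂(haarG T) = 0) :
    h =ᵐ[haarG T] 0 := by
  set U : Set (ℝ × E3) := Ioo 0 T ×ˢ univ with hU
  have hUo : IsOpen U := isOpen_Ioo.prod isOpen_univ
  set H : ℝ × E3 → ℂ := fun p => h ((p.1 : AddCircle T), p.2) with hH
  set ν : Measure (ℝ × E3) := (volume.restrict (Ioc 0 T)).prod volume with hν
  have hνeq : ν = (volume : Measure (ℝ × E3)).restrict U := by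
    rw [hν, hU, ← restrict_Ioo_eq_restrict_Ioc, Measure.volume_eq_prod, ← Measure.prod_restrict,
      Measure.restrict_univ]
  have hmul : ∀ g : ℝ × E3 → ℝ, EqOn (fun p : ℝ × E3 => h ((p.1 : AddCircle T), p.2) *
      liftDomain T g ((p.1 : AddCircle T), p.2)) (fun p => g p • H p) U := by
    rintro g ⟨t, x⟩ hp
    have := liftDomain_coe_of_mem g (T := T) 0 (t := t) (by
      simpa using Ioo_subset_Ioc_self hp.1) x
    simp only [this, hH, Complex.real_smul, Int.cast_zero, zero_mul, sub_zero]
    ring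
  have hintU : ∀ g : ℝ × E3 → ℝ, ContDiff ℝ ∞ g → HasCompactSupport g → tsupport g ⊆ U →
      IntegrableOn (fun p => g p • H p) U volume := fun g hg1 hg2 hg3 => by
    have := integrable_comp_coe_prod (hint _ (isSchwartzBruhat_liftDomain hg1 hg2 hg3))
    rw [← hν, hνeq] at this
    exact (integrableOn_congr_fun (hmul g) hUo.measurableSet).1 this
  have hae : ∀ᵐ p : ℝ × E3, p ∈ U → H p = 0 := by
    refine hUo.ae_eq_zero_of_integral_contDiff_smul_eq_zero ?_ fun g hg1 hg2 hg3 => ?_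
    · intro p hp
      obtain ⟨r, hr, hrU⟩ := Metric.isOpen_iff.1 hUo p hp
      -- Local integrability of `H` is read off from a test function equal to one near `p`.
      let χ : ContDiffBump p := ⟨r / 4, r / 2, by positivity, by linarith⟩
      have hχ := hintU χ χ.contDiff χ.hasCompactSupport (by
        rw [χ.tsupport_eq]
        exact (Metric.closedBall_subset_ball (by change r / 2 < r; linarith)).trans hrU)
      refine ⟨Metric.ball p (r / 4), mem_nhdsWithin_of_mem_nhds (Metric.ball_mem_nhds _ (by positivity)), ?_⟩
      refine (integrableOn_congr_fun (fun q hq => ?_) measurableSet_ball).1 (hχ.mono_set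
        ((Metric.ball_subset_ball (by linarith)).trans hrU))
      have : χ q = 1 := χ.one_of_mem_closedBall (Metric.ball_subset_closedBall hq)
      simp [this]
    · have hSB := isSchwartzBruhat_liftDomain hg1 hg2 hg3
      have h1 := integral_comp_coe_prod (hint _ hSB)
      rw [hzero _ hSB, smul_zero, ← hν, hνeq, setIntegral_congr_fun hUo.measurableSet (hmul g)] at h1
      rw [← h1, setIntegral_eq_integral_of_forall_compl_eq_zero]
      intro q hq
      rw [image_eq_zero_of_notMem_tsupport fun hmem => hq (hg3 hmem), zero_smul]
  -- UNUSED
  have hae' : ∀ᵐ p ∂ν, H p = 0 := by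
    rw [hνeq]
    exact (ae_restrict_iff' hUo.measurableSet).2 hae
  set e : G T → ℝ × E3 := fun p => ((AddCircle.equivIoc T 0 p.1 : ℝ), p.2) with he
  have hem : Measurable e :=
    (measurable_equivIoc.comp measurable_fst).prodMk measurable_snd
  have hq := measurePreserving_coe_prod (T := T)
  have hqmp : Measure.QuasiMeasurePreserving e
      ((volume : Measure (AddCircle T)).prod (volume : Measure E3)) ν := by
    refine ⟨hem, ?_⟩
    rw [← hq.map_eq, Measure.map_map hem hq.measurable]
    refine (Measure.absolutelyContinuous_of_eq ?_)
    rw [Measure.map_congr (g := id), Measure.map_id]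
    rw [← hν, hνeq]
    filter_upwards [ae_restrict_mem hUo.measurableSet] with p hp
    have := AddCircle.equivIoc_coe_of_mem (p := T) (a := 0) (y := p.1)
      (by simpa using Ioo_subset_Ioc_self hp.1)
    simp [he, this]
  have hfin := hqmp.ae hae'
  rw [volume_prod_eq_smul_haarG, Measure.ae_ennreal_smul_measure_eq
    (by simpa using hT.out)] at hfin
  filter_upwards [hfin] with p hp
  have : (((e p).1 : ℝ) : AddCircle T) = p.1 := (AddCircle.equivIoc T 0).symm_apply_apply p.1
  simpa [hH, he, this] using hp

theorem IsGivenBy.ae_eq {u : (G T → ℂ) → ℂ} {f₁ f₂ : G T → ℂ} (h₁ : IsGivenBy u f₁)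
    (h₂ : IsGivenBy u f₂) : f₁ =ᵐ[haarG T] f₂ := by
  have : (fun p => f₁ p - f₂ p) =ᵐ[haarG T] 0 := by
    refine ae_eq_zero_of_forall_integral_mul_eq_zero (fun φ hφ => ?_) fun φ hφ => ?_
    · simp_rw [sub_mul]
      exact (h₁.integrable φ hφ).sub (h₂.integrable φ hφ)
    · simp_rw [sub_mul]
      rw [integral_sub (h₁.integrable φ hφ) (h₂.integrable φ hφ), ← h₁.eq_integral φ hφ,
        ← h₂.eq_integral φ hφ, sub_self]
  filter_upwards [this] with p hp
  exact sub_eq_zero.1 hp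

end Uniqueness

/-! ### Convolution of algebraically decaying kernels with power weights -/

section Convolution

variable {T : ℝ} [hT : Fact (0 < T)]

lemma lintegral_snd_haarG {w : E3 → ℝ≥0∞} (hw : Measurable w) :
    ∫⁻ q, w q.2 ∂(haarG T) = ∫⁻ y, w y :=
  (measurePreserving_snd (μ := (haarAddCircle : Measure (AddCircle T)))
    (ν := (volume : Measure E3))).lintegral_comp hw

lemma measurable_one_add_norm_rpow (s : ℝ) :
    Measurable fun y : E3 => ENNReal.ofReal ((1 + ‖y‖) ^ s) :=
  ENNReal.measurable_ofReal.comp ((measurable_const.add measurable_norm).pow_const s)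

lemma lintegral_one_add_norm_rpow_lt_top {s : ℝ} (hs : 3 < s) :
    ∫⁻ y : E3, ENNReal.ofReal ((1 + ‖y‖) ^ (-s)) < ⊤ :=
  finite_integral_one_add_norm (by simpa using hs)

/-- Convolution with a power weight of a kernel on `G` with algebraic decay. -/
lemma exists_lintegral_mul_rpow_le {K : G T → ℝ≥0∞}
    {A b d ε C₀ : ℝ} (hb : 0 ≤ b) (hbA : b ≤ A) (hbd : b ≤ d) (hAd : 3 < A + d - b) (hε : 0 < ε)
    (hC₀ : 0 ≤ C₀) (hdecay : ∀ q, ε / 2 ≤ ‖q.2‖ → K q ≤ ENNReal.ofReal (C₀ * ‖q.2‖ ^ (-d)))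
    (hfin : ∫⁻ q, K q * ENNReal.ofReal ((1 + ‖q.2‖) ^ (-(A - b))) ∂(haarG T) < ⊤) :
    ∃ C : ℝ, 0 ≤ C ∧ ∀ x : E3, ε ≤ ‖x‖ →
      ∫⁻ q, K q * ENNReal.ofReal ((1 + ‖x - q.2‖) ^ (-A)) ∂(haarG T) ≤
        ENNReal.ofReal (C * (1 + ‖x‖) ^ (-b)) := by
  set c₁ : ℝ := 2 ^ b * 3 ^ (A - b) with hc₁
  set c₂ : ℝ := C₀ * (ε / (1 + ε) / 2) ^ (-d) with hc₂
  set I₁ := ∫⁻ q, K q * ENNReal.ofReal ((1 + ‖q.2‖) ^ (-(A - b))) ∂(haarG T) with hI₁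
  set I₂ := ∫⁻ y : E3, ENNReal.ofReal ((1 + ‖y‖) ^ (-(A + d - b))) with hI₂
  have hI₂fin : I₂ < ⊤ := lintegral_one_add_norm_rpow_lt_top hAd
  have hc₁0 : 0 ≤ c₁ := by positivity
  have hc₂0 : 0 ≤ c₂ := by positivity
  refine ⟨c₁ * I₁.toReal + c₂ * I₂.toReal, by positivity, fun x hx => ?_⟩
  have hx1 : (0 : ℝ) < 1 + ‖x‖ := by positivity
  have key : ∀ q : G T, K q * ENNReal.ofReal ((1 + ‖x - q.2‖) ^ (-A)) ≤
      ENNReal.ofReal (c₁ * (1 + ‖x‖) ^ (-b)) *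
        (K q * ENNReal.ofReal ((1 + ‖q.2‖) ^ (-(A - b)))) +
      ENNReal.ofReal (c₂ * (1 + ‖x‖) ^ (-b)) *
        ENNReal.ofReal ((1 + ‖x - q.2‖) ^ (-(A + d - b))) := by
    rintro ⟨t, y⟩
    dsimp only
    have hxy1 : (0 : ℝ) < 1 + ‖x - y‖ := by positivity
    have hy1 : (0 : ℝ) < 1 + ‖y‖ := by positivity
    -- If `|x - y| ≥ |x|/2`, then `|y| ≤ 3|x - y|`, and the weight alone provides `(1+|x|)^(-b)`
    -- while keeping `(1+|y|)^(-(A-b))` for the kernel.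
    rcases le_or_gt (‖x‖ / 2) ‖x - y‖ with h | h
    · refine le_trans ?_ (le_add_of_nonneg_right zero_le)
      rw [mul_left_comm, ← ENNReal.ofReal_mul (by positivity)]
      gcongr
      have hy : ‖y‖ ≤ ‖x‖ + ‖x - y‖ := by
        have := norm_sub_le x (x - y)
        rwa [sub_sub_cancel] at this
      have e1 : (1 + ‖x - y‖) ^ (-b) ≤ ((1 + ‖x‖) / 2) ^ (-b) :=
        Real.rpow_le_rpow_of_nonpos (by positivity) (by linarith) (by linarith)
      have e2 : (1 + ‖x - y‖) ^ (-(A - b)) ≤ ((1 + ‖y‖) / 3) ^ (-(A - b)) :=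
        Real.rpow_le_rpow_of_nonpos (by positivity) (by linarith) (by linarith)
      calc (1 + ‖x - y‖) ^ (-A) = (1 + ‖x - y‖) ^ (-b) * (1 + ‖x - y‖) ^ (-(A - b)) := by
            rw [← Real.rpow_add hxy1]; congr 1; ring
        _ ≤ ((1 + ‖x‖) / 2) ^ (-b) * ((1 + ‖y‖) / 3) ^ (-(A - b)) := by gcongr
        _ = _ := by
            rw [Real.div_rpow hx1.le two_pos.le, Real.div_rpow hy1.le three_pos.le,
              Real.rpow_neg two_pos.le, Real.rpow_neg three_pos.le, hc₁]
            field_simp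
    -- Here `|y| > |x|/2 ≥ ε/2`, so the kernel decay applies. It is split into `b` powers of `1 +
    -- |x|` and `d - b` powers passed on to `1 + |x - y|`.
    · refine le_trans ?_ (le_add_of_nonneg_left zero_le)
      have hy : ‖x‖ / 2 ≤ ‖y‖ := by
        have := norm_sub_norm_le x y
        linarith
      have hcx : ε / (1 + ε) * (1 + ‖x‖) ≤ ‖x‖ := by
        rw [div_mul_eq_mul_div, div_le_iff₀ (by positivity)]
        nlinarith
      have hKy := hdecay (t, y) (by dsimp only; linarith)
      refine (mul_le_mul_left hKy _).trans ?_
      rw [← ENNReal.ofReal_mul (by positivity), ← ENNReal.ofReal_mul (by positivity)]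
      refine ENNReal.ofReal_le_ofReal ?_
      have hd : 0 ≤ d := hb.trans hbd
      have e1 : ‖y‖ ^ (-d) ≤ (ε / (1 + ε) / 2 * (1 + ‖x‖)) ^ (-d) :=
        Real.rpow_le_rpow_of_nonpos (by positivity) (by linarith) (by linarith)
      have e2 : (1 + ‖x‖) ^ (-(d - b)) ≤ (1 + ‖x - y‖) ^ (-(d - b)) :=
        Real.rpow_le_rpow_of_nonpos (by positivity) (by linarith) (by linarith)
      calc C₀ * ‖y‖ ^ (-d) * (1 + ‖x - y‖) ^ (-A)
          ≤ C₀ * (ε / (1 + ε) / 2 * (1 + ‖x‖)) ^ (-d) * (1 + ‖x - y‖) ^ (-A) := by gcongr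
        _ = c₂ * (1 + ‖x‖) ^ (-b) * ((1 + ‖x‖) ^ (-(d - b)) * (1 + ‖x - y‖) ^ (-A)) := by
            rw [Real.mul_rpow (by positivity) hx1.le, hc₂,
              show -d = -b + -(d - b) by ring, Real.rpow_add hx1]
            ring
        _ ≤ c₂ * (1 + ‖x‖) ^ (-b) * ((1 + ‖x - y‖) ^ (-(d - b)) * (1 + ‖x - y‖) ^ (-A)) := by
            gcongr
        _ = _ := by
            rw [← Real.rpow_add hxy1]
            congr 2
            ring
  have hmeas := measurable_one_add_norm_rpow
  have hmeas' : Measurable fun q : G T => ENNReal.ofReal ((1 + ‖x - q.2‖) ^ (-(A + d - b))) :=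
    (hmeas _).comp (measurable_const.sub measurable_snd)
  calc ∫⁻ q, K q * ENNReal.ofReal ((1 + ‖x - q.2‖) ^ (-A)) ∂(haarG T)
      ≤ ∫⁻ q, ENNReal.ofReal (c₁ * (1 + ‖x‖) ^ (-b)) *
        (K q * ENNReal.ofReal ((1 + ‖q.2‖) ^ (-(A - b)))) +
      ENNReal.ofReal (c₂ * (1 + ‖x‖) ^ (-b)) *
        ENNReal.ofReal ((1 + ‖x - q.2‖) ^ (-(A + d - b))) ∂(haarG T) := lintegral_mono key
    _ = ENNReal.ofReal (c₁ * (1 + ‖x‖) ^ (-b)) * I₁ +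
        ENNReal.ofReal (c₂ * (1 + ‖x‖) ^ (-b)) * I₂ := by
      rw [lintegral_add_right _ (hmeas'.const_mul _),
        lintegral_const_mul' _ _ ENNReal.ofReal_ne_top,
        lintegral_const_mul' _ _ ENNReal.ofReal_ne_top,
        lintegral_snd_haarG (w := fun y => ENNReal.ofReal ((1 + ‖x - y‖) ^ (-(A + d - b))))
          ((hmeas _).comp (measurable_const.sub measurable_id)),
        lintegral_sub_left_eq_self (fun y : E3 => ENNReal.ofReal ((1 + ‖y‖) ^ (-(A + d - b)))) x]
    _ = _ := by
      rw [← ENNReal.ofReal_toReal hfin.ne, ← ENNReal.ofReal_toReal hI₂fin.ne,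
        ← ENNReal.ofReal_mul (by positivity), ← ENNReal.ofReal_mul (by positivity),
        ← ENNReal.ofReal_add (by positivity) (by positivity),
        ENNReal.toReal_ofReal ENNReal.toReal_nonneg, ENNReal.toReal_ofReal ENNReal.toReal_nonneg]
      congr 1
      ring

variable {m : ℕ} {P : E3 → ℂ}

/-- On the unit ball the weight `(1+|x|)⁻⁴` is bounded below and gives integrability through the
singularity; outside it the pointwise decay of order `m + 1` takes over. -/
lemma IsHomSymbol.lintegral_kernelFun_mul_rpow_lt_top (hP : IsHomSymbol m P) (hm : 2 ≤ m)
    (hm3 : m ≤ 3) {lam : ℝ} (hlam : lam ≠ 0) {a : ℝ} (ha : 0 ≤ a) (had : 3 < a + (m + 1)) :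
    ∫⁻ q, ‖kernelFun T lam P q‖ₑ * ENNReal.ofReal ((1 + ‖q.2‖) ^ (-a)) ∂(haarG T) < ⊤ := by
  obtain ⟨C, hC0, hC⟩ := hP.exists_norm_kernelFun_le (T := T) hm hlam one_pos
  have key : ∀ q : G T, ‖kernelFun T lam P q‖ₑ * ENNReal.ofReal ((1 + ‖q.2‖) ^ (-a)) ≤
      ENNReal.ofReal (2 ^ (4 : ℝ)) * (‖kernelFun T lam P q‖ₑ * ENNReal.ofReal (weight q.2)) +
      ENNReal.ofReal (C * 2 ^ (m + 1 : ℝ)) *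
        ENNReal.ofReal ((1 + ‖q.2‖) ^ (-(a + (m + 1)))) := by
    intro q
    have hq1 : (0 : ℝ) < 1 + ‖q.2‖ := by positivity
    rcases lt_or_ge ‖q.2‖ 1 with h | h
    · refine le_trans ?_ (le_add_of_nonneg_right zero_le)
      rw [mul_left_comm, ← ENNReal.ofReal_mul (by positivity)]
      gcongr
      calc (1 + ‖q.2‖) ^ (-a) ≤ 1 :=
            Real.rpow_le_one_of_one_le_of_nonpos (by linarith [norm_nonneg q.2]) (by linarith)
        _ = 2 ^ (4 : ℝ) * 2 ^ (-4 : ℝ) := by rw [← Real.rpow_add two_pos]; simp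
        _ ≤ 2 ^ (4 : ℝ) * weight q.2 := by
            rw [weight]
            gcongr 2 ^ (4 : ℝ) * ?_
            exact Real.rpow_le_rpow_of_nonpos hq1 (by linarith) (by norm_num)
    · refine le_trans ?_ (le_add_of_nonneg_left zero_le)
      rw [← ofReal_norm, ← ENNReal.ofReal_mul (norm_nonneg _),
        ← ENNReal.ofReal_mul (by positivity)]
      refine ENNReal.ofReal_le_ofReal ?_
      have e1 : ‖q.2‖ ^ (-(m + 1 : ℝ)) ≤ ((1 + ‖q.2‖) / 2) ^ (-(m + 1 : ℝ)) :=
        Real.rpow_le_rpow_of_nonpos (by positivity) (by linarith)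
          (by have : (0 : ℝ) ≤ m := m.cast_nonneg
              linarith)
      calc ‖kernelFun T lam P q‖ * (1 + ‖q.2‖) ^ (-a)
          ≤ C * ((1 + ‖q.2‖) / 2) ^ (-(m + 1 : ℝ)) * (1 + ‖q.2‖) ^ (-a) := by
            gcongr
            exact (hC q h).trans (by gcongr)
        _ = _ := by
            rw [Real.div_rpow hq1.le two_pos.le, Real.rpow_neg two_pos.le (m + 1 : ℝ),
              show -(a + (m + 1 : ℝ)) = -(m + 1 : ℝ) + -a by ring, Real.rpow_add hq1]
            field_simp
  refine (lintegral_mono key).trans_lt ?_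
  have hmeas : Measurable fun q : G T => ENNReal.ofReal ((1 + ‖q.2‖) ^ (-(a + (m + 1)))) :=
    (measurable_one_add_norm_rpow _).comp measurable_snd
  rw [lintegral_add_right _ (hmeas.const_mul _), lintegral_const_mul' _ _ ENNReal.ofReal_ne_top,
    lintegral_const_mul' _ _ ENNReal.ofReal_ne_top,
    lintegral_snd_haarG (measurable_one_add_norm_rpow _)]
  exact ENNReal.add_lt_top.2
    ⟨ENNReal.mul_lt_top ENNReal.ofReal_lt_top (hP.lintegral_kernelFun_mul_weight_lt_top hm hm3 lam),
      ENNReal.mul_lt_top ENNReal.ofReal_lt_top (lintegral_one_add_norm_rpow_lt_top had)⟩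

lemma IsHomSymbol.exists_lintegral_kernelFun_mul_le (hP : IsHomSymbol m P) (hm : 2 ≤ m)
    (hm3 : m ≤ 3) {lam : ℝ} (hlam : lam ≠ 0) {A b ε : ℝ} (hb : 0 ≤ b) (hbA : b ≤ A)
    (hbm : b ≤ m + 1) (hAm : 3 < A + (m + 1) - b) (hε : 0 < ε) :
    ∃ C : ℝ, 0 ≤ C ∧ ∀ x : E3, ε ≤ ‖x‖ →
      ∫⁻ q, ‖kernelFun T lam P q‖ₑ * ENNReal.ofReal ((1 + ‖x - q.2‖) ^ (-A)) ∂(haarG T) ≤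
        ENNReal.ofReal (C * (1 + ‖x‖) ^ (-b)) := by
  obtain ⟨C, hC0, hC⟩ := hP.exists_norm_kernelFun_le (T := T) hm hlam (half_pos hε)
  refine exists_lintegral_mul_rpow_le hb hbA hbm hAm hε hC0 (fun q hq => ?_)
    (hP.lintegral_kernelFun_mul_rpow_lt_top hm hm3 hlam (by linarith) (by linarith))
  rw [← ofReal_norm]
  exact ENNReal.ofReal_le_ofReal (hC q hq)

/-- The weighted integral bound for a finite sum of kernels. -/
lemma exists_lintegral_sum_kernelFun_mul_le {ι : Type*} (s : Finset ι) {P : ι → E3 → ℂ}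
    (hP : ∀ i, IsHomSymbol m (P i)) (hm : 2 ≤ m)
    (hm3 : m ≤ 3) {lam : ℝ} (hlam : lam ≠ 0) {A b ε : ℝ} (hb : 0 ≤ b) (hbA : b ≤ A)
    (hbm : b ≤ m + 1) (hAm : 3 < A + (m + 1) - b) (hε : 0 < ε) :
    ∃ C : ℝ, 0 ≤ C ∧ ∀ x : E3, ε ≤ ‖x‖ →
      ∫⁻ q, (∑ i ∈ s, ‖kernelFun T lam (P i) q‖ₑ) *
        ENNReal.ofReal ((1 + ‖x - q.2‖) ^ (-A)) ∂(haarG T) ≤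
        ENNReal.ofReal (C * (1 + ‖x‖) ^ (-b)) := by
  choose C hC0 hC using fun i => (hP i).exists_lintegral_kernelFun_mul_le (T := T) hm hm3 hlam
    hb hbA hbm hAm hε
  refine ⟨∑ i ∈ s, C i, Finset.sum_nonneg fun i _ => hC0 i, fun x hx => ?_⟩
  simp_rw [Finset.sum_mul]
  rw [lintegral_finsetSum' _ fun i _ => ?_, ENNReal.ofReal_sum_of_nonneg fun i _ => ?_]
  · exact Finset.sum_le_sum fun i _ => hC i x hx
  · have := hC0 i
    positivity
  · exact ((hP i).aestronglyMeasurable_kernelFun hm hlam).enorm.mul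
      ((measurable_one_add_norm_rpow _).comp (measurable_const.sub measurable_snd)).aemeasurable

/-- Existence and size of a convolution whose kernel is controlled by weighted integrals. -/
lemma convExistsG_and_abs_convG_le {N g : G T → ℝ} (hN : AEStronglyMeasurable N (haarG T))
    (hg : AEStronglyMeasurable g (haarG T)) {M A B : ℝ} (hM : 0 ≤ M) (hB : 0 ≤ B)
    (hgM : ∀ᵐ p ∂(haarG T), |g p| ≤ M * (1 + ‖p.2‖) ^ (-A)) (p : G T)
    (hNB : ∫⁻ q, ‖N q‖ₑ * ENNReal.ofReal ((1 + ‖p.2 - q.2‖) ^ (-A)) ∂(haarG T) ≤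
      ENNReal.ofReal B) :
    ConvExistsG N g p ∧ |convG N g p| ≤ M * B := by
  have hqmp := quasiMeasurePreserving_sub_left (haarG T) p
  have hle : ∫⁻ q, ‖N q * g (p - q)‖ₑ ∂(haarG T) ≤ ENNReal.ofReal (M * B) := by
    calc ∫⁻ q, ‖N q * g (p - q)‖ₑ ∂(haarG T)
        ≤ ∫⁻ q, ENNReal.ofReal M *
          (‖N q‖ₑ * ENNReal.ofReal ((1 + ‖p.2 - q.2‖) ^ (-A))) ∂(haarG T) := by
          refine lintegral_mono_ae ?_
          filter_upwards [hqmp.ae hgM] with q hq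
          rw [enorm_mul, mul_left_comm, ← ENNReal.ofReal_mul hM, ← ofReal_norm (g (p - q)),
            Real.norm_eq_abs]
          gcongr
          exact hq
      _ ≤ ENNReal.ofReal M * ENNReal.ofReal B := by
          rw [lintegral_const_mul' _ _ ENNReal.ofReal_ne_top]
          gcongr
      _ = _ := (ENNReal.ofReal_mul hM).symm
  refine ⟨⟨hN.mul (hg.comp_quasiMeasurePreserving hqmp), hle.trans_lt ENNReal.ofReal_lt_top⟩, ?_⟩
  have h2 : ‖convG N g p‖ₑ ≤ ENNReal.ofReal (M * B) :=
    (enorm_integral_le_lintegral_enorm _).trans hle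
  rw [← ofReal_norm, ENNReal.ofReal_le_ofReal_iff (by positivity)] at h2
  exact h2

end Convolution

/-! ### Euclidean norms of arrays and uniform convolution bounds -/

section Norms

lemma sqrt_sum_norm_sq_le {ι : Type*} (s : Finset ι) (a : ι → ℂ) :
    Real.sqrt (∑ i ∈ s, ‖a i‖ ^ 2) ≤ ∑ i ∈ s, ‖a i‖ :=
  Real.sqrt_le_iff.2 ⟨Finset.sum_nonneg fun _ _ => norm_nonneg _,
    Finset.sum_sq_le_sq_sum_of_nonneg fun _ _ => norm_nonneg _⟩

lemma absMatrix_eq {T : ℝ} (Γ : G T → Matrix (Fin 3) (Fin 3) ℂ) :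
    absMatrix Γ = fun p => Real.sqrt (∑ i : Fin 3 × Fin 3, ‖Γ p i.1 i.2‖ ^ 2) := by
  ext p
  rw [absMatrix, Fintype.sum_prod_type]

lemma absGrad_eq {T : ℝ} (DΓ : Fin 3 → G T → Matrix (Fin 3) (Fin 3) ℂ) :
    absGrad DΓ = fun p =>
      Real.sqrt (∑ i : Fin 3 × Fin 3 × Fin 3, ‖DΓ i.1 p i.2.1 i.2.2‖ ^ 2) := by
  ext p
  simp only [absGrad, Fintype.sum_prod_type]

variable {T : ℝ} [hT : Fact (0 < T)] {lam : ℝ}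

/-- Euclidean norm of an array of functions which agree almost everywhere with kernels. -/
lemma aestronglyMeasurable_sqrt_and_enorm_le {ι : Type*} [Fintype ι] {m : ℕ} {P : ι → E3 → ℂ}
    (hP : ∀ i, IsHomSymbol m (P i)) (hm : 2 ≤ m) (hlam : lam ≠ 0) {F : ι → G T → ℂ}
    (hF : ∀ i, F i =ᵐ[haarG T] kernelFun T lam (P i)) :
    AEStronglyMeasurable (fun p => Real.sqrt (∑ i, ‖F i p‖ ^ 2)) (haarG T) ∧
      ∀ᵐ p ∂(haarG T), ‖Real.sqrt (∑ i, ‖F i p‖ ^ 2)‖ₑ ≤ ∑ i, ‖kernelFun T lam (P i) p‖ₑ := by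
  have hall : ∀ᵐ p ∂(haarG T), ∀ i, F i p = kernelFun T lam (P i) p := ae_all_iff.2 hF
  refine ⟨?_, ?_⟩
  · refine Real.continuous_sqrt.comp_aestronglyMeasurable ?_
    refine Finset.aestronglyMeasurable_fun_sum _ fun i _ => ?_
    exact (((hP i).aestronglyMeasurable_kernelFun hm hlam).congr (hF i).symm).norm.pow 2
  · filter_upwards [hall] with p hp
    simp only [hp]
    rw [Real.enorm_of_nonneg (Real.sqrt_nonneg _)]
    refine (ENNReal.ofReal_le_ofReal (sqrt_sum_norm_sq_le _ _)).trans ?_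
    rw [ENNReal.ofReal_sum_of_nonneg fun _ _ => norm_nonneg _]
    simp only [ofReal_norm, le_refl]

/-- The constant is fixed before the representatives `F`, which enter only up to null sets. The
exponent `A'` allows part of the decay of `g` to be given up, as is needed when `A` exceeds the
decay of the kernel. -/
lemma exists_convolution_bound {ι : Type*} [Fintype ι] {m : ℕ} {P : ι → E3 → ℂ}
    (hP : ∀ i, IsHomSymbol m (P i)) (hm : 2 ≤ m) (hm3 : m ≤ 3) (hlam : lam ≠ 0)
    {A A' b ε : ℝ} (hb : 0 ≤ b) (hbA : b ≤ A') (hA : A' ≤ A)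
    (hbm : b ≤ m + 1) (hAm : 3 < A' + (m + 1) - b) (hε : 0 < ε) :
    ∃ C : ℝ, 0 ≤ C ∧ ∀ F : ι → G T → ℂ, (∀ i, F i =ᵐ[haarG T] kernelFun T lam (P i)) →
      ∀ (M : ℝ) (g : G T → ℝ), AEStronglyMeasurable g (haarG T) →
        (∀ᵐ p ∂(haarG T), |g p| ≤ M * (1 + ‖p.2‖) ^ (-A)) → ∀ (t : AddCircle T) (x : E3),
          ε ≤ ‖x‖ → 0 ≤ M ∧
          ConvExistsG (fun p => Real.sqrt (∑ i, ‖F i p‖ ^ 2)) g (t, x) ∧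
            |convG (fun p => Real.sqrt (∑ i, ‖F i p‖ ^ 2)) g (t, x)| ≤
              C * M * (1 + ‖x‖) ^ (-b) := by
  obtain ⟨C, hC0, hC⟩ := exists_lintegral_sum_kernelFun_mul_le (T := T) (Finset.univ : Finset ι)
    hP hm hm3 hlam hb hbA hbm hAm hε
  refine ⟨C, hC0, fun F hF M g hg hgM t x hx => ?_⟩
  have hM : 0 ≤ M := by
    obtain ⟨p, hp⟩ := hgM.exists
    exact nonneg_of_mul_nonneg_left ((abs_nonneg _).trans hp) (by positivity)
  obtain ⟨hmeas, hle⟩ := aestronglyMeasurable_sqrt_and_enorm_le hP hm hlam hF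
  have hgM' : ∀ᵐ p ∂(haarG T), |g p| ≤ M * (1 + ‖p.2‖) ^ (-A') := by
    filter_upwards [hgM] with p hp
    refine hp.trans ?_
    gcongr
    linarith [norm_nonneg p.2]
  have hbound := convExistsG_and_abs_convG_le hmeas hg hM
    (B := C * (1 + ‖x‖) ^ (-b)) (by positivity) hgM' (t, x) (by
      refine le_trans (lintegral_mono_ae ?_) (hC x hx)
      filter_upwards [hle] with q hq
      gcongr)
  exact ⟨hM, hbound.1, hbound.2.trans_eq (by ring)⟩

end Norms

end TPOseen

/-! ### The main theorem -/

theorem theorem3p3 (T : ℝ) [Fact (0 < T)] (lam : ℝ) (hlam : lam ≠ 0) :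
    (∃ Γ : TPOseen.G T → Matrix (Fin 3) (Fin 3) ℂ, TPOseen.IsGammaPerp T lam Γ) ∧
    (∃ DΓ : Fin 3 → TPOseen.G T → Matrix (Fin 3) (Fin 3) ℂ,
      TPOseen.IsGradGammaPerp T lam DΓ) ∧
    ∀ A : ℝ, 0 < A → ∀ ε : ℝ, 0 < ε → ∃ C : ℝ, 0 < C ∧
      ∀ (Γ : TPOseen.G T → Matrix (Fin 3) (Fin 3) ℂ)
        (DΓ : Fin 3 → TPOseen.G T → Matrix (Fin 3) (Fin 3) ℂ),
        TPOseen.IsGammaPerp T lam Γ → TPOseen.IsGradGammaPerp T lam DΓ →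
        ∀ (M : ℝ) (g : TPOseen.G T → ℝ), MemLp g ∞ (TPOseen.haarG T) →
          (∀ᵐ p ∂(TPOseen.haarG T), |g p| ≤ M * (1 + ‖p.2‖) ^ (-A)) →
          ∀ (t : AddCircle T) (x : TPOseen.E3), ε ≤ ‖x‖ →
            (TPOseen.ConvExistsG (TPOseen.absGrad DΓ) g (t, x) ∧
              |TPOseen.convG (TPOseen.absGrad DΓ) g (t, x)|
                ≤ C * M * (1 + ‖x‖) ^ (-min A 4)) ∧
            (3 < A →
              TPOseen.ConvExistsG (TPOseen.absMatrix Γ) g (t, x) ∧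
              |TPOseen.convG (TPOseen.absMatrix Γ) g (t, x)|
                ≤ C * M * (1 + ‖x‖) ^ (-3 : ℝ)) := by
  have hΓ₀ := TPOseen.isGammaPerp_kernelFun (T := T) hlam
  have hDΓ₀ := TPOseen.isGradGammaPerp_kernelFun (T := T) hlam
  refine ⟨⟨_, hΓ₀⟩, ⟨_, hDΓ₀⟩, fun A hA ε hε => ?_⟩
  obtain ⟨C₁, hC₁, h₁⟩ := TPOseen.exists_convolution_bound (T := T)
    (P := fun i : Fin 3 × Fin 3 × Fin 3 => TPOseen.gradNumerator i.1 i.2.1 i.2.2)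
    (fun i => TPOseen.isHomSymbol_gradNumerator _ _ _) (by norm_num) le_rfl hlam
    -- With `A' = b` the integrability condition reduces to `4 > 3`: the gradient kernel is
    -- integrable without any weight.
    (A := A) (A' := min A 4) (b := min A 4) (by positivity) le_rfl (min_le_left _ _)
    ((min_le_right _ _).trans (by norm_num)) (by push_cast; linarith) hε
  have h₂ : ∃ C₂ : ℝ, 0 ≤ C₂ ∧ (3 < A → ∀ Γ : TPOseen.G T → Matrix (Fin 3) (Fin 3) ℂ,
      TPOseen.IsGammaPerp T lam Γ → ∀ (M : ℝ) (g : TPOseen.G T → ℝ),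
        AEStronglyMeasurable g (TPOseen.haarG T) →
        (∀ᵐ p ∂(TPOseen.haarG T), |g p| ≤ M * (1 + ‖p.2‖) ^ (-A)) →
        ∀ (t : AddCircle T) (x : TPOseen.E3), ε ≤ ‖x‖ →
          TPOseen.ConvExistsG (TPOseen.absMatrix Γ) g (t, x) ∧
          |TPOseen.convG (TPOseen.absMatrix Γ) g (t, x)| ≤ C₂ * M * (1 + ‖x‖) ^ (-3 : ℝ)) := by
    by_cases hA3 : 3 < A
    · obtain ⟨C₂, hC₂, h₂⟩ := TPOseen.exists_convolution_bound (T := T)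
        (P := fun i : Fin 3 × Fin 3 => TPOseen.lerayNumerator i.1 i.2)
        (fun i => TPOseen.isHomSymbol_lerayNumerator _ _) le_rfl (by norm_num) hlam
        -- The velocity kernel decays only like `|x|⁻³`, so the condition becomes `A > 3`.
        (A := A) (A' := A) (b := 3) (by norm_num) hA3.le le_rfl (by norm_num)
        (by push_cast; linarith) hε
      refine ⟨C₂, hC₂, fun _ Γ hΓ M g hg hgM t x hx => ?_⟩
      rw [TPOseen.absMatrix_eq]
      exact (h₂ (fun i p => Γ p i.1 i.2) (fun i => (hΓ i.1 i.2).ae_eq (hΓ₀ i.1 i.2))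
        M g hg hgM t x hx).2
    · exact ⟨0, le_rfl, fun h => absurd h hA3⟩
  obtain ⟨C₂, hC₂, h₂⟩ := h₂
  -- The summand `1` only makes the constant positive.
  refine ⟨C₁ + C₂ + 1, by positivity, fun Γ DΓ hΓ hDΓ M g hg hgM t x hx => ?_⟩
  obtain ⟨hM, hconv, hle⟩ := h₁ (fun i p => DΓ i.1 p i.2.1 i.2.2)
    (fun i => (hDΓ i.1 i.2.1 i.2.2).ae_eq (hDΓ₀ i.1 i.2.1 i.2.2))
    M g hg.aestronglyMeasurable hgM t x hx
  refine ⟨?_, fun hA3 => ?_⟩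
  · rw [TPOseen.absGrad_eq]
    refine ⟨hconv, hle.trans ?_⟩
    gcongr
    linarith
  · obtain ⟨hconv, hle⟩ := h₂ hA3 Γ hΓ M g hg.aestronglyMeasurable hgM t x hx
    refine ⟨hconv, hle.trans ?_⟩
    gcongr
    linarith
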